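/- Setting. A Lefschetz fibration is a smooth map \(f:X\to\Sigma\) from a compact connected smooth 4-manifold \(X\) to a compact connected orientable smooth surface \(\Sigma\) (both possibly with boundary) such that \(\partial X=f^{-1}(\partial\Sigma)\), \(\mathrm{Crit}(f)\subset\mathrm{Int}(X)\), and for each \(x\in\mathrm{Crit}(f)\) there are smooth charts \(\varphi:U\to\mathbb C^2\) about \(x\) and \(\psi:V\to\mathbb C\) about \(f(x)\), with \(f(U)\subset V\), in which \(f\) is \((z,w)\mapsto zw\) ("Lefschetz charts"). Put \(\Delta_f=f(\mathrm{Crit}(f))\). Let \(\Sigma_h\subset\mathbb R^3\) be a closed connected orientable surface of genus \(h\) that is symmetric about the origin and does not contain it, let \(J(v)=-v\) be its antipodal map, and let \(\widetilde J:\Sigma_{g-1}\to\Sigma_{g-1}/J=N_g\) be the quotient map onto the closed non-orientable surface of genus \(g\ge 1\). The fibration \(f\) is non-orientable of genus \(g\) if \(X\) is non-orientable and all fibers over \(\Sigma-\Delta_f\) are diffeomorphic to \(N_g\). Let \(\pi:\widetilde X\to X\), \(\pi(p,o)=p\), be the standard orientation double covering, where \(\widetilde X\) is the set of pairs of a point \(p\in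 X\) and an orientation \(o\) of \(T_pX\), and let \(\tau(p,o)=(p,-o)\). Vanishing cycles. Let \(x_0\in\mathrm{Crit}(f)\) and let \(\ell:[0,1]\to\Sigma\) be a smooth embedding with \(\ell(0)=f(x_0)\) and \(\ell(t)\notin\Delta_f\) for \(t\in(0,1]\). Choose Lefschetz charts \(\varphi,\psi\) about \(x_0\) and \(\delta\in(0,1]\) so small that \(\ell(t)\) lies in the domain of \(\psi\) and \(\{zw=\psi(\ell(t)),\ |z|=|w|\}\) lies in the range of \(\varphi\) for all \(t\in[0,\delta]\). Let \(C\subset f^{-1}(\ell(\delta))\) be the curve that corresponds under \(\varphi\) to \(\{zw=\psi(\ell(\delta)),\ |z|=|w|\}\), let \(W\) be a smooth vector field on \(f^{-1}(\ell([\delta,1]))\) which \(f\) projects to the velocity of \(\ell\), and let \(\Upsilon:f^{-1}(\ell(\delta))\to f^{-1}(\ell(1))\) be the identification of fibers by the flow of \(W\). Each curve \(\Upsilon(C)\) obtained in this way is called a vanishing cycle of \(f\) at \(x_0\) determined by \(\ell\) (it is considered up to isotopy in the fiber). Proposition. Let \(f:X\to\Sigma\) be a non-orientable Lefschetz fibration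 of genus \(g\ge1\) and \(\pi:\widetilde X\to X\) the standard orientation double covering. (0) \(f\circ\pi\) is an orientable Lefschetz fibration, achiral if \(\mathrm{Crit}(f)\neq\emptyset\) (for any orientation of \(\widetilde X\), some critical point has an orientation reversing Lefschetz chart \(\varphi\)). It has genus \(g-1\): for each \(y\in\Sigma-\Delta_f\) and each diffeomorphism \(\Xi:f^{-1}(y)\to N_g\) there is a diffeomorphism \(\widetilde\Xi:(f\circ\pi)^{-1}(y)\to\Sigma_{g-1}\) with \(\Xi\circ\pi=\widetilde J\circ\widetilde\Xi\). (1) Let \(c\) be a vanishing cycle of \(f\) at \(x_0\) determined by \(\ell\), and let \(\tilde x_0\in\pi^{-1}(x_0)\). Then \(\pi^{-1}(c)=c_1\amalg c_2\), where \(c_1\) and \(c_2=\tau(c_1)\) are vanishing cycles of \(f\circ\pi\) determined by \(\ell\), at \(\tilde x_0\) and at \(\tau(\tilde x_0)\) respectively. They are in antipodal position on \(\Sigma_{g-1}\): \(\widetilde\Xi(c_2)=J(\widetilde\Xi(c_1))\) for all diffeomorphisms \(\Xi:f^{-1}(\ell(1))\to N_g\) and \(\widetilde\Xi:(f\circ\pi)^{-1}(\ell(1))\to\Sigma_{g-1}\)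 with \(\Xi\circ\pi=\widetilde J\circ\widetilde\Xi\). (2) Each vanishing cycle \(\tilde c\) of \(f\circ\pi\) arises in this way: if \(\tilde c\) is a vanishing cycle of \(f\circ\pi\) at \(\tilde x_0\) determined by \(\ell\), then there is a vanishing cycle \(c\) of \(f\) at \(\pi(\tilde x_0)\) determined by \(\ell\), with \(\pi^{-1}(c)=c_1\amalg c_2\) as in (1), such that \(\tilde c\) is isotopic to \(c_1\) in the fiber \((f\circ\pi)^{-1}(\ell(1))\) (through simple closed curves). (3) Every vanishing cycle \(c\) of \(f\) determined by \(\ell\) is two-sided: it is the core of an open annulus in the surface \(f^{-1}(\ell(1))\). -/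

import Mathlib

open Set Topology Manifold ContDiff

noncomputable section OrientationCoverConstruction

/-- The set of the two orientations of `ℝⁿ`, with the discrete topology. -/
abbrev ModelOrientation (n : ℕ) : Type :=
  Orientation ℝ (EuclideanSpace ℝ (Fin n)) (Fin n)

instance (n : ℕ) : TopologicalSpace (ModelOrientation n) := ⊥

instance (n : ℕ) : DiscreteTopology (ModelOrientation n) := ⟨rfl⟩

/-- The action of an invertible linear map on orientations (the identity if `A` is singular). -/
def pushOrientation {n : ℕ} (A : EuclideanSpace ℝ (Fin n) →L[ℝ] EuclideanSpace ℝ (Fin n))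
    (o : ModelOrientation n) : ModelOrientation n :=
  open Classical in
  if h : LinearMap.det A.toLinearMap ≠ 0 then
    Orientation.map (Fin n) (LinearMap.equivOfDetNeZero A.toLinearMap h) o
  else o

theorem pushOrientation_of_pos {n : ℕ}
    {A : EuclideanSpace ℝ (Fin n) →L[ℝ] EuclideanSpace ℝ (Fin n)}
    (h : 0 < LinearMap.det A.toLinearMap) (o : ModelOrientation n) : pushOrientation A o = o := by
  rw [pushOrientation, dif_pos h.ne']
  refine (Orientation.map_eq_iff_det_pos (ι := Fin n) o _ (by simp)).2 ?_
  exact h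

theorem pushOrientation_of_neg {n : ℕ}
    {A : EuclideanSpace ℝ (Fin n) →L[ℝ] EuclideanSpace ℝ (Fin n)}
    (h : LinearMap.det A.toLinearMap < 0) (o : ModelOrientation n) :
    pushOrientation A o = -o := by
  rw [pushOrientation, dif_pos h.ne]
  refine (Orientation.map_eq_neg_iff_det_neg (ι := Fin n) o _ (by simp)).2 ?_
  exact h

theorem continuous_det_clm (n : ℕ) :
    Continuous fun A : EuclideanSpace ℝ (Fin n) →L[ℝ] EuclideanSpace ℝ (Fin n) =>
      LinearMap.det A.toLinearMap :=
  ContinuousLinearMap.continuous_det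

variable {n : ℕ} {H : Type*} [TopologicalSpace H]
  (I : ModelWithCorners ℝ (EuclideanSpace ℝ (Fin n)) H)
  (M : Type*) [TopologicalSpace M] [ChartedSpace H M]

theorem det_coordChange_mul [IsManifold I 1 M] (i j k : atlas H M) (x : M)
    (hx : x ∈ i.1.source ∩ j.1.source ∩ k.1.source) :
    LinearMap.det ((tangentBundleCore I M).coordChange j k x).toLinearMap *
      LinearMap.det ((tangentBundleCore I M).coordChange i j x).toLinearMap =
      LinearMap.det ((tangentBundleCore I M).coordChange i k x).toLinearMap := by
  rw [← LinearMap.det_comp]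
  congr 1
  ext1 v
  exact (tangentBundleCore I M).coordChange_comp i j k x hx v

theorem det_coordChange_self [IsManifold I 1 M] (i : atlas H M) (x : M) (hx : x ∈ i.1.source) :
    LinearMap.det ((tangentBundleCore I M).coordChange i i x).toLinearMap = 1 := by
  rw [← LinearMap.det_id (A := ℝ) (M := EuclideanSpace ℝ (Fin n))]
  congr 1
  ext1 v
  exact (tangentBundleCore I M).coordChange_self i x hx v

theorem det_coordChange_ne_zero [IsManifold I 1 M] (i j : atlas H M) (x : M)
    (hx : x ∈ i.1.source ∩ j.1.source) :
    LinearMap.det ((tangentBundleCore I M).coordChange i j x).toLinearMap ≠ 0 := by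
  intro h
  have := det_coordChange_mul I M i j i x ⟨hx, hx.1⟩
  rw [h, mul_zero, det_coordChange_self I M i x hx.1] at this
  exact zero_ne_one this

/-- The bundle of orientations of the tangent spaces of `M`, glued in the same way as the tangent
bundle: the fibre over `x` consists of the two orientations of `TangentSpace I x`. -/
def orientationBundleCore [IsManifold I 1 M] :
    FiberBundleCore (atlas H M) M (ModelOrientation n) where
  baseSet i := i.1.source
  isOpen_baseSet i := i.1.open_source
  indexAt := achart H
  mem_baseSet_at := mem_chart_source H
  coordChange i j x := pushOrientation ((tangentBundleCore I M).coordChange i j x)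
  coordChange_self i x hx v := by
    apply pushOrientation_of_pos
    rw [det_coordChange_self I M i x hx]
    exact one_pos
  continuousOn_coordChange i j := by
    rintro ⟨x, o⟩ ⟨hx, -⟩
    have hc : ContinuousAt (fun y =>
        LinearMap.det ((tangentBundleCore I M).coordChange i j y).toLinearMap) x :=
      ((continuous_det_clm n).comp_continuousOn
        ((tangentBundleCore I M).continuousOn_coordChange i j)).continuousAt
          ((i.1.open_source.inter j.1.open_source).mem_nhds hx)
    have h1 : ∀ᶠ p : M × ModelOrientation n in 𝓝 (x, o), p.2 = o := by
      have : ∀ᶠ q in 𝓝 o, q = o := by simp [nhds_discrete]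
      exact (continuous_snd.continuousAt (x := (x, o))).eventually this
    apply ContinuousAt.continuousWithinAt
    rcases lt_or_gt_of_ne (det_coordChange_ne_zero I M i j x hx) with h | h
    · have h2 : ∀ᶠ p : M × ModelOrientation n in 𝓝 (x, o),
          LinearMap.det ((tangentBundleCore I M).coordChange i j p.1).toLinearMap < 0 :=
        (continuous_fst.continuousAt (x := (x, o))).eventually (hc.eventually (gt_mem_nhds h))
      refine (continuousAt_const (y := pushOrientation
        ((tangentBundleCore I M).coordChange i j x) o)).congr ?_
      filter_upwards [h1, h2] with p hp1 hp2
      rw [hp1, pushOrientation_of_neg h, pushOrientation_of_neg hp2]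
    · have h2 : ∀ᶠ p : M × ModelOrientation n in 𝓝 (x, o),
          0 < LinearMap.det ((tangentBundleCore I M).coordChange i j p.1).toLinearMap :=
        (continuous_fst.continuousAt (x := (x, o))).eventually (hc.eventually (lt_mem_nhds h))
      refine (continuousAt_const (y := pushOrientation
        ((tangentBundleCore I M).coordChange i j x) o)).congr ?_
      filter_upwards [h1, h2] with p hp1 hp2
      rw [hp1, pushOrientation_of_pos h, pushOrientation_of_pos hp2]
  coordChange_comp i j k x hx v := by
    have h := det_coordChange_mul I M i j k x hx
    rcases lt_or_gt_of_ne (det_coordChange_ne_zero I M i j x hx.1) with h1 | h1 <;>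
    rcases lt_or_gt_of_ne (det_coordChange_ne_zero I M j k x ⟨hx.1.2, hx.2⟩) with h2 | h2
    · rw [pushOrientation_of_neg h1, pushOrientation_of_neg h2,
        pushOrientation_of_pos (h ▸ mul_pos_of_neg_of_neg h2 h1)]
      exact neg_neg v
    · rw [pushOrientation_of_neg h1, pushOrientation_of_pos h2,
        pushOrientation_of_neg (h ▸ mul_neg_of_pos_of_neg h2 h1)]
    · rw [pushOrientation_of_pos h1, pushOrientation_of_neg h2,
        pushOrientation_of_neg (h ▸ mul_neg_of_neg_of_pos h2 h1)]
    · rw [pushOrientation_of_pos h1, pushOrientation_of_pos h2,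
        pushOrientation_of_pos (h ▸ mul_pos h2 h1)]

/-- The total space `M̃` of the standard orientation double covering of `M`: the set of pairs
`(p, o)` of a point `p` of `M` and an orientation `o` of the tangent space at `p`. -/
def OrientationCover [IsManifold I 1 M] : Type _ := (orientationBundleCore I M).TotalSpace

namespace OrientationCover

variable [IsManifold I 1 M]

instance : TopologicalSpace (OrientationCover I M) :=
  inferInstanceAs (TopologicalSpace (orientationBundleCore I M).TotalSpace)

variable {I M}

/-- The standard orientation double covering map `(p, o) ↦ p`. -/
def proj (p : OrientationCover I M) : M := (orientationBundleCore I M).proj p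

/-- The orientation `o` of the tangent space at `p` in a point `(p, o)` of the covering space. -/
def orientation (p : OrientationCover I M) : Orientation ℝ (TangentSpace I p.proj) (Fin n) :=
  Bundle.TotalSpace.snd p

/-- The point `(p, o)` of the covering space. -/
def mk (p : M) (o : Orientation ℝ (TangentSpace I p) (Fin n)) : OrientationCover I M :=
  ⟨p, o⟩

/-- The covering involution `(p, o) ↦ (p, -o)`. -/
def flip (p : OrientationCover I M) : OrientationCover I M := mk p.proj (-p.orientation)

theorem isLocalHomeomorph_proj : IsLocalHomeomorph (proj : OrientationCover I M → M) := by
  have : IsCoveringMap ((orientationBundleCore I M).proj) :=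
    FiberBundle.isCoveringMap (F := ModelOrientation n) (E := (orientationBundleCore I M).Fiber)
  exact this.isLocalHomeomorph


/-- The smooth structure on the covering space: its charts are `φ ∘ π` where `π` is injective and
`φ` is a chart of `M`. -/
instance : ChartedSpace H (OrientationCover I M) where
  atlas := {c | ∃ e : OpenPartialHomeomorph (OrientationCover I M) M, (e : _ → M) = proj ∧
    ∃ φ ∈ atlas H M, c = e.trans φ}
  chartAt p := (isLocalHomeomorph_proj.localInverseAt p).symm.trans (chartAt H p.proj)
  mem_chart_source p := by
    simp
  chart_mem_atlas p := ⟨_, by simp, _, chart_mem_atlas H _, rfl⟩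

instance [IsManifold I ∞ M] : IsManifold I ∞ (OrientationCover I M) := by
  apply isManifold_of_contDiffOn
  rintro _ _ ⟨e, he, φ, hφ, rfl⟩ ⟨e', he', φ', hφ', rfl⟩
  have h := (StructureGroupoid.compatible (contDiffGroupoid ∞ I) hφ hφ').1
  have key : ∀ y ∈ ((e.trans φ).symm.trans (e'.trans φ')).source,
      e' (e.symm (φ.symm y)) = φ.symm y := by
    intro y hy
    simp only [mfld_simps] at hy
    rw [he', ← he, e.right_inv hy.1.2]
  refine (h.mono ?_).congr ?_
  · rintro y ⟨hy, hy'⟩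
    refine ⟨?_, hy'⟩
    have hk := key _ hy
    simp only [mfld_simps] at hy hk ⊢
    rw [hk] at hy
    exact ⟨hy.1.1, hy.2.2⟩
  · rintro y ⟨hy, hy'⟩
    have hk := key _ hy
    simp only [mfld_simps] at hk ⊢
    rw [hk]

end OrientationCover
end OrientationCoverConstruction

noncomputable section ModelSurfaces

/-- The planar function `(R² - x² - y²) ∏ᵢ ((x - aᵢ)² + y² - 1/4)` with `R = h + 1` and
`aᵢ = 2i + 1 - h` for `0 ≤ i < h`. The set where it is nonnegative is the closed disc of radius
`h + 1` with the `h` disjoint open discs of radius `1/2` about the points `(aᵢ, 0)` removed. -/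
def holedDisc (h : ℕ) (x y : ℝ) : ℝ :=
  (((h : ℝ) + 1) ^ 2 - x ^ 2 - y ^ 2) *
    ∏ i ∈ Finset.range h, ((x - (2 * i + 1 - h)) ^ 2 + y ^ 2 - 1 / 4)

/-- The defining function `z² - holedDisc h x y` of the surface of genus `h`. -/
def surfaceEq (h : ℕ) (v : EuclideanSpace ℝ (Fin 3)) : ℝ :=
  v 2 ^ 2 - holedDisc h (v 0) (v 1)

/-- The closed orientable surface `Σ_h` of genus `h`: the double of a disc with `h` holes, embedded
in `ℝ³` as the surface `z² = holedDisc h x y`, symmetrically about the origin. -/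
abbrev GenusSurface (h : ℕ) : Type := {v : EuclideanSpace ℝ (Fin 3) // surfaceEq h v = 0}

theorem contDiff_surfaceEq (h : ℕ) : ContDiff ℝ ∞ (surfaceEq h) := by
  unfold surfaceEq holedDisc
  have h0 (i : Fin 3) : ContDiff ℝ ∞ fun v : EuclideanSpace ℝ (Fin 3) => v i := by fun_prop
  have h3 : ContDiff ℝ ∞ fun v : EuclideanSpace ℝ (Fin 3) =>
      ∏ i ∈ Finset.range h, ((v 0 - (2 * i + 1 - h)) ^ 2 + v 1 ^ 2 - 1 / 4) :=
    contDiff_prod fun i _ => by fun_prop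
  fun_prop

theorem holedDisc_neg (h : ℕ) (x y : ℝ) : holedDisc h (-x) (-y) = holedDisc h x y := by
  unfold holedDisc
  rw [← Finset.prod_range_reflect]
  congr 1
  · ring
  · refine Finset.prod_congr rfl fun i hi => ?_
    have hi := Finset.mem_range.1 hi
    have : ((h - 1 - i : ℕ) : ℝ) = h - 1 - i := by
      rw [Nat.sub_sub, Nat.cast_sub (by omega)]; push_cast; ring
    rw [this]; ring

theorem surfaceEq_neg (h : ℕ) (v : EuclideanSpace ℝ (Fin 3)) :
    surfaceEq h (-v) = surfaceEq h v := by
  simp [surfaceEq, holedDisc_neg]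

theorem holedDisc_zero_ne (h : ℕ) : holedDisc h 0 0 ≠ 0 := by
  unfold holedDisc
  refine mul_ne_zero ?_ (Finset.prod_ne_zero_iff.2 fun i hi h0 => ?_)
  · have : 0 < (h : ℝ) + 1 := by positivity
    simp [this.ne']
  have h1 : ((4 * (2 * i + 1 - h) ^ 2 : ℤ) : ℝ) = (1 : ℤ) := by push_cast; linarith
  have h2 : (4 * (2 * i + 1 - h) ^ 2 : ℤ) = 1 := by exact_mod_cast h1
  omega

theorem fderiv_ne_zero_of_line {F : EuclideanSpace ℝ (Fin 3) → ℝ} {v : EuclideanSpace ℝ (Fin 3)}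
    (hF : DifferentiableAt ℝ F v) (w : EuclideanSpace ℝ (Fin 3)) {c : ℝ} (hc : c ≠ 0)
    (h : HasDerivAt (fun t : ℝ => F (v + t • w)) c 0) : fderiv ℝ F v ≠ 0 := by
  intro h0
  have h1 : HasDerivAt (fun t : ℝ => v + t • w) w 0 := by
    simpa using ((hasDerivAt_id (0 : ℝ)).smul_const w).const_add v
  have h2 : HasFDerivAt F (fderiv ℝ F v) (v + (0 : ℝ) • w) := by simpa using hF.hasFDerivAt
  have h3 := h2.comp_hasDerivAt 0 h1
  rw [h0] at h3
  exact hc (h.unique h3)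

theorem hasDerivAt_mul_of_zero {A B : ℝ → ℝ} {a : ℝ} (hA : HasDerivAt A a 0) (hA0 : A 0 = 0)
    (hB : DifferentiableAt ℝ B 0) : HasDerivAt (fun t => A t * B t) (a * B 0) 0 := by
  have := hA.mul hB.hasDerivAt
  rw [hA0, zero_mul, add_zero] at this
  exact this

/-- On the outer circle none of the inner circles passes. -/
theorem outer_inner_ne {h : ℕ} {x y : ℝ} (h0 : ((h : ℝ) + 1) ^ 2 - x ^ 2 - y ^ 2 = 0) {i : ℕ}
    (hi : i < h) : (x - (2 * i + 1 - h)) ^ 2 + y ^ 2 - 1 / 4 ≠ 0 := by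
  intro h1
  have hi' : (i : ℝ) + 1 ≤ h := by exact_mod_cast hi
  have hi0 : (0 : ℝ) ≤ i := by positivity
  set a : ℝ := 2 * i + 1 - h with ha
  have h2 : a ^ 2 ≤ (h - 1 : ℝ) ^ 2 := by
    apply sq_le_sq'
    · linarith
    · linarith
  nlinarith [sq_nonneg (x - a - a), sq_nonneg (2 * (x - a) - a), sq_nonneg (x - a)]

theorem inner_inner_ne {h : ℕ} {x y : ℝ} {i j : ℕ} (hij : i ≠ j)
    (h0 : (x - (2 * i + 1 - h)) ^ 2 + y ^ 2 - 1 / 4 = 0) :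
    (x - (2 * j + 1 - h)) ^ 2 + y ^ 2 - 1 / 4 ≠ 0 := by
  intro h1
  have h2 : (1 : ℝ) ≤ ((i : ℝ) - j) ^ 2 := by
    have : (1 : ℤ) ≤ ((i : ℤ) - j) ^ 2 := by
      have : ((i : ℤ) - j) ≠ 0 := by omega
      have := sq_pos_of_ne_zero this
      omega
    exact_mod_cast this
  nlinarith [sq_nonneg (x - (2 * i + 1 - h) + (x - (2 * j + 1 - h))), sq_nonneg y]

theorem surfaceEq_line (h : ℕ) (v : EuclideanSpace ℝ (Fin 3)) (a b c t : ℝ) :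
    surfaceEq h (v + t • !₂[a, b, c]) =
      (v 2 + t * c) ^ 2 - holedDisc h (v 0 + t * a) (v 1 + t * b) := by
  simp [surfaceEq]

theorem fderiv_surfaceEq_ne_zero {h : ℕ} {v : EuclideanSpace ℝ (Fin 3)} (hv : surfaceEq h v = 0) :
    fderiv ℝ (surfaceEq h) v ≠ 0 := by
  have hd : DifferentiableAt ℝ (surfaceEq h) v :=
    (contDiff_surfaceEq h).differentiable (by simp) v
  by_cases hz : v 2 = 0
  · have hP : holedDisc h (v 0) (v 1) = 0 := by simpa [surfaceEq, hz] using hv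
    have hP' := hP
    unfold holedDisc at hP
    rcases mul_eq_zero.1 hP with h0 | h0
    · refine fderiv_ne_zero_of_line hd !₂[v 0, v 1, 0]
        (c := -((-2 * ((h : ℝ) + 1) ^ 2) * ∏ i ∈ Finset.range h,
          ((v 0 + 0 * v 0 - (2 * i + 1 - h)) ^ 2 + (v 1 + 0 * v 1) ^ 2 - 1 / 4))) ?_ ?_
      · refine neg_ne_zero.2 (mul_ne_zero ?_ (Finset.prod_ne_zero_iff.2 fun i hi => ?_))
        · have : 0 < ((h : ℝ) + 1) ^ 2 := by positivity
          linarith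
        · simpa using outer_inner_ne h0 (Finset.mem_range.1 hi)
      · have hA : HasDerivAt (fun t : ℝ => ((h : ℝ) + 1) ^ 2 - (v 0 + t * v 0) ^ 2
            - (v 1 + t * v 1) ^ 2) (-2 * ((h : ℝ) + 1) ^ 2) 0 := by
          have := (((((hasDerivAt_id (0 : ℝ)).mul_const (v 0)).const_add (v 0)).pow 2).const_sub
            (((h : ℝ) + 1) ^ 2)).sub
              ((((hasDerivAt_id (0 : ℝ)).mul_const (v 1)).const_add (v 1)).pow 2)
          refine this.congr_deriv ?_
          simp
          linarith
        have := (hasDerivAt_mul_of_zero hA (by simpa using h0) (B := fun t => ∏ i ∈ Finset.range h,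
          ((v 0 + t * v 0 - (2 * i + 1 - h)) ^ 2 + (v 1 + t * v 1) ^ 2 - 1 / 4)) (by fun_prop)).neg
        refine this.congr_of_eventuallyEq (Filter.Eventually.of_forall fun t => ?_)
        simp only [surfaceEq_line, hz, holedDisc]
        simp
    · obtain ⟨i, hi, h0⟩ := Finset.prod_eq_zero_iff.1 h0
      set p : ℝ := v 0 - (2 * i + 1 - h) with hp
      refine fderiv_ne_zero_of_line hd !₂[p, v 1, 0]
        (c := -((1 / 2) * ((((h : ℝ) + 1) ^ 2 - (v 0 + 0 * p) ^ 2 - (v 1 + 0 * v 1) ^ 2) *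
          ∏ j ∈ (Finset.range h).erase i,
          ((v 0 + 0 * p - (2 * j + 1 - h)) ^ 2 + (v 1 + 0 * v 1) ^ 2 - 1 / 4)))) ?_ ?_
      · refine neg_ne_zero.2 (mul_ne_zero (by norm_num) (mul_ne_zero ?_
          (Finset.prod_ne_zero_iff.2 fun j hj => ?_)))
        · intro h1
          exact outer_inner_ne (by simpa using h1) (Finset.mem_range.1 hi) h0
        · simpa using inner_inner_ne (Finset.ne_of_mem_erase hj).symm h0
      · have hA : HasDerivAt (fun t : ℝ => (v 0 + t * p - (2 * i + 1 - h)) ^ 2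
            + (v 1 + t * v 1) ^ 2 - 1 / 4) (1 / 2) 0 := by
          have := ((((((hasDerivAt_id (0 : ℝ)).mul_const p).const_add (v 0)).sub_const
            (2 * (i : ℝ) + 1 - h)).pow 2).add
              ((((hasDerivAt_id (0 : ℝ)).mul_const (v 1)).const_add (v 1)).pow 2)).sub_const
                (1 / 4)
          refine this.congr_deriv ?_
          simp
          rw [← hp]
          linarith
        have := (hasDerivAt_mul_of_zero hA (by simpa using h0) (B := fun t =>
          (((h : ℝ) + 1) ^ 2 - (v 0 + t * p) ^ 2 - (v 1 + t * v 1) ^ 2) *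
          ∏ j ∈ (Finset.range h).erase i,
          ((v 0 + t * p - (2 * j + 1 - h)) ^ 2 + (v 1 + t * v 1) ^ 2 - 1 / 4)) (by fun_prop)).neg
        refine this.congr_of_eventuallyEq (Filter.Eventually.of_forall fun t => ?_)
        simp only [surfaceEq_line, hz, holedDisc]
        rw [← Finset.mul_prod_erase _ _ hi]
        simp
        ring
  · refine fderiv_ne_zero_of_line hd !₂[0, 0, 1] (c := 2 * v 2) (by simpa using hz) ?_
    have := ((((hasDerivAt_id (0 : ℝ)).const_add (v 2)).pow 2).sub_const
      (holedDisc h (v 0) (v 1)))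
    refine (this.congr_deriv (by simp)).congr_of_eventuallyEq
      (Filter.Eventually.of_forall fun t => ?_)
    simp [surfaceEq_line]

/-- A linear form that does not vanish is the last coordinate of a linear isomorphism. -/
theorem exists_transverse (a : EuclideanSpace ℝ (Fin 3) →L[ℝ] ℝ) (ha : a ≠ 0) :
    ∃ A : EuclideanSpace ℝ (Fin 3) ≃L[ℝ] EuclideanSpace ℝ (Fin 2) × ℝ, ∀ v, (A v).2 = a v := by
  obtain ⟨w, hw⟩ : ∃ w, a w = 1 := by
    obtain ⟨u, hu⟩ : ∃ u, a u ≠ 0 := by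
      by_contra! h
      exact ha (ContinuousLinearMap.ext h)
    exact ⟨(a u)⁻¹ • u, by simp [hu]⟩
  have hs : Function.Surjective a.toLinearMap := fun t => ⟨t • w, by simp [hw]⟩
  have hr : Module.finrank ℝ (LinearMap.ker a.toLinearMap) =
      Module.finrank ℝ (EuclideanSpace ℝ (Fin 2)) := by
    have := LinearMap.finrank_range_add_finrank_ker a.toLinearMap
    rw [LinearMap.range_eq_top.2 hs] at this
    simp at this ⊢
    omega
  let e : LinearMap.ker a.toLinearMap ≃ₗ[ℝ] EuclideanSpace ℝ (Fin 2) :=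
    LinearEquiv.ofFinrankEq _ _ hr
  let B : (EuclideanSpace ℝ (Fin 2) × ℝ) →ₗ[ℝ] EuclideanSpace ℝ (Fin 3) :=
    LinearMap.coprod ((LinearMap.ker a.toLinearMap).subtype ∘ₗ e.symm.toLinearMap)
      (LinearMap.toSpanSingleton ℝ _ w)
  have haB : ∀ p, a (B p) = p.2 := by
    rintro ⟨u, t⟩
    have : a (e.symm u : EuclideanSpace ℝ (Fin 3)) = 0 := (e.symm u).2
    simp [B, hw, this]
  have hB : Function.Injective B := by
    rw [← LinearMap.ker_eq_bot, LinearMap.ker_eq_bot']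
    rintro ⟨u, t⟩ h
    have ht : t = 0 := by simpa [h] using (haB (u, t)).symm
    subst ht
    have : (e.symm u : EuclideanSpace ℝ (Fin 3)) = 0 := by simpa [B] using h
    have : u = 0 := by simpa using this
    simp [this]
  let C := (LinearEquiv.ofInjectiveOfFinrankEq B hB (by simp)).toContinuousLinearEquiv
  refine ⟨C.symm, fun v => ?_⟩
  obtain ⟨p, rfl⟩ := C.surjective v
  rw [C.symm_apply_apply]
  exact (haB p).symm

namespace GenusSurface

variable {h : ℕ}

instance : LocallyCompactSpace (GenusSurface h) :=
  IsClosed.locallyCompactSpace (X := EuclideanSpace ℝ (Fin 3))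
    (s := {v | surfaceEq h v = 0})
    (isClosed_singleton.preimage (contDiff_surfaceEq h).continuous)

/-- A linear isomorphism of `ℝ³` with `ℝ² × ℝ` whose last coordinate is the differential of the
defining equation at `p`. -/
def frame (p : GenusSurface h) :
    EuclideanSpace ℝ (Fin 3) ≃L[ℝ] EuclideanSpace ℝ (Fin 2) × ℝ :=
  (exists_transverse _ (fderiv_surfaceEq_ne_zero p.2)).choose

/-- Near `p`, two linear coordinates and the defining equation are coordinates of `ℝ³`. -/
def straighten (p : GenusSurface h) (v : EuclideanSpace ℝ (Fin 3)) :
    EuclideanSpace ℝ (Fin 2) × ℝ :=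
  ((frame p v).1, surfaceEq h v)

theorem contDiff_straighten (p : GenusSurface h) : ContDiff ℝ ∞ (straighten p) :=
  ((contDiff_fst.comp (frame p).contDiff)).prodMk (contDiff_surfaceEq h)

theorem fderiv_straighten (p : GenusSurface h) :
    HasFDerivAt (straighten p)
      (frame p : EuclideanSpace ℝ (Fin 3) →L[ℝ] EuclideanSpace ℝ (Fin 2) × ℝ) p.1 := by
  have h1 : HasFDerivAt (fun v => (frame p v).1) ((ContinuousLinearMap.fst ℝ _ _).comp
      (frame p : EuclideanSpace ℝ (Fin 3) →L[ℝ] EuclideanSpace ℝ (Fin 2) × ℝ)) p.1 :=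
    ((ContinuousLinearMap.fst ℝ _ _).comp
      (frame p : EuclideanSpace ℝ (Fin 3) →L[ℝ] EuclideanSpace ℝ (Fin 2) × ℝ)).hasFDerivAt
  have h2 : HasFDerivAt (surfaceEq h) (fderiv ℝ (surfaceEq h) p.1) p.1 :=
    ((contDiff_surfaceEq h).differentiable (by simp) _).hasFDerivAt
  refine (h1.prodMk h2).congr_fderiv ?_
  ext1 v
  exact Prod.ext rfl ((exists_transverse _ (fderiv_surfaceEq_ne_zero p.2)).choose_spec v).symm

/-- The local coordinates of `ℝ³` about `p` adapted to the surface. -/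
def ambientChart (p : GenusSurface h) :
    OpenPartialHomeomorph (EuclideanSpace ℝ (Fin 3)) (EuclideanSpace ℝ (Fin 2) × ℝ) :=
  ((contDiff_straighten p).contDiffAt.toOpenPartialHomeomorph (straighten p)
    (fderiv_straighten p) (by simp)).restrOpen
      ((fderiv ℝ (straighten p)) ⁻¹' range ContinuousLinearEquiv.toContinuousLinearMap)
      (ContinuousLinearEquiv.isOpen.preimage ((contDiff_straighten p).continuous_fderiv (by simp)))

theorem coe_ambientChart (p : GenusSurface h) : (ambientChart p : _ → _) = straighten p := rfl

theorem mem_ambientChart_source (p : GenusSurface h) : p.1 ∈ (ambientChart p).source :=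
  ⟨ContDiffAt.mem_toOpenPartialHomeomorph_source _ _ _,
    ⟨frame p, (fderiv_straighten p).fderiv.symm⟩⟩

theorem contDiffOn_ambientChart_symm (p : GenusSurface h) :
    ContDiffOn ℝ ∞ (ambientChart p).symm (ambientChart p).target := by
  intro y hy
  obtain ⟨A, hA⟩ := ((ambientChart p).map_target hy).2
  refine ((ambientChart p).contDiffAt_symm hy (f₀' := A) ?_
    (contDiff_straighten p).contDiffAt).contDiffWithinAt
  rw [hA]
  exact ((contDiff_straighten p).differentiable (by simp) _).hasFDerivAt

theorem ambientChart_symm_mem (p : GenusSurface h) {u : EuclideanSpace ℝ (Fin 2)}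
    (hu : (u, (0 : ℝ)) ∈ (ambientChart p).target) :
    surfaceEq h ((ambientChart p).symm (u, 0)) = 0 :=
  congrArg Prod.snd ((ambientChart p).right_inv hu)

open Classical in
/-- The chart of the surface about `p`: two linear coordinates of `ℝ³`. -/
def chart (p : GenusSurface h) :
    OpenPartialHomeomorph (GenusSurface h) (EuclideanSpace ℝ (Fin 2)) where
  toFun v := (frame p v.1).1
  invFun u := if hu : (u, (0 : ℝ)) ∈ (ambientChart p).target then
    ⟨(ambientChart p).symm (u, 0), ambientChart_symm_mem p hu⟩ else p
  source := {v | v.1 ∈ (ambientChart p).source}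
  target := {u | (u, (0 : ℝ)) ∈ (ambientChart p).target}
  map_source' v hv := by
    have := (ambientChart p).map_source hv
    rw [coe_ambientChart, straighten, v.2] at this
    exact this
  map_target' u hu := by
    have hu' : (u, (0 : ℝ)) ∈ (ambientChart p).target := hu
    rw [dif_pos hu']
    exact (ambientChart p).map_target hu'
  left_inv' v hv := by
    have h1 := (ambientChart p).map_source hv
    have h2 := (ambientChart p).left_inv hv
    rw [coe_ambientChart, straighten, v.2] at h1 h2
    rw [dif_pos h1]
    exact Subtype.ext h2
  right_inv' u hu := by
    have hu' : (u, (0 : ℝ)) ∈ (ambientChart p).target := hu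
    simp only [dif_pos hu']
    exact congrArg Prod.fst ((ambientChart p).right_inv hu')
  open_source := (ambientChart p).open_source.preimage continuous_subtype_val
  open_target := (ambientChart p).open_target.preimage (by fun_prop)
  continuousOn_toFun := (continuous_fst.comp
    ((frame p).continuous.comp continuous_subtype_val)).continuousOn
  continuousOn_invFun := by
    have hi : IsInducing (fun p : GenusSurface h => p.1) := ⟨rfl⟩
    rw [hi.continuousOn_iff]
    refine ((ambientChart p).continuousOn_symm.comp (t := (ambientChart p).target)
      (f := fun u : EuclideanSpace ℝ (Fin 2) => (u, (0 : ℝ))) (by fun_prop)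
      fun u hu => hu).congr fun u hu => ?_
    have hu' : (u, (0 : ℝ)) ∈ (ambientChart p).target := hu
    simp [dif_pos hu']

theorem coe_chart_symm (p : GenusSurface h) {u : EuclideanSpace ℝ (Fin 2)}
    (hu : u ∈ (chart p).target) : ((chart p).symm u).1 = (ambientChart p).symm (u, 0) := by
  have hu' : (u, (0 : ℝ)) ∈ (ambientChart p).target := hu
  simp [chart, dif_pos hu']

instance : ChartedSpace (EuclideanSpace ℝ (Fin 2)) (GenusSurface h) where
  atlas := range chart
  chartAt := chart
  mem_chart_source p := mem_ambientChart_source p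
  chart_mem_atlas p := mem_range_self p

theorem contDiffOn_coe_chart_symm (p : GenusSurface h) :
    ContDiffOn ℝ ∞ (fun u => ((chart p).symm u).1) (chart p).target :=
  ((contDiffOn_ambientChart_symm p).comp (g := (ambientChart p).symm)
    (f := fun u : EuclideanSpace ℝ (Fin 2) => (u, (0 : ℝ))) (s := (chart p).target)
    (by fun_prop) fun u hu => hu).congr fun u hu => coe_chart_symm p hu

instance : IsManifold (𝓡 2) ∞ (GenusSurface h) := by
  apply isManifold_of_contDiffOn
  rintro _ _ ⟨p, rfl⟩ ⟨q, rfl⟩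
  have h1 : ContDiffOn ℝ ∞ (fun u => (frame q ((chart p).symm u).1).1) (chart p).target :=
    (contDiff_fst.comp (frame q).contDiff).comp_contDiffOn (contDiffOn_coe_chart_symm p)
  refine (h1.mono ?_).congr fun u hu => rfl
  rintro u ⟨hu, -⟩
  exact hu.1

/-- The involution `J(v) = -v`, which sends every point of `Σ_h` to its antipodal point. -/
def antipode (p : GenusSurface h) : GenusSurface h := ⟨-p.1, by rw [surfaceEq_neg, p.2]⟩

/-- The two-element group `{1, -1}` acts on `Σ_h` by `± 1`. -/
instance : MulAction ℤˣ (GenusSurface h) where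
  smul e p := if e = 1 then p else antipode p
  one_smul p := if_pos rfl
  mul_smul a b p := by
    rcases Int.units_eq_one_or a with rfl | rfl <;> rcases Int.units_eq_one_or b with rfl | rfl <;>
      apply Subtype.ext <;> simp [HSMul.hSMul, antipode, show (-1 : ℤˣ) ≠ 1 by decide]

theorem neg_one_smul (p : GenusSurface h) : (-1 : ℤˣ) • p = antipode p :=
  if_neg (by decide)

theorem coe_smul (e : ℤˣ) (p : GenusSurface h) : (e • p).1 = (e : ℤ) • p.1 := by
  rcases Int.units_eq_one_or e with rfl | rfl
  · simp
  · simp [neg_one_smul, antipode]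

theorem continuous_antipode : Continuous (antipode : GenusSurface h → GenusSurface h) :=
  (continuous_subtype_val.neg).subtype_mk _

theorem antipode_ne (p : GenusSurface h) : antipode p ≠ p := by
  intro hp
  have h1 : -p.1 = p.1 := congrArg Subtype.val hp
  have h2 : p.1 = 0 := by
    have : (2 : ℝ) • p.1 = 0 := by
      rw [two_smul]
      nth_rewrite 1 [← h1]
      exact neg_add_cancel _
    simpa using this
  have h3 := p.2
  rw [h2] at h3
  exact holedDisc_zero_ne h (by simpa [surfaceEq] using h3)

instance : ContinuousConstSMul ℤˣ (GenusSurface h) where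
  continuous_const_smul e := by
    rcases Int.units_eq_one_or e with rfl | rfl
    · simp only [one_smul]
      exact continuous_id
    · simpa only [neg_one_smul] using continuous_antipode

instance : IsCancelSMul ℤˣ (GenusSurface h) where
  right_cancel' a b p hab := by
    rcases Int.units_eq_one_or a with rfl | rfl <;> rcases Int.units_eq_one_or b with rfl | rfl
    · rfl
    · rw [one_smul, neg_one_smul] at hab
      exact absurd hab.symm (antipode_ne p)
    · rw [one_smul, neg_one_smul] at hab
      exact absurd hab (antipode_ne p)
    · rfl

end GenusSurface

/-- The closed non-orientable surface `N_g` of genus `g ≥ 1`, the quotient of `Σ_{g-1}` by the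
identification of antipodal points. -/
abbrev CrosscapSurface (g : ℕ) : Type := MulAction.orbitRel.Quotient ℤˣ (GenusSurface (g - 1))

namespace CrosscapSurface

theorem contDiff_transition {h : ℕ} (l l' : OpenPartialHomeomorph
      (MulAction.orbitRel.Quotient ℤˣ (GenusSurface h)) (GenusSurface h))
    (hl : (l.symm : _ → _) = Quotient.mk (MulAction.orbitRel ℤˣ (GenusSurface h)))
    (hl' : (l'.symm : _ → _) = Quotient.mk (MulAction.orbitRel ℤˣ (GenusSurface h)))
    (p q : GenusSurface h) :
    ContDiffOn ℝ ∞ ((l.trans (GenusSurface.chart p)).symm.trans (l'.trans (GenusSurface.chart q)))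
      ((l.trans (GenusSurface.chart p)).symm.trans (l'.trans (GenusSurface.chart q))).source := by
  intro y hy
  simp only [mfld_simps] at hy
  obtain ⟨⟨hy1, hy2⟩, hy3, hy4⟩ := hy
  set a : GenusSurface h := (GenusSurface.chart p).symm y with ha
  set b : GenusSurface h := l' (l.symm a) with hb
  have hab : Quotient.mk (MulAction.orbitRel ℤˣ (GenusSurface h)) b =
      Quotient.mk (MulAction.orbitRel ℤˣ (GenusSurface h)) a := by
    rw [← hl', hb, l'.left_inv hy3, hl, hl']
  obtain ⟨e, he⟩ : ∃ e : ℤˣ, e • a = b := Quotient.exact hab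
  have hs : ContDiffAt ℝ ∞ (fun u => (GenusSurface.frame q
      ((e : ℤ) • ((GenusSurface.chart p).symm u).1)).1) y := by
    have h1 : ContDiffAt ℝ ∞ (fun u => ((GenusSurface.chart p).symm u).1) y :=
      (GenusSurface.contDiffOn_coe_chart_symm p).contDiffAt
        ((GenusSurface.chart p).open_target.mem_nhds hy1)
    have h2 : ContDiffAt ℝ ∞ (fun u => ((e : ℤ) : ℝ) • ((GenusSurface.chart p).symm u).1) y :=
      h1.const_smul _
    simp only [← Int.cast_smul_eq_zsmul ℝ]
    exact (contDiff_fst.comp (GenusSurface.frame q).contDiff).contDiffAt.comp y h2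
  refine (hs.congr_of_eventuallyEq ?_).contDiffWithinAt
  have hc : ContinuousAt (fun u => e • (GenusSurface.chart p).symm u) y :=
    ((GenusSurface.chart p).continuousAt_symm hy1).const_smul e
  have hbt : e • (GenusSurface.chart p).symm y ∈ l'.target := by
    rw [← ha, he]
    exact l'.map_source hy3
  filter_upwards [hc.preimage_mem_nhds (l'.open_target.mem_nhds hbt)] with u hu
  have hu' : l' (l.symm ((GenusSurface.chart p).symm u)) = e • (GenusSurface.chart p).symm u := by
    have hu2 : l' (l'.symm (e • (GenusSurface.chart p).symm u)) =
      e • (GenusSurface.chart p).symm u := l'.right_inv hu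
    refine Eq.trans ?_ hu2
    congr 1
    rw [hl, hl']
    exact Quotient.sound (s := MulAction.orbitRel ℤˣ (GenusSurface h))
      ⟨e⁻¹, inv_smul_smul e _⟩
  simp only [mfld_simps]
  rw [hu', ← GenusSurface.coe_smul]
  rfl

instance (g : ℕ) : IsManifold (𝓡 2) ∞ (CrosscapSurface g) := by
  apply isManifold_of_contDiffOn
  rintro _ _ ⟨p, rfl⟩ ⟨q, rfl⟩
  exact (contDiff_transition _ _ (IsLocalHomeomorph.localInverseAt_symm _ _)
    (IsLocalHomeomorph.localInverseAt_symm _ _) _ _).mono fun u hu => hu.1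

/-- The double covering `J̃ : Σ_{g-1} → N_g`. -/
def proj {g : ℕ} (p : GenusSurface (g - 1)) : CrosscapSurface g := Quotient.mk _ p

end CrosscapSurface
end ModelSurfaces

noncomputable section LefschetzFibrations

variable {X S : Type*} [TopologicalSpace X] [ChartedSpace (EuclideanHalfSpace 4) X]
  [IsManifold (𝓡∂ 4) ∞ X] [TopologicalSpace S] [ChartedSpace (EuclideanHalfSpace 2) S]
  [IsManifold (𝓡∂ 2) ∞ S]

/-- A manifold is orientable if one can choose continuously orientations of its tangent spaces. -/
def IsOrientable {n : ℕ} {H : Type*} [TopologicalSpace H]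
    (I : ModelWithCorners ℝ (EuclideanSpace ℝ (Fin n)) H) (M : Type*) [TopologicalSpace M]
    [ChartedSpace H M] [IsManifold I 1 M] : Prop :=
  ∃ s : M → OrientationCover I M, Continuous s ∧ ∀ x, (s x).proj = x

/-- `Crit(f)`, the set of points at which the differential of `f` is not surjective. -/
def criticalSet (f : X → S) : Set X :=
  {x | ¬ Function.Surjective (mfderiv (𝓡∂ 4) (𝓡∂ 2) f x)}

/-- Complex coordinate charts `φ` about `x` and `ψ` about `f x` in which `f` is `(z, w) ↦ z w`. -/
structure LefschetzChart (f : X → S) (x : X) where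
  φ : OpenPartialHomeomorph X (ℂ × ℂ)
  ψ : OpenPartialHomeomorph S ℂ
  contMDiffOn_φ : ContMDiffOn (𝓡∂ 4) 𝓘(ℝ, ℂ × ℂ) ∞ φ φ.source
  contMDiffOn_φ_symm : ContMDiffOn 𝓘(ℝ, ℂ × ℂ) (𝓡∂ 4) ∞ φ.symm φ.target
  contMDiffOn_ψ : ContMDiffOn (𝓡∂ 2) 𝓘(ℝ, ℂ) ∞ ψ ψ.source
  contMDiffOn_ψ_symm : ContMDiffOn 𝓘(ℝ, ℂ) (𝓡∂ 2) ∞ ψ.symm ψ.target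
  mem_source : x ∈ φ.source
  mapsTo : MapsTo f φ.source ψ.source
  normal_form : ∀ p ∈ φ.source, ψ (f p) = (φ p).1 * (φ p).2

/-- Lefschetz fibrations of a compact connected smooth 4-manifold, possibly with boundary, over a
compact connected orientable smooth surface, possibly with boundary. -/
structure IsLefschetzFibration (f : X → S) : Prop where
  compactSpace_total : CompactSpace X
  t2Space_total : T2Space X
  connectedSpace_total : ConnectedSpace X
  compactSpace_base : CompactSpace S
  t2Space_base : T2Space S
  connectedSpace_base : ConnectedSpace S
  orientable_base : IsOrientable (𝓡∂ 2) S
  contMDiff : ContMDiff (𝓡∂ 4) (𝓡∂ 2) ∞ f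
  boundary_eq : (𝓡∂ 4).boundary X = f ⁻¹' (𝓡∂ 2).boundary S
  criticalSet_subset : criticalSet f ⊆ (𝓡∂ 4).interior X
  exists_chart : ∀ x ∈ criticalSet f, Nonempty (LefschetzChart f x)

/-- `e` is a diffeomorphism of the surface `N` onto the fibre of `f` over `y`, regarded as a map
into the total space. -/
structure IsFiberParametrization {N : Type*} [TopologicalSpace N]
    [ChartedSpace (EuclideanSpace ℝ (Fin 2)) N] (f : X → S) (y : S) (e : N → X) : Prop where
  isSmoothEmbedding : IsSmoothEmbedding (𝓡 2) (𝓡∂ 4) ∞ e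
  range_eq : range e = f ⁻¹' {y}

/-- Non-orientable Lefschetz fibrations of genus `g`: the total space is not orientable, and the
regular fibres are diffeomorphic to `N_g`. -/
structure IsNonorientableLefschetzFibration (g : ℕ) (f : X → S) : Prop where
  isLefschetzFibration : IsLefschetzFibration f
  not_isOrientable : ¬ IsOrientable (𝓡∂ 4) X
  one_le_genus : 1 ≤ g
  exists_fiber : ∀ y ∉ f '' criticalSet f,
    ∃ e : CrosscapSurface g → X, IsFiberParametrization f y e

/-- The real basis `(1, 0), (i, 0), (0, 1), (0, i)` of `ℂ²`, which defines its orientation. -/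
def complexBasis : Module.Basis (Fin 4) ℝ (ℂ × ℂ) :=
  (Complex.basisOneI.prod Complex.basisOneI).reindex finSumFinEquiv

/-- The map `φ` to `ℂ²` reverses orientations on `U`, where the manifold is oriented by `s`. -/
def ReversesOrientationOn (s : X → OrientationCover (𝓡∂ 4) X) (φ : X → ℂ × ℂ) (U : Set X) : Prop :=
  ∀ x ∈ U, ∀ b : Module.Basis (Fin 4) ℝ (TangentSpace (𝓡∂ 4) x),
    s x = OrientationCover.mk x b.orientation →
      complexBasis.det (fun i => mfderiv (𝓡∂ 4) 𝓘(ℝ, ℂ × ℂ) φ x (b i)) < 0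

/-- An orientable Lefschetz fibration is achiral if (for any orientation of the total space) some
critical point has a Lefschetz chart that reverses the orientation. -/
def IsAchiral (f : X → S) : Prop :=
  IsOrientable (𝓡∂ 4) X ∧
    ∀ s : X → OrientationCover (𝓡∂ 4) X, Continuous s → (∀ x, (s x).proj = x) →
      ∃ x ∈ criticalSet f, ∃ χ : LefschetzChart f x, ReversesOrientationOn s χ.φ χ.φ.source

/-- The path `ℓ` restricts to a smooth embedding of `[0, 1]` in the base which starts at the
critical value `f x₀` and afterwards runs through regular values. -/
structure IsVanishingPath (f : X → S) (x₀ : X) (ℓ : ℝ → S) : Prop where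
  mem_criticalSet : x₀ ∈ criticalSet f
  contMDiffOn : ContMDiffOn 𝓘(ℝ, ℝ) (𝓡∂ 2) ∞ ℓ (Icc 0 1)
  injOn : InjOn ℓ (Icc 0 1)
  deriv_ne_zero : ∀ t ∈ Icc (0 : ℝ) 1, mfderivWithin 𝓘(ℝ, ℝ) (𝓡∂ 2) ℓ (Icc 0 1) t ≠ 0
  start : ℓ 0 = f x₀
  regular : ∀ t ∈ Ioc (0 : ℝ) 1, ℓ t ∉ f '' criticalSet f

/-- The set `{zw = ε, |z| = |w|}`: a circle for `ε ≠ 0` and the point `0` for `ε = 0`. -/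
def matchingCircle (ε : ℂ) : Set (ℂ × ℂ) := {p | p.1 * p.2 = ε ∧ ‖p.1‖ = ‖p.2‖}

/-- `W` is a smooth vector field along `f⁻¹(ℓ([δ, 1]))` that is projected by `f` to the velocity
of `ℓ`, and `x ↦ γ x` is its flow: `γ x` is the integral curve in `f⁻¹(ℓ([δ, 1]))` that starts at
the point `x` of the fibre over `ℓ δ`. The flow identifies this fibre with those over
`ℓ (δ + s)`. -/
structure IsParallelTransport (f : X → S) (ℓ : ℝ → S) (δ : ℝ)
    (W : (x : X) → TangentSpace (𝓡∂ 4) x) (γ : X → ℝ → X) : Prop where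
  contMDiffOn : ContMDiffOn (𝓡∂ 4) (𝓡∂ 4).tangent ∞
    (fun x => (⟨x, W x⟩ : TangentBundle (𝓡∂ 4) X)) (f ⁻¹' (ℓ '' Icc δ 1))
  projects : ∀ t ∈ Icc δ 1, ∀ x ∈ f ⁻¹' {ℓ t},
    (mfderiv (𝓡∂ 4) (𝓡∂ 2) f x (W x) : EuclideanSpace ℝ (Fin 2)) =
      mfderivWithin 𝓘(ℝ, ℝ) (𝓡∂ 2) ℓ (Icc 0 1) t (1 : ℝ)
  start : ∀ x ∈ f ⁻¹' {ℓ δ}, γ x 0 = x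
  isMIntegralCurveOn : ∀ x ∈ f ⁻¹' {ℓ δ},
    IsMIntegralCurveOn (I := 𝓡∂ 4) (γ x) W (Icc 0 (1 - δ))
  continuousOn : ContinuousOn (fun p : X × ℝ => γ p.1 p.2) ((f ⁻¹' {ℓ δ}) ×ˢ Icc 0 (1 - δ))
  bijOn : ∀ s ∈ Icc 0 (1 - δ), BijOn (fun x => γ x s) (f ⁻¹' {ℓ δ}) (f ⁻¹' {ℓ (δ + s)})

/-- `c` is a vanishing cycle of `f` in the fibre over `ℓ 1`, determined by the path `ℓ` from the
critical value `f x₀`: in Lefschetz charts about `x₀`, take the circle `{zw = ψ (ℓ δ), |z| = |w|}`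
for `δ` so small that the circles for `0 ≤ t ≤ δ` lie in the range of the chart, and transport it
along `ℓ` from the fibre over `ℓ δ` to the fibre over `ℓ 1`. -/
def IsVanishingCycle (f : X → S) (x₀ : X) (ℓ : ℝ → S) (c : Set X) : Prop :=
  IsVanishingPath f x₀ ℓ ∧
  ∃ (χ : LefschetzChart f x₀) (δ : ℝ), δ ∈ Ioc (0 : ℝ) 1 ∧
    (∀ t ∈ Icc 0 δ, ℓ t ∈ χ.ψ.source ∧ matchingCircle (χ.ψ (ℓ t)) ⊆ χ.φ.target) ∧
    ∃ (W : (x : X) → TangentSpace (𝓡∂ 4) x) (γ : X → ℝ → X),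
      IsParallelTransport f ℓ δ W γ ∧
      c = (fun x => γ x (1 - δ)) '' (χ.φ.symm '' matchingCircle (χ.ψ (ℓ δ)))

/-- The sets `c` and `c'` are simple closed curves in `F` that are isotopic through simple closed
curves in `F`. -/
def IsIsotopicIn {M : Type*} [TopologicalSpace M] (F c c' : Set M) : Prop :=
  ∃ h : unitInterval × Circle → M, Continuous h ∧ (∀ s, Function.Injective fun θ => h (s, θ)) ∧
    (∀ p, h p ∈ F) ∧ (range fun θ => h (0, θ)) = c ∧ (range fun θ => h (1, θ)) = c'

/-- The set `c` is a two-sided simple closed curve in the surface `F`: it is the core of an open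
annulus in `F`. -/
def IsTwoSidedIn {M : Type*} [TopologicalSpace M] (F c : Set M) : Prop :=
  ∃ e : Circle × Ioo (-1 : ℝ) 1 → M, IsEmbedding e ∧ (∃ O, IsOpen O ∧ range e = F ∩ O) ∧
    (range fun θ => e (θ, ⟨0, by norm_num⟩)) = c

/-- The inverse image of the curve `c` in the orientation covering of `X` consists of two disjoint
vanishing cycles `c₁`, `c₂` of `f ∘ π`, determined by `ℓ` and the critical points `p` and its
mirror image, which are interchanged by the covering involution, and by the antipodal map under
any identification of the fibre of `f ∘ π` with `Σ_{g-1}` that covers an identification of the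
fibre of `f` with `N_g`. -/
structure IsAntipodalPair (g : ℕ) (f : X → S) (p : OrientationCover (𝓡∂ 4) X) (ℓ : ℝ → S)
    (c : Set X) (c₁ c₂ : Set (OrientationCover (𝓡∂ 4) X)) : Prop where
  isVanishingCycle_left : IsVanishingCycle (f ∘ OrientationCover.proj) p ℓ c₁
  isVanishingCycle_right : IsVanishingCycle (f ∘ OrientationCover.proj) p.flip ℓ c₂
  preimage_eq : OrientationCover.proj ⁻¹' c = c₁ ∪ c₂
  disjoint : Disjoint c₁ c₂
  image_flip : OrientationCover.flip '' c₁ = c₂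
  antipodal : ∀ (e : CrosscapSurface g → X) (e' : GenusSurface (g - 1) → OrientationCover (𝓡∂ 4) X),
    IsFiberParametrization f (ℓ 1) e →
    IsFiberParametrization (f ∘ OrientationCover.proj) (ℓ 1) e' →
    (∀ v, (e' v).proj = e (CrosscapSurface.proj v)) →
      e' ⁻¹' c₂ = GenusSurface.antipode ⁻¹' (e' ⁻¹' c₁)

end LefschetzFibrations

/-! The charts of the orientation cover are charts of `X` composed with the projection `π`. In these
charts `π` and its differential are the identity, so the critical points, the boundary, Lefschetz
charts and vector fields of `f` pull back unchanged. The cover is compact and Hausdorff because `π`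
has two sheets. It is connected because a disconnection would orient `X`
(`OrientationCover.connectedSpace`), and it carries a tautological orientation. A Lefschetz chart of
`f` lifts to both points above a critical point, preserving the orientation at one and reversing it
at the other; hence `f ∘ π` is achiral for either orientation.

A vanishing cycle is a small circle in a chart, moved by a flow. The chart lifts along a local
section of `π`, and the flow lifts by the homotopy lifting property
(`IsParallelTransport.exists_lift`). The two lifts are exchanged by `flip`, so the preimage of the
cycle is a pair of disjoint vanishing cycles (`isAntipodalPair_of_section`). An identification of
the fibres that covers one with `N_g` turns `flip` into the antipodal map, since both send a point
to the only other point over the same point.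

Conversely, a vanishing cycle of `f ∘ π` may come from a chart on which `π` is not injective and
from a vector field that is not invariant under `flip`. Restricting the chart to one sheet gives a
chart of `f` with room for smaller circles only, and a transport for `f` has to be constructed. A
horizontal field comes from local lifts and a partition of unity. To integrate it when `X` has
boundary, `exists_flowBox` straightens `f` by an inverse function theorem on half-spaces, which
turns horizontal curves into solutions of a time-dependent equation in a plane without boundary
(`exists_horizontalBox`). Compactness of the fibres makes the local flows global. Finally
`LefschetzChart.isIsotopicIn` connects the cycles obtained from different radii and different
fields.

Vanishing cycles are two-sided because `|z| = |w|` is the core of an annulus in the conic `zw = ε`,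
and the flow is a homeomorphism of fibres.

For the genus (`IsFiberParametrization.exists_cover`), orientations of the surface `Σ_{g-1}` and of
the base orient `X` along the map from `Σ_{g-1}` to the fibre, that is, they lift this map to the
cover. Since `J` reverses the orientation of the surface, antipodal points go to different sheets
and the lift is injective. -/

set_option linter.unusedSectionVars false

/-! ### Topology of the orientation cover: the involution, compactness, connectedness -/

section OrientationCoverBasics

variable {n : ℕ}

theorem pushOrientation_neg (A : EuclideanSpace ℝ (Fin n) →L[ℝ] EuclideanSpace ℝ (Fin n))
    (o : ModelOrientation n) : pushOrientation A (-o) = -pushOrientation A o := by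
  unfold pushOrientation
  split_ifs
  · exact Orientation.map_neg _ _
  · rfl

theorem ModelOrientation.eq_or_eq_neg (o o' : ModelOrientation n) : o = o' ∨ o = -o' :=
  Orientation.eq_or_eq_neg o o' (by simp)

variable {H : Type*} [TopologicalSpace H] {I : ModelWithCorners ℝ (EuclideanSpace ℝ (Fin n)) H}
  {M : Type*} [TopologicalSpace M] [ChartedSpace H M]

namespace OrientationCover

section C1

variable [IsManifold I 1 M]

@[simp] theorem proj_flip (p : OrientationCover I M) : p.flip.proj = p.proj := rfl

@[simp] theorem flip_flip (p : OrientationCover I M) : p.flip.flip = p := by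
  obtain ⟨x, o⟩ := p
  exact congrArg (mk (I := I) x) (neg_neg (show Orientation ℝ (TangentSpace I x) (Fin n) from o))

theorem mk_injective (x : M) {o o' : Orientation ℝ (TangentSpace I x) (Fin n)}
    (h : (mk x o : OrientationCover I M) = mk x o') : o = o' :=
  Bundle.TotalSpace.mk_injective x h

theorem flip_ne (p : OrientationCover I M) : p.flip ≠ p := by
  obtain ⟨x, o⟩ := p
  intro h
  exact Module.Ray.ne_neg_self (show Module.Ray ℝ _ from o) (mk_injective x h).symm

theorem eq_or_eq_flip {p q : OrientationCover I M} (h : p.proj = q.proj) : p = q ∨ p = q.flip := by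
  obtain ⟨x, o⟩ := p
  obtain ⟨y, o'⟩ := q
  obtain rfl : x = y := h
  rcases ModelOrientation.eq_or_eq_neg (n := n) o o' with h | h
  · exact Or.inl (congrArg (mk (I := I) x) h)
  · exact Or.inr (congrArg (mk (I := I) x) h)

variable (I M) in
theorem isCoveringMap_proj : IsCoveringMap (proj : OrientationCover I M → M) :=
  FiberBundle.isCoveringMap (F := ModelOrientation n) (E := (orientationBundleCore I M).Fiber)

@[fun_prop]
theorem continuous_proj : Continuous (proj : OrientationCover I M → M) :=
  (isCoveringMap_proj I M).continuous

theorem proj_surjective : Function.Surjective (proj : OrientationCover I M → M) := fun x =>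
  ⟨mk x (EuclideanSpace.basisFun (Fin n) ℝ).toBasis.orientation, rfl⟩

/-- The orientation of a point of the cover, transported to the model space in the chart
about `x`. -/
noncomputable def read (x : M) (p : OrientationCover I M) : ModelOrientation n :=
  pushOrientation ((tangentBundleCore I M).coordChange (achart H p.proj) (achart H x) p.proj)
    p.orientation

/-- The fibre is discrete, so convergence of the orientation, read in a fixed chart, means that it
is eventually constant. Continuity of maps into the cover is reduced to this criterion below. -/
theorem continuousAt_iff {T : Type*} [TopologicalSpace T] {q : T → OrientationCover I M} {t₀ : T} :
    ContinuousAt q t₀ ↔ ContinuousAt (fun t => (q t).proj) t₀ ∧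
      ∀ᶠ t in 𝓝 t₀, read (q t₀).proj (q t) = read (q t₀).proj (q t₀) := by
  refine (FiberBundle.continuousAt_totalSpace (F := ModelOrientation n)
    (E := (orientationBundleCore I M).Fiber) q).trans ?_
  refine and_congr Iff.rfl ?_
  rw [ContinuousAt, nhds_discrete (ModelOrientation n), Filter.tendsto_pure]
  rfl

theorem read_flip (x : M) (p : OrientationCover I M) : read x p.flip = -read x p :=
  pushOrientation_neg _ _

theorem continuous_flip : Continuous (flip : OrientationCover I M → OrientationCover I M) := by
  rw [continuous_iff_continuousAt]
  intro p
  obtain ⟨h1, h2⟩ := continuousAt_iff.1 (continuousAt_id (x := p))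
  refine continuousAt_iff.2 ⟨h1, ?_⟩
  filter_upwards [h2] with q hq
  rw [read_flip, read_flip, proj_flip]
  exact congrArg _ hq

variable (I M) in
/-- The covering involution as a homeomorphism. -/
noncomputable def flipHomeomorph : OrientationCover I M ≃ₜ OrientationCover I M where
  toFun := flip
  invFun := flip
  left_inv := flip_flip
  right_inv := flip_flip
  continuous_toFun := continuous_flip
  continuous_invFun := continuous_flip

theorem t2Space [T2Space M] : T2Space (OrientationCover I M) := by
  refine ⟨fun p q hpq => ?_⟩
  by_cases h : p.proj = q.proj
  · exact (isCoveringMap_proj I M).isSeparatedMap p q h hpq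
  · obtain ⟨U, V, hU, hV, hp, hq, hUV⟩ := t2_separation h
    exact ⟨proj ⁻¹' U, proj ⁻¹' V, hU.preimage continuous_proj, hV.preimage continuous_proj,
      hp, hq, hUV.preimage _⟩

theorem preimage_image_proj (U : Set (OrientationCover I M)) :
    proj ⁻¹' (proj '' U) = U ∪ flip '' U := by
  ext p
  constructor
  · rintro ⟨q, hq, h⟩
    rcases eq_or_eq_flip h with rfl | rfl
    · exact Or.inl hq
    · exact Or.inr ⟨_, hq, flip_flip p⟩
  · rintro (h | ⟨q, hq, rfl⟩)
    · exact ⟨p, h, rfl⟩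
    · exact ⟨q, hq, rfl⟩

theorem isOpenMap_proj : IsOpenMap (proj : OrientationCover I M → M) :=
  (isCoveringMap_proj I M).isOpenMap

/-- The projection of an ultrafilter converges to some point. If the ultrafilter converged to
neither of the two points above, it would miss a neighbourhood of each; intersecting one with the
mirror image of the other gives a set `N` such that `N ∪ flip N` belongs to the ultrafilter but
neither part does. -/
theorem compactSpace [CompactSpace M] : CompactSpace (OrientationCover I M) := by
  refine ⟨isCompact_iff_ultrafilter_le_nhds.2 fun F _ => ?_⟩
  obtain ⟨x, -, hx⟩ := isCompact_iff_ultrafilter_le_nhds.1 isCompact_univ (F.map proj) (by simp)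
  obtain ⟨p, rfl⟩ := proj_surjective (I := I) x
  by_contra! hF
  have h1 : ¬ (F : Filter (OrientationCover I M)) ≤ 𝓝 p := hF p (mem_univ _)
  have h2 : ¬ (F : Filter (OrientationCover I M)) ≤ 𝓝 p.flip := hF p.flip (mem_univ _)
  rw [Filter.not_le] at h1 h2
  obtain ⟨U, hU, hUF⟩ := h1
  obtain ⟨V, hV, hVF⟩ := h2
  have hV' : flip ⁻¹' V ∈ 𝓝 p := continuous_flip.continuousAt hV
  set N := U ∩ flip ⁻¹' V with hN
  have h3 : proj '' N ∈ 𝓝 p.proj :=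
    isOpenMap_proj.image_mem_nhds (Filter.inter_mem hU hV')
  have h4 : proj ⁻¹' (proj '' N) ∈ F := hx h3
  rw [preimage_image_proj, Ultrafilter.union_mem_iff] at h4
  rcases h4 with h4 | h4
  · exact hUF (Filter.mem_of_superset h4 inter_subset_left)
  · refine hVF (Filter.mem_of_superset h4 ?_)
    rintro _ ⟨q, hq, rfl⟩
    exact hq.2

/-- For a clopen set `U`, the sets `U ∪ flip U` and `U ∩ flip U` are invariant under the involution,
so each is empty or everything. The only case in which `U` is nontrivial is that `U` meets every
fibre once, and then `U` is an orientation of `M`. -/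
theorem connectedSpace [ConnectedSpace M] (hM : ¬ IsOrientable I M) :
    ConnectedSpace (OrientationCover I M) := by
  have : Nonempty (OrientationCover I M) := by
    obtain ⟨x⟩ := (inferInstance : Nonempty M)
    obtain ⟨p, -⟩ := proj_surjective (I := I) x
    exact ⟨p⟩
  have : PreconnectedSpace (OrientationCover I M) := by
    rw [preconnectedSpace_iff_clopen]
    intro U hU
    have hU' : IsClopen (flip '' U) := by
      rw [show flip '' U = flip ⁻¹' U from
        congrFun (image_eq_preimage_of_inverse flip_flip flip_flip) U]
      exact hU.preimage continuous_flip
    -- An invariant clopen set is the full preimage of its image, which is clopen because the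
    -- projection is open and the complement is invariant too.
    have hproj : ∀ V : Set (OrientationCover I M), IsClopen V → flip '' V = V →
        V = ∅ ∨ V = univ := by
      intro V hV hVf
      have h1 : proj ⁻¹' (proj '' V) = V := by rw [preimage_image_proj, hVf, union_self]
      have h2 : IsClopen (proj '' V) := by
        refine ⟨?_, isOpenMap_proj _ hV.isOpen⟩
        rw [← isOpen_compl_iff]
        have : (proj '' V)ᶜ = proj '' Vᶜ := by
          apply Subset.antisymm
          · intro x hx
            obtain ⟨p, rfl⟩ := proj_surjective (I := I) x
            exact ⟨p, fun hp => hx ⟨p, hp, rfl⟩, rfl⟩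
          · rintro _ ⟨p, hp, rfl⟩ h
            exact hp (h1 ▸ h)
        rw [this]
        exact isOpenMap_proj _ hV.compl.isOpen
      rcases isClopen_iff.1 h2 with h | h
      · exact Or.inl (image_eq_empty.1 h)
      · right
        rw [← h1, h, preimage_univ]
    have hfu : flip '' (U ∪ flip '' U) = U ∪ flip '' U := by
      rw [image_union, image_image]
      simp [union_comm]
    have hfi : flip '' (U ∩ flip '' U) = U ∩ flip '' U := by
      rw [image_inter (f := flip) (flipHomeomorph I M).injective, image_image]
      simp [inter_comm]
    rcases hproj _ (hU.union hU') hfu with h | h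
    · exact Or.inl (union_empty_iff.1 h).1
    rcases hproj _ (hU.inter hU') hfi with h' | h'
    · exfalso
      apply hM
      -- The union being everything and the intersection empty, `U` contains exactly one orientation
      -- at each point; the inverse of the open bijection from `U` to `M` is a continuous choice.
      have hbij : Function.Bijective (fun p : U => (p : OrientationCover I M).proj) := by
        constructor
        · rintro ⟨p, hp⟩ ⟨q, hq⟩ hpq
          rcases eq_or_eq_flip hpq with hh | hh
          · exact Subtype.ext hh
          · exact (h'.le ⟨hp, q, hq, hh.symm⟩).elim
        · intro x
          obtain ⟨p, rfl⟩ := proj_surjective (I := I) x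
          rcases h.ge (mem_univ p) with hp | ⟨q, hq, hqp⟩
          · exact ⟨⟨p, hp⟩, rfl⟩
          · exact ⟨⟨q, hq⟩, by rw [← hqp]; rfl⟩
      have hopen : IsOpenMap (fun p : U => (p : OrientationCover I M).proj) :=
        isOpenMap_proj.comp hU.isOpen.isOpenMap_subtype_val
      let h := (Equiv.ofBijective _ hbij).toHomeomorphOfContinuousOpen
        (continuous_proj.comp continuous_subtype_val) hopen
      exact ⟨fun x => h.symm x, continuous_subtype_val.comp h.symm.continuous,
        fun x => h.apply_symm_apply x⟩
    · right
      exact univ_subset_iff.1 (h' ▸ inter_subset_left)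
  exact { toNonempty := inferInstance }

end C1

end OrientationCover
end OrientationCoverBasics

/-! ### Smooth structure and tautological orientation of the cover -/

section OrientationCoverSmooth

variable {n : ℕ} {H : Type*} [TopologicalSpace H]
  {I : ModelWithCorners ℝ (EuclideanSpace ℝ (Fin n)) H}
  {M : Type*} [TopologicalSpace M] [ChartedSpace H M] [IsManifold I 1 M]
  {E' : Type*} [NormedAddCommGroup E'] [NormedSpace ℝ E'] {H' : Type*} [TopologicalSpace H']
  {I' : ModelWithCorners ℝ E' H'} {N : Type*} [TopologicalSpace N] [ChartedSpace H' N]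

namespace OrientationCover

/-- A chart of the cover is the inverse of a local inverse of `proj`, that is `proj`, followed by a
chart of `M`. This is what makes coordinate expressions upstairs and downstairs literally equal. -/
theorem coe_extChartAt (p : OrientationCover I M) :
    (extChartAt I p : OrientationCover I M → _) = extChartAt I p.proj ∘ proj := by
  have h : (chartAt H p : OrientationCover I M → H) = chartAt H p.proj ∘ proj := by
    change ((isLocalHomeomorph_proj.localInverseAt p).symm.trans (chartAt H p.proj) : _ → _) = _
    rw [OpenPartialHomeomorph.coe_trans, IsLocalHomeomorph.localInverseAt_symm]
  rw [extChartAt_coe, h, extChartAt_coe]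
  rfl

theorem coe_extChartAt_symm (p : OrientationCover I M) :
    ((extChartAt I p).symm : _ → OrientationCover I M) =
      isLocalHomeomorph_proj.localInverseAt p ∘ (extChartAt I p.proj).symm := rfl

/-- By `coe_extChartAt` a map and its projection have the same coordinate expression, hence the same
derivative. Continuity is the only additional information: it excludes jumps between the sheets. -/
theorem hasMFDerivWithinAt_iff {g : N → OrientationCover I M} {s : Set N} {x : N}
    {D : E' →L[ℝ] EuclideanSpace ℝ (Fin n)} :
    HasMFDerivWithinAt I' I g s x D ↔
      ContinuousWithinAt g s x ∧ HasMFDerivWithinAt I' I (fun y => (g y).proj) s x D := by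
  have h : writtenInExtChartAt I' I x g = writtenInExtChartAt I' I x (fun y => (g y).proj) := by
    rw [writtenInExtChartAt, coe_extChartAt]
    rfl
  constructor
  · rintro ⟨h1, h2⟩
    exact ⟨h1, continuous_proj.continuousAt.comp_continuousWithinAt h1, h ▸ h2⟩
  · rintro ⟨h1, -, h2⟩
    exact ⟨h1, h ▸ h2⟩

theorem contMDiffWithinAt_iff_proj {m : ℕ∞ω} {g : N → OrientationCover I M} {s : Set N} {x : N} :
    ContMDiffWithinAt I' I m g s x ↔
      ContinuousWithinAt g s x ∧ ContMDiffWithinAt I' I m (fun y => (g y).proj) s x := by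
  rw [contMDiffWithinAt_iff, contMDiffWithinAt_iff, coe_extChartAt]
  constructor
  · rintro ⟨h1, h2⟩
    exact ⟨h1, continuous_proj.continuousAt.comp_continuousWithinAt h1, h2⟩
  · rintro ⟨h1, -, h2⟩
    exact ⟨h1, h2⟩

/-- Obtained by applying the criterion to the identity map of the cover. The tangent spaces at a
point and at its projection are read in the same chart, so tangent vectors can be used upstairs
without conversion. -/
theorem hasMFDerivAt_proj (p : OrientationCover I M) :
    HasMFDerivAt I I (proj : OrientationCover I M → M) p
      (ContinuousLinearMap.id ℝ (EuclideanSpace ℝ (Fin n))) := by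
  exact hasMFDerivWithinAt_univ.1 (hasMFDerivWithinAt_iff.1
    (hasMFDerivWithinAt_univ.2 (hasMFDerivAt_id (I := I) p))).2

theorem contMDiff_proj {m : ℕ∞ω} : ContMDiff I I m (proj : OrientationCover I M → M) := fun p =>
  (contMDiffWithinAt_iff_proj.1 (contMDiffWithinAt_id (I := I) (x := p) (s := univ))).2

/-- The projection of a local section is the identity, which is smooth; continuity of the section is
therefore enough. -/
theorem contMDiffOn_comp_symm {m : ℕ∞ω} {g : M → OrientationCover I M} {U : Set M}
    (hg : ContinuousOn g U) (h : ∀ x ∈ U, (g x).proj = x) : ContMDiffOn I I m g U := fun x hx =>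
  contMDiffWithinAt_iff_proj.2 ⟨hg x hx, contMDiffWithinAt_id.congr h (h x hx)⟩

theorem hasMFDerivAt_comp_proj {f : M → N} {p : OrientationCover I M}
    {D : EuclideanSpace ℝ (Fin n) →L[ℝ] E'} (hf : HasMFDerivAt I I' f p.proj D) :
    HasMFDerivAt I I' (f ∘ proj) p D := by
  simpa using! hf.comp p (hasMFDerivAt_proj p)

theorem mfderiv_comp_proj {f : M → N} {p : OrientationCover I M}
    (hf : MDifferentiableAt I I' f p.proj) :
    mfderiv I I' (f ∘ proj) p = mfderiv I I' f p.proj :=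
  (hasMFDerivAt_comp_proj hf.hasMFDerivAt).mfderiv

theorem boundary_eq :
    I.boundary (OrientationCover I M) = proj ⁻¹' I.boundary M := by
  ext p
  change I.IsBoundaryPoint p ↔ I.IsBoundaryPoint p.proj
  rw [ModelWithCorners.isBoundaryPoint_iff, ModelWithCorners.isBoundaryPoint_iff, coe_extChartAt]
  rfl

theorem interior_eq :
    I.interior (OrientationCover I M) = proj ⁻¹' I.interior M := by
  ext p
  change I.IsInteriorPoint p ↔ I.IsInteriorPoint p.proj
  rw [ModelWithCorners.IsInteriorPoint, ModelWithCorners.IsInteriorPoint, coe_extChartAt]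
  rfl

theorem mem_chartAt_source {p q : OrientationCover I M} (h : q ∈ (chartAt H p).source) :
    q.proj ∈ (chartAt H p.proj).source := by
  have h' : q ∈ ((isLocalHomeomorph_proj.localInverseAt p).symm.trans
    (chartAt H p.proj)).source := h
  rw [OpenPartialHomeomorph.trans_source, IsLocalHomeomorph.localInverseAt_symm] at h'
  exact h'.2

/-- A local inverse of `proj` followed by `proj` is the identity near the point in question, so the
transition functions of the cover are germs of those of `M`. Hence the tangent bundle of the cover
is glued by the pulled back cocycle. -/
theorem coordChange_eq [IsManifold I 1 (OrientationCover I M)] (p q : OrientationCover I M)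
    {z : OrientationCover I M} (hz : z ∈ (chartAt H p).source) :
    (tangentBundleCore I (OrientationCover I M)).coordChange (achart H p) (achart H q) z =
      (tangentBundleCore I M).coordChange (achart H p.proj) (achart H q.proj) z.proj := by
  rw [tangentBundleCore_coordChange_achart, tangentBundleCore_coordChange_achart]
  have hz1 := mem_chartAt_source hz
  have hz2 : z.proj ∈ (isLocalHomeomorph_proj.localInverseAt p).source := by
    have h' : z ∈ ((isLocalHomeomorph_proj.localInverseAt p).symm.trans
      (chartAt H p.proj)).source := hz
    have h2 := (isLocalHomeomorph_proj.localInverseAt p).symm.map_source h'.1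
    rwa [IsLocalHomeomorph.localInverseAt_symm] at h2
  have hv : extChartAt I p z = extChartAt I p.proj z.proj := by rw [coe_extChartAt]; rfl
  rw [hv]
  have hc : ContinuousAt (extChartAt I p.proj).symm (extChartAt I p.proj z.proj) :=
    continuousAt_extChartAt_symm' (by rwa [extChartAt_source])
  have he : (extChartAt I p.proj).symm (extChartAt I p.proj z.proj) = z.proj :=
    (extChartAt I p.proj).left_inv (by rwa [extChartAt_source])
  have hev : ∀ᶠ v in 𝓝 (extChartAt I p.proj z.proj),
      (extChartAt I p.proj).symm v ∈ (isLocalHomeomorph_proj.localInverseAt p).source :=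
    hc.eventually ((isLocalHomeomorph_proj.localInverseAt p).open_source.mem_nhds (by rwa [he]))
  have key : ∀ v, (extChartAt I p.proj).symm v ∈
      (isLocalHomeomorph_proj.localInverseAt p).source →
      ((extChartAt I q) ∘ (extChartAt I p).symm) v =
        (extChartAt I q.proj ∘ (extChartAt I p.proj).symm) v := by
    intro v hv
    rw [coe_extChartAt, coe_extChartAt_symm]
    exact congrArg _ (IsLocalHomeomorph.apply_localInverseAt_of_mem _ hv)
  refine Filter.EventuallyEq.fderivWithin_eq (nhdsWithin_le_nhds ?_) (key _ (by rwa [he]))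
  filter_upwards [hev] with v hv
  exact key v hv

/-- The tangent bundle of the cover, read in the chart about `p`. -/
theorem trivializationAt_snd [IsManifold I 1 (OrientationCover I M)] (p q : OrientationCover I M)
    (v : EuclideanSpace ℝ (Fin n)) :
    (trivializationAt (EuclideanSpace ℝ (Fin n)) (TangentSpace I) p
      (⟨q, v⟩ : TangentBundle I (OrientationCover I M))).2 =
    (trivializationAt (EuclideanSpace ℝ (Fin n)) (TangentSpace I) p.proj
      (⟨q.proj, v⟩ : TangentBundle I M)).2 := by
  change (tangentBundleCore I (OrientationCover I M)).coordChange (achart H q) (achart H p) q v =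
    (tangentBundleCore I M).coordChange (achart H q.proj) (achart H p.proj) q.proj v
  rw [coordChange_eq q p (mem_chart_source H q)]

theorem read_eq [IsManifold I 1 (OrientationCover I M)] (p q : OrientationCover I M)
    (o : ModelOrientation n) :
    read p (mk q o : OrientationCover I (OrientationCover I M)) =
      read p.proj (mk q.proj o : OrientationCover I M) := by
  change pushOrientation ((tangentBundleCore I (OrientationCover I M)).coordChange
    (achart H q) (achart H p) q) o = pushOrientation ((tangentBundleCore I M).coordChange
    (achart H q.proj) (achart H p.proj) q.proj) o
  rw [coordChange_eq q p (mem_chart_source H q)]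

/-- The orientation of the cover whose value at `(p, o)` is `o`. -/
noncomputable def tautologicalSection [IsManifold I 1 (OrientationCover I M)]
    (p : OrientationCover I M) : OrientationCover I (OrientationCover I M) :=
  mk p p.orientation

/-- By `read_eq` the orientation `o` at `(p, o)` has the same chart coordinate upstairs as
downstairs, and downstairs it is locally constant by the topology of the cover. -/
theorem continuous_tautologicalSection [IsManifold I 1 (OrientationCover I M)] :
    Continuous (tautologicalSection : OrientationCover I M → _) := by
  rw [continuous_iff_continuousAt]
  intro p
  refine continuousAt_iff.2 ⟨continuousAt_id, ?_⟩
  filter_upwards [(continuousAt_iff.1 (continuousAt_id (x := p))).2] with q hq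
  exact (read_eq p q _).trans (hq.trans (read_eq p p _).symm)

theorem isOrientable [IsManifold I 1 (OrientationCover I M)] :
    IsOrientable I (OrientationCover I M) :=
  ⟨tautologicalSection, continuous_tautologicalSection, fun _ => rfl⟩

/-- A section of the orientation cover of a connected manifold is determined up to sign. -/
theorem section_eq_or_eq_flip [PreconnectedSpace M] {s t : M → OrientationCover I M}
    (hs : Continuous s) (ht : Continuous t) (hs' : ∀ x, (s x).proj = x)
    (ht' : ∀ x, (t x).proj = x) : s = t ∨ s = flip ∘ t := by
  by_cases hM : Nonempty M
  · obtain ⟨x⟩ := hM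
    rcases eq_or_eq_flip ((hs' x).trans (ht' x).symm) with h | h
    · exact Or.inl ((isCoveringMap_proj I M).eq_of_comp_eq hs ht
        (funext fun y => (hs' y).trans (ht' y).symm) x h)
    · exact Or.inr ((isCoveringMap_proj I M).eq_of_comp_eq hs (continuous_flip.comp ht)
        (funext fun y => (hs' y).trans (ht' y).symm) x h)
  · exact Or.inl (funext fun x => (hM ⟨x⟩).elim)

theorem pushOrientation_basis {A : EuclideanSpace ℝ (Fin n) →L[ℝ] EuclideanSpace ℝ (Fin n)}
    (hA : LinearMap.det A.toLinearMap ≠ 0) (b : Module.Basis (Fin n) ℝ (EuclideanSpace ℝ (Fin n))) :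
    pushOrientation A b.orientation =
      (b.map (LinearMap.equivOfDetNeZero A.toLinearMap hA)).orientation := by
  rw [pushOrientation, dif_pos hA]
  exact (Module.Basis.orientation_map b _).symm

/-- A family of points of the orientation cover is continuous if the orientations are those of a
continuous family of bases of the tangent spaces. -/
theorem continuousAt_of_frame {T : Type*} [TopologicalSpace T] {q : T → OrientationCover I M}
    {t₀ : T} (b : T → Fin n → EuclideanSpace ℝ (Fin n))
    (hb : ∀ i, ContinuousAt (fun t => (⟨(q t).proj, b t i⟩ : TangentBundle I M)) t₀)
    (hq : ∀ᶠ t in 𝓝 t₀, ∃ B : Module.Basis (Fin n) ℝ (EuclideanSpace ℝ (Fin n)),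
      ⇑B = b t ∧ (q t).orientation = B.orientation)
    (hproj : ContinuousAt (fun t => (q t).proj) t₀) : ContinuousAt q t₀ := by
  set x₀ := (q t₀).proj with hx₀
  refine continuousAt_iff.2 ⟨hproj, ?_⟩
  let A : T → EuclideanSpace ℝ (Fin n) →L[ℝ] EuclideanSpace ℝ (Fin n) := fun t =>
    (tangentBundleCore I M).coordChange (achart H (q t).proj) (achart H x₀) (q t).proj
  have hA : ∀ᶠ t in 𝓝 t₀, LinearMap.det (A t).toLinearMap ≠ 0 := by
    filter_upwards [hproj.preimage_mem_nhds
      ((chartAt H x₀).open_source.mem_nhds (mem_chart_source H x₀))] with t ht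
    exact det_coordChange_ne_zero I M _ _ _ ⟨mem_achart_source H _, ht⟩
  have hc : ∀ i, ContinuousAt (fun t => A t (b t i)) t₀ := fun i =>
    ((FiberBundle.continuousAt_totalSpace (F := EuclideanSpace ℝ (Fin n))
      (E := (TangentSpace I : M → Type _)) _).1 (hb i)).2
  obtain ⟨B₀, hB₀, hq₀⟩ := hq.self_of_nhds
  -- The frame at `t₀`, read in the model space, serves as the reference basis. The determinant of
  -- the moving frame relative to it is continuous and equals `1` at `t₀`, so it stays positive and
  -- the orientation read in the chart does not change.
  let C₀ := B₀.map (LinearMap.equivOfDetNeZero (A t₀).toLinearMap hA.self_of_nhds)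
  have hC₀ : ∀ i, C₀ i = A t₀ (b t₀ i) := fun i => by rw [← hB₀]; rfl
  have hcd : ContinuousAt (fun t => C₀.det (fun i => A t (b t i))) t₀ := by
    simp only [Module.Basis.det_apply]
    have : ∀ i j, ContinuousAt (fun t => C₀.toMatrix (fun i => A t (b t i)) i j) t₀ := fun i j => by
      simp only [Module.Basis.toMatrix_apply]
      exact (LinearMap.continuous_of_finiteDimensional (C₀.coord i)).continuousAt.comp (hc j)
    exact (Continuous.matrix_det continuous_id).continuousAt.comp
      (continuousAt_pi.2 fun i => continuousAt_pi.2 fun j => this i j)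
  have h1 : C₀.det (fun i => A t₀ (b t₀ i)) = 1 := by
    rw [show (fun i => A t₀ (b t₀ i)) = ⇑C₀ from funext fun i => (hC₀ i).symm]
    exact C₀.det_self
  have hpos : ∀ᶠ t in 𝓝 t₀, 0 < C₀.det (fun i => A t (b t i)) :=
    hcd.eventually (lt_mem_nhds (by simp only [h1]; exact one_pos))
  filter_upwards [hA, hq, hpos] with t hAt ⟨B, hB, hqt⟩ hdet
  change pushOrientation (A t) (q t).orientation = pushOrientation (A t₀) (q t₀).orientation
  have e1 : pushOrientation (A t) (q t).orientation = pushOrientation (A t) B.orientation :=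
    congrArg _ hqt
  have e2 : pushOrientation (A t₀) (q t₀).orientation = pushOrientation (A t₀) B₀.orientation :=
    congrArg _ hq₀
  rw [e1, e2, pushOrientation_basis hAt, pushOrientation_basis hA.self_of_nhds, eq_comm,
    Module.Basis.orientation_eq_iff_det_pos]
  have e3 : ⇑(B.map (LinearMap.equivOfDetNeZero (A t).toLinearMap hAt)) =
      fun i => A t (b t i) := by
    ext1 i
    rw [← hB]
    rfl
  rw [e3]
  exact hdet

end OrientationCover
end OrientationCoverSmooth

/-! ### The composite with the orientation cover is an achiral Lefschetz fibration -/

section LiftedFibration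

variable {X S : Type*} [TopologicalSpace X] [ChartedSpace (EuclideanHalfSpace 4) X]
  [IsManifold (𝓡∂ 4) ∞ X] [TopologicalSpace S] [ChartedSpace (EuclideanHalfSpace 2) S]
  [IsManifold (𝓡∂ 2) ∞ S]

open OrientationCover

namespace OrientationCover

/-- The image of an open set under a continuous section of the orientation cover is open. -/
theorem isOpen_image_section {σ : X → OrientationCover (𝓡∂ 4) X} {U : Set X} (hU : IsOpen U)
    (hσ : ContinuousOn σ U) (hσ' : ∀ x ∈ U, (σ x).proj = x) : IsOpen (σ '' U) := by
  rw [isOpen_iff_mem_nhds]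
  rintro _ ⟨x, hx, rfl⟩
  have h := isLocalHomeomorph_proj (I := 𝓡∂ 4) (M := X)
  set V := (h.localInverseAt (σ x)).target with hV
  have hVo : IsOpen V := (h.localInverseAt (σ x)).open_target
  have hxV : σ x ∈ V := h.self_mem_localInverseAt_target
  have hc : ContinuousAt (fun q : OrientationCover (𝓡∂ 4) X => σ q.proj) (σ x) := by
    refine ContinuousAt.comp (g := σ) ?_ continuous_proj.continuousAt
    rw [hσ' x hx]
    exact hσ.continuousAt (hU.mem_nhds hx)
  -- For `q` near `σ x`, both `q` and `σ q.proj` lie in the sheet `V` over the same point, hence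
  -- coincide.
  filter_upwards [hVo.mem_nhds hxV, hc.preimage_mem_nhds (hVo.mem_nhds
    (by rw [hσ' x hx]; exact hxV)), (hU.preimage continuous_proj).mem_nhds
      (show (σ x).proj ∈ U by rwa [hσ' x hx])] with q h1 h2 h3
  exact ⟨q.proj, h3, h.injOn_localInverseAt_target h2 h1 (hσ' _ h3)⟩

end OrientationCover

/-- The differential of the projection is the identity, so `f ∘ π` and `f` have the same
differential. -/
theorem criticalSet_comp_proj {f : X → S} (hf : ContMDiff (𝓡∂ 4) (𝓡∂ 2) ∞ f) :
    criticalSet (f ∘ (OrientationCover.proj : OrientationCover (𝓡∂ 4) X → X)) =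
      OrientationCover.proj ⁻¹' criticalSet f := by
  ext p
  have := mfderiv_comp_proj (p := p) ((hf.mdifferentiable (by simp)) p.proj)
  change ¬ Function.Surjective (mfderiv (𝓡∂ 4) (𝓡∂ 2) (f ∘ OrientationCover.proj) p) ↔
    ¬ Function.Surjective (mfderiv (𝓡∂ 4) (𝓡∂ 2) f p.proj)
  rw [this]
  exact Iff.rfl

theorem image_criticalSet_comp_proj {f : X → S} (hf : ContMDiff (𝓡∂ 4) (𝓡∂ 2) ∞ f) :
    (f ∘ (OrientationCover.proj : OrientationCover (𝓡∂ 4) X → X)) ''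
      criticalSet (f ∘ (OrientationCover.proj : OrientationCover (𝓡∂ 4) X → X)) =
      f '' criticalSet f := by
  rw [criticalSet_comp_proj hf, image_comp, image_preimage_eq _ proj_surjective]

/-- The lift of a Lefschetz chart to the orientation cover by a section of the cover. -/
noncomputable def LefschetzChart.lift {f : X → S} {p : OrientationCover (𝓡∂ 4) X}
    (χ : LefschetzChart f p.proj) (σ : X → OrientationCover (𝓡∂ 4) X)
    (hσ : ContinuousOn σ χ.φ.source) (hσ' : ∀ x ∈ χ.φ.source, (σ x).proj = x)
    (hp : σ p.proj = p) : LefschetzChart (f ∘ OrientationCover.proj) p where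
  φ :=
    { toFun := χ.φ ∘ OrientationCover.proj
      invFun := σ ∘ χ.φ.symm
      source := σ '' χ.φ.source
      target := χ.φ.target
      map_source' := by
        rintro _ ⟨x, hx, rfl⟩
        rw [Function.comp_apply, hσ' x hx]
        exact χ.φ.map_source hx
      map_target' := fun y hy => ⟨_, χ.φ.map_target hy, rfl⟩
      left_inv' := by
        rintro _ ⟨x, hx, rfl⟩
        simp only [Function.comp_apply]
        rw [hσ' x hx, χ.φ.left_inv hx]
      right_inv' := fun y hy => by
        simp only [Function.comp_apply]
        rw [hσ' _ (χ.φ.map_target hy), χ.φ.right_inv hy]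
      open_source := isOpen_image_section χ.φ.open_source hσ hσ'
      open_target := χ.φ.open_target
      continuousOn_toFun := χ.φ.continuousOn.comp continuous_proj.continuousOn (by
        rintro _ ⟨x, hx, rfl⟩
        rwa [hσ' x hx])
      continuousOn_invFun := hσ.comp χ.φ.continuousOn_symm χ.φ.mapsTo_symm }
  ψ := χ.ψ
  contMDiffOn_φ := χ.contMDiffOn_φ.comp contMDiff_proj.contMDiffOn (by
    rintro _ ⟨x, hx, rfl⟩
    change (σ x).proj ∈ χ.φ.source
    rwa [hσ' x hx])
  contMDiffOn_φ_symm := (contMDiffOn_comp_symm hσ hσ').comp χ.contMDiffOn_φ_symm χ.φ.mapsTo_symm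
  contMDiffOn_ψ := χ.contMDiffOn_ψ
  contMDiffOn_ψ_symm := χ.contMDiffOn_ψ_symm
  mem_source := ⟨p.proj, χ.mem_source, hp⟩
  mapsTo := by
    rintro _ ⟨x, hx, rfl⟩
    rw [Function.comp_apply, hσ' x hx]
    exact χ.mapsTo hx
  normal_form := by
    rintro _ ⟨x, hx, rfl⟩
    simp only [Function.comp_apply, OpenPartialHomeomorph.coe_mk]
    rw [hσ' x hx]
    exact χ.normal_form x hx

namespace LefschetzChart

variable {f : X → S} {x₀ : X} (χ : LefschetzChart f x₀)

theorem mdifferentiable_φ : χ.φ.MDifferentiable (𝓡∂ 4) 𝓘(ℝ, ℂ × ℂ) :=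
  ⟨χ.contMDiffOn_φ.mdifferentiableOn (by simp), χ.contMDiffOn_φ_symm.mdifferentiableOn (by simp)⟩

open Classical in
/-- The basis of the tangent space corresponding to the basis `(1, 0), (i, 0), (0, 1), (0, i)`
in a Lefschetz chart. -/
noncomputable def frame (x : X) : Module.Basis (Fin 4) ℝ (EuclideanSpace ℝ (Fin 4)) :=
  if hx : x ∈ χ.φ.source then
    complexBasis.map (χ.mdifferentiable_φ.mfderiv hx).symm.toLinearEquiv
  else (EuclideanSpace.basisFun (Fin 4) ℝ).toBasis

theorem mfderiv_frame {x : X} (hx : x ∈ χ.φ.source) (i : Fin 4) :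
    mfderiv (𝓡∂ 4) 𝓘(ℝ, ℂ × ℂ) χ.φ x (χ.frame x i) = complexBasis i := by
  rw [frame, dif_pos hx]
  exact (χ.mdifferentiable_φ.mfderiv hx).apply_symm_apply _

theorem frame_eq {x : X} (hx : x ∈ χ.φ.source) (i : Fin 4) :
    χ.frame x i = mfderiv 𝓘(ℝ, ℂ × ℂ) (𝓡∂ 4) χ.φ.symm (χ.φ x) (complexBasis i) := by
  rw [frame, dif_pos hx]
  rfl

/-- The orientation for which a Lefschetz chart preserves orientations. -/
noncomputable def orientationSection (x : X) : OrientationCover (𝓡∂ 4) X :=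
  OrientationCover.mk x (χ.frame x).orientation

@[simp] theorem proj_orientationSection (x : X) : (χ.orientationSection x).proj = x := rfl

/-- The frame is the image of the constant basis of `ℂ²` under the tangent map of the inverse chart,
so it varies continuously and `continuousAt_of_frame` applies. -/
theorem continuousOn_orientationSection : ContinuousOn χ.orientationSection χ.φ.source := by
  intro x hx
  refine ContinuousAt.continuousWithinAt ?_
  refine continuousAt_of_frame (fun y i => χ.frame y i) (fun i => ?_)
    (Filter.Eventually.of_forall fun y => ⟨χ.frame y, rfl, rfl⟩) continuousAt_id
  have h1 := χ.contMDiffOn_φ_symm.continuousOn_tangentMapWithin (by simp)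
    χ.φ.open_target.uniqueMDiffOn
  have h2 : ContinuousOn (fun y : X =>
      (⟨χ.φ y, complexBasis i⟩ : TangentBundle 𝓘(ℝ, ℂ × ℂ) (ℂ × ℂ))) χ.φ.source :=
    (tangentBundleModelSpaceHomeomorph 𝓘(ℝ, ℂ × ℂ)).symm.continuous.comp_continuousOn
      (χ.φ.continuousOn.prodMk continuousOn_const)
  have h3 := h1.comp h2 (fun y hy => χ.φ.map_source hy)
  refine (h3.continuousAt (χ.φ.open_source.mem_nhds hx)).congr ?_
  filter_upwards [χ.φ.open_source.mem_nhds hx] with y hy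
  have h4 : UniqueMDiffWithinAt 𝓘(ℝ, ℂ × ℂ) χ.φ.target (χ.φ y) :=
    χ.φ.open_target.uniqueMDiffWithinAt (χ.φ.map_source hy)
  have h5 : MDifferentiableAt 𝓘(ℝ, ℂ × ℂ) (𝓡∂ 4) χ.φ.symm (χ.φ y) :=
    χ.mdifferentiable_φ.mdifferentiableAt_symm (χ.φ.map_source hy)
  rw [Function.comp_apply, tangentMapWithin_eq_tangentMap h4 h5, tangentMap]
  change (⟨χ.φ.symm (χ.φ y), _⟩ : TangentBundle (𝓡∂ 4) X) = ⟨y, χ.frame y i⟩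
  rw [frame_eq χ hy]
  congr 1
  exact χ.φ.left_inv hy

/-- A Lefschetz chart trivializes the cover over its whole domain, however large, because it orients
that domain. The section or its mirror image passes through `p`. -/
theorem exists_section {p : OrientationCover (𝓡∂ 4) X} (χ : LefschetzChart f p.proj) :
    ∃ σ : X → OrientationCover (𝓡∂ 4) X, ContinuousOn σ χ.φ.source ∧
      (∀ x ∈ χ.φ.source, (σ x).proj = x) ∧ σ p.proj = p := by
  rcases eq_or_eq_flip (χ.proj_orientationSection p.proj) with h | h
  · exact ⟨_, χ.continuousOn_orientationSection, fun x _ => rfl, h⟩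
  · refine ⟨_, continuous_flip.comp_continuousOn χ.continuousOn_orientationSection,
      fun x _ => rfl, ?_⟩
    rw [Function.comp_apply, h, OrientationCover.flip_flip]

end LefschetzChart

/-- Non-orientability of `X` enters through the connectedness of the total space; all other clauses
are pulled back along a local diffeomorphism. -/
theorem IsNonorientableLefschetzFibration.comp_proj {g : ℕ} {f : X → S}
    (hf : IsNonorientableLefschetzFibration g f) :
    IsLefschetzFibration (f ∘ (OrientationCover.proj : OrientationCover (𝓡∂ 4) X → X)) := by
  have h := hf.isLefschetzFibration
  have := h.compactSpace_total
  have := h.t2Space_total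
  have := h.connectedSpace_total
  have hc := criticalSet_comp_proj h.contMDiff
  exact
    { compactSpace_total := OrientationCover.compactSpace
      t2Space_total := OrientationCover.t2Space
      connectedSpace_total := OrientationCover.connectedSpace hf.not_isOrientable
      compactSpace_base := h.compactSpace_base
      t2Space_base := h.t2Space_base
      connectedSpace_base := h.connectedSpace_base
      orientable_base := h.orientable_base
      contMDiff := h.contMDiff.comp contMDiff_proj
      boundary_eq := by rw [OrientationCover.boundary_eq, h.boundary_eq]; rfl
      criticalSet_subset := by
        rw [hc, OrientationCover.interior_eq]
        exact preimage_mono h.criticalSet_subset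
      exists_chart := fun p hp => by
        rw [hc] at hp
        obtain ⟨χ⟩ := h.exists_chart _ hp
        obtain ⟨σ, h1, h2, h3⟩ := χ.exists_section
        exact ⟨χ.lift σ h1 h2 h3⟩ }

theorem LefschetzChart.reversesOrientationOn_lift {f : X → S} {p : OrientationCover (𝓡∂ 4) X}
    (χ : LefschetzChart f p.proj) {σ : X → OrientationCover (𝓡∂ 4) X}
    (hσ : ContinuousOn σ χ.φ.source) (hσ' : ∀ x ∈ χ.φ.source, (σ x).proj = x)
    (hp : σ p.proj = p)
    {s : OrientationCover (𝓡∂ 4) X → OrientationCover (𝓡∂ 4) (OrientationCover (𝓡∂ 4) X)}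
    (hs : ∀ x ∈ χ.φ.source, s (σ x) =
      (OrientationCover.mk (σ x) (-(χ.frame (σ x).proj).orientation))) :
    ReversesOrientationOn s (χ.lift σ hσ hσ' hp).φ (χ.lift σ hσ hσ' hp).φ.source := by
  rintro _ ⟨x, hx, rfl⟩ b hb
  have hx' : (σ x).proj ∈ χ.φ.source := by rwa [hσ' x hx]
  have h1 := mk_injective _ ((hs x hx).symm.trans hb)
  have h2 : mfderiv (𝓡∂ 4) 𝓘(ℝ, ℂ × ℂ) (χ.lift σ hσ hσ' hp).φ (σ x) =
      mfderiv (𝓡∂ 4) 𝓘(ℝ, ℂ × ℂ) χ.φ (σ x).proj :=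
    mfderiv_comp_proj (χ.mdifferentiable_φ.mdifferentiableAt hx')
  let b' : Module.Basis (Fin 4) ℝ (EuclideanSpace ℝ (Fin 4)) := b
  let D : EuclideanSpace ℝ (Fin 4) →L[ℝ] ℂ × ℂ := mfderiv (𝓡∂ 4) 𝓘(ℝ, ℂ × ℂ) χ.φ (σ x).proj
  -- Both sides are alternating 4-forms in `b'`. They agree because `D` sends the frame of the chart
  -- to `complexBasis`, so that both are `1` on the frame.
  have h3 : complexBasis.det (fun i => D (b' i)) = (χ.frame (σ x).proj).det b' := by
    have h4 := AlternatingMap.eq_smul_basis_det (χ.frame (σ x).proj)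
      (complexBasis.det.compLinearMap D.toLinearMap)
    have h6 : (complexBasis.det.compLinearMap D.toLinearMap) (χ.frame (σ x).proj) = 1 := by
      have : (fun i => D (χ.frame (σ x).proj i)) = complexBasis :=
        funext fun i => χ.mfderiv_frame hx' i
      change complexBasis.det (fun i => D (χ.frame (σ x).proj i)) = 1
      rw [this, Module.Basis.det_self]
    rw [h6, one_smul] at h4
    exact congrArg (fun F => F b') h4
  -- A positive determinant would identify the orientation of `b` with that of the frame, while `s`
  -- is assumed to be the opposite one.
  have h5 : (χ.frame (σ x).proj).det b' < 0 := by
    rw [← not_le]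
    intro h6
    have h7 := (Module.Basis.orientation_eq_iff_det_pos (χ.frame (σ x).proj) b').2
      (lt_of_le_of_ne h6 ((χ.frame (σ x).proj).isUnit_det b').ne_zero.symm)
    have h8 : -(χ.frame (σ x).proj).orientation = (χ.frame (σ x).proj).orientation := by
      rw [h7]; exact (congrArg _ h7.symm).trans h1
    exact Module.Ray.ne_neg_self _ h8.symm
  rw [h2]
  rw [← h3] at h5
  exact h5

/-- On the connected cover `s` is the tautological orientation or its opposite. One chart about `x`
lifts to both points over `x`, where the tautological orientations differ, so the lift to one of
them reverses `s`: the mirror image of the chart orientation in the first case, the chart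
orientation itself in the second. -/
theorem IsNonorientableLefschetzFibration.isAchiral {g : ℕ} {f : X → S}
    (hf : IsNonorientableLefschetzFibration g f) (hc : (criticalSet f).Nonempty) :
    IsAchiral (f ∘ (OrientationCover.proj : OrientationCover (𝓡∂ 4) X → X)) := by
  refine ⟨OrientationCover.isOrientable, fun s hs hs' => ?_⟩
  have hX := hf.comp_proj.connectedSpace_total
  obtain ⟨x, hx⟩ := hc
  obtain ⟨χ⟩ := hf.isLefschetzFibration.exists_chart x hx
  have hcrit := criticalSet_comp_proj hf.isLefschetzFibration.contMDiff
  rcases section_eq_or_eq_flip hs continuous_tautologicalSection hs' (fun _ => rfl) with h | h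
  · let p : OrientationCover (𝓡∂ 4) X := (χ.orientationSection x).flip
    refine ⟨p, hcrit.ge hx, LefschetzChart.lift (p := p) χ
      (OrientationCover.flip ∘ χ.orientationSection)
      (continuous_flip.comp_continuousOn χ.continuousOn_orientationSection) (fun _ _ => rfl) rfl,
      LefschetzChart.reversesOrientationOn_lift (p := p) χ _ _ _ fun z hz => ?_⟩
    rw [h]
    rfl
  · let p : OrientationCover (𝓡∂ 4) X := χ.orientationSection x
    refine ⟨p, hcrit.ge hx, LefschetzChart.lift (p := p) χ χ.orientationSection
      χ.continuousOn_orientationSection (fun _ _ => rfl) rfl,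
      LefschetzChart.reversesOrientationOn_lift (p := p) χ _ _ _ fun z hz => ?_⟩
    rw [h]
    rfl

end LiftedFibration

/-! ### Lifting parallel transport and vanishing cycles to the cover -/

section LiftedVanishingCycles

variable {X S : Type*} [TopologicalSpace X] [ChartedSpace (EuclideanHalfSpace 4) X]
  [IsManifold (𝓡∂ 4) ∞ X] [TopologicalSpace S] [ChartedSpace (EuclideanHalfSpace 2) S]
  [IsManifold (𝓡∂ 2) ∞ S]

open OrientationCover

theorem isVanishingPath_comp_proj_iff {f : X → S} (hf : ContMDiff (𝓡∂ 4) (𝓡∂ 2) ∞ f)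
    {p : OrientationCover (𝓡∂ 4) X} {ℓ : ℝ → S} :
    IsVanishingPath (f ∘ OrientationCover.proj) p ℓ ↔ IsVanishingPath f p.proj ℓ := by
  have h1 := criticalSet_comp_proj hf
  have h2 := image_criticalSet_comp_proj hf
  constructor
  · rintro ⟨a, b, c, d, e, r⟩
    exact ⟨h1.le a, b, c, d, e, h2 ▸ r⟩
  · rintro ⟨a, b, c, d, e, r⟩
    exact ⟨h1.ge a, b, c, d, e, h2.symm ▸ r⟩

theorem isMIntegralCurveOn_congr {W : (x : X) → TangentSpace (𝓡∂ 4) x} {c c' : ℝ → X} {s : Set ℝ}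
    (h : ∀ t ∈ s, c' t = c t) (hc : IsMIntegralCurveOn (I := 𝓡∂ 4) c W s) :
    IsMIntegralCurveOn (I := 𝓡∂ 4) c' W s := by
  intro t ht
  have h1 := (hc t ht).congr_of_eventuallyEq (f₁ := c')
    (Filter.eventually_of_mem self_mem_nhdsWithin h) (h t ht)
  have h2 : (ContinuousLinearMap.smulRight (1 : ℝ →L[ℝ] ℝ) (W (c t) : EuclideanSpace ℝ (Fin 4))) =
      ContinuousLinearMap.smulRight (1 : ℝ →L[ℝ] ℝ) (W (c' t) : EuclideanSpace ℝ (Fin 4)) := by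
    rw [h t ht]
  exact (congrArg (fun D : ℝ →L[ℝ] EuclideanSpace ℝ (Fin 4) =>
    HasMFDerivWithinAt 𝓘(ℝ, ℝ) (𝓡∂ 4) c' s t D) h2).mp h1

/-- Parallel transport lifts to the orientation cover. -/
theorem IsParallelTransport.exists_lift {f : X → S} (hf : ContMDiff (𝓡∂ 4) (𝓡∂ 2) ∞ f)
    {ℓ : ℝ → S} {δ : ℝ} (hδ : δ ∈ Ioc (0 : ℝ) 1) {W : (x : X) → TangentSpace (𝓡∂ 4) x}
    {γ : X → ℝ → X} (h : IsParallelTransport f ℓ δ W γ) :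
    ∃ (W' : (p : OrientationCover (𝓡∂ 4) X) → TangentSpace (𝓡∂ 4) p)
      (γ' : OrientationCover (𝓡∂ 4) X → ℝ → OrientationCover (𝓡∂ 4) X),
      IsParallelTransport (f ∘ OrientationCover.proj) ℓ δ W' γ' ∧
      ∀ p ∈ (f ∘ OrientationCover.proj) ⁻¹' {ℓ δ}, ∀ s ∈ Icc 0 (1 - δ),
        (γ' p s).proj = γ p.proj s ∧ γ' p.flip s = (γ' p s).flip := by
  classical
  have hδ1 : 0 ≤ 1 - δ := by linarith [hδ.2]
  set A := ((f ∘ (OrientationCover.proj : OrientationCover (𝓡∂ 4) X → X)) ⁻¹' {ℓ δ}) with hA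
  -- Homotopy lifting is formulated over the unit interval, so time is clamped at `1 - δ`; beyond
  -- that the homotopy stands still.
  have hmin : ∀ s : unitInterval, min (s : ℝ) (1 - δ) ∈ Icc 0 (1 - δ) := fun s =>
    ⟨le_min s.2.1 hδ1, min_le_right _ _⟩
  let Hm : C(unitInterval × A, X) :=
    ⟨fun sa => γ (sa.2 : OrientationCover (𝓡∂ 4) X).proj (min (sa.1 : ℝ) (1 - δ)), by
      refine h.continuousOn.comp_continuous (f := fun sa : unitInterval × A =>
        ((sa.2 : OrientationCover (𝓡∂ 4) X).proj, min (sa.1 : ℝ) (1 - δ))) ?_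
        fun sa => ⟨sa.2.2, hmin _⟩
      fun_prop⟩
  let F : C(A, OrientationCover (𝓡∂ 4) X) := ⟨Subtype.val, continuous_subtype_val⟩
  have H0 : ∀ a : A, Hm (0, a) = OrientationCover.proj (F a) := by
    intro a
    change γ _ (min ((0 : unitInterval) : ℝ) (1 - δ)) = _
    rw [Icc.coe_zero, min_eq_left hδ1]
    exact h.start _ a.2
  let cov := isCoveringMap_proj (𝓡∂ 4) X
  set Γ := cov.liftHomotopy Hm F H0 with hΓ
  have hΓp : ∀ s a, (Γ (s, a)).proj = γ (a : OrientationCover (𝓡∂ 4) X).proj (min (s : ℝ) (1 - δ)) :=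
    fun s a => congrFun (cov.liftHomotopy_lifts Hm F H0) (s, a)
  have hΓ0 : ∀ a : A, Γ (0, a) = a := fun a => cov.liftHomotopy_zero Hm F H0 a
  let γ' : OrientationCover (𝓡∂ 4) X → ℝ → OrientationCover (𝓡∂ 4) X := fun p s =>
    if hp : p ∈ A then Γ (projIcc 0 1 zero_le_one s, ⟨p, hp⟩) else p
  have hIcc : ∀ s ∈ Icc (0 : ℝ) (1 - δ), s ∈ Icc (0 : ℝ) 1 := fun s hs =>
    ⟨hs.1, hs.2.trans (by linarith [hδ.1])⟩
  have hγ' : ∀ p (hp : p ∈ A) s, γ' p s = Γ (projIcc 0 1 zero_le_one s, ⟨p, hp⟩) :=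
    fun p hp s => dif_pos hp
  have hproj : ∀ p ∈ A, ∀ s ∈ Icc 0 (1 - δ), (γ' p s).proj = γ p.proj s := by
    intro p hp s hs
    rw [hγ' p hp, hΓp, projIcc_of_mem zero_le_one (hIcc s hs), min_eq_left hs.2]
  -- Two lifts of one path that meet at some time coincide at all times, in particular at time `0`.
  -- Thus distinct starting points over one point of `X` are never merged.
  have huniq : ∀ a b : A, (a : OrientationCover (𝓡∂ 4) X).proj =
      (b : OrientationCover (𝓡∂ 4) X).proj → ∀ s, Γ (s, a) = Γ (s, b) → a = b := by
    intro a b hab s hs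
    have := cov.eq_of_comp_eq (g₁ := fun s => Γ (s, a)) (g₂ := fun s => Γ (s, b))
      (by fun_prop) (by fun_prop) (funext fun s => by
        simp only [Function.comp_apply]; rw [hΓp, hΓp, hab]) s hs
    have := congrFun this 0
    simp only [hΓ0] at this
    exact Subtype.ext this
  have hinj : ∀ s ∈ Icc 0 (1 - δ), InjOn (fun p => γ' p s) A := by
    intro s hs p hp q hq hpq
    change γ' p s = γ' q s at hpq
    have h1 : p.proj = q.proj := (h.bijOn s hs).injOn hp hq
      (by rw [← hproj p hp s hs, ← hproj q hq s hs, hpq])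
    rw [hγ' p hp, hγ' q hq] at hpq
    exact congrArg Subtype.val (huniq ⟨p, hp⟩ ⟨q, hq⟩ h1 _ hpq)
  -- The lifts from `p` and `p.flip` project to the same path, and injectivity keeps them apart; the
  -- only remaining possibility is that they are mirror images.
  have hflip : ∀ p ∈ A, ∀ s ∈ Icc 0 (1 - δ), γ' p.flip s = (γ' p s).flip := by
    intro p hp s hs
    have hp' : p.flip ∈ A := hp
    rcases eq_or_eq_flip ((hproj _ hp' s hs).trans (hproj p hp s hs).symm) with h1 | h1
    · exact (flip_ne p (hinj s hs hp' hp h1)).elim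
    · exact h1
  have hcont : ContinuousOn (fun p : OrientationCover (𝓡∂ 4) X × ℝ => γ' p.1 p.2)
      (A ×ˢ Icc 0 (1 - δ)) := by
    rw [continuousOn_iff_continuous_domRestrict]
    have : Continuous fun p : ↥(A ×ˢ Icc (0 : ℝ) (1 - δ)) =>
        Γ (projIcc 0 1 zero_le_one p.1.2, ⟨p.1.1, p.2.1⟩) := by
      refine Γ.continuous.comp (Continuous.prodMk ?_ ?_)
      · exact continuous_projIcc.comp (continuous_snd.comp continuous_subtype_val)
      · exact (continuous_fst.comp continuous_subtype_val).subtype_mk _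
    exact this.congr fun p => (hγ' _ p.2.1 _).symm
  -- The lifted field is `W` with the same vectors, since `π` has the identity as differential.
  refine ⟨fun p => W p.proj, γ', ⟨?_, ?_, ?_, ?_, hcont, ?_⟩, fun p hp s hs =>
    ⟨hproj p hp s hs, hflip p hp s hs⟩⟩
  · intro p hp
    refine Bundle.contMDiffWithinAt_section.2 ?_
    have h1 := Bundle.contMDiffWithinAt_section.1 (h.contMDiffOn p.proj hp)
    have h2 := ContMDiffWithinAt.comp (g := _) (f := OrientationCover.proj)
      (s := (f ∘ OrientationCover.proj) ⁻¹' (ℓ '' Icc δ 1)) p h1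
      (contMDiff_proj.contMDiffAt.contMDiffWithinAt) (fun q hq => hq)
    refine h2.congr (fun q hq => ?_) ?_
    · exact trivializationAt_snd p q _
    · exact trivializationAt_snd p p _
  · intro t ht p hp
    have h1 := mfderiv_comp_proj (p := p) ((hf.mdifferentiable (by simp)) p.proj)
    refine Eq.trans ?_ (h.projects t ht p.proj hp)
    exact congrArg (fun D : EuclideanSpace ℝ (Fin 4) →L[ℝ] EuclideanSpace ℝ (Fin 2) =>
      D (W p.proj)) h1
  · intro p hp
    rw [hγ' p hp, projIcc_of_mem zero_le_one (by simp)]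
    exact hΓ0 _
  · intro p hp s hs
    refine hasMFDerivWithinAt_iff.2 ⟨?_, ?_⟩
    · exact (hcont.comp (f := fun s => (p, s)) (by fun_prop) (fun s hs => ⟨hp, hs⟩)) s hs
    · exact isMIntegralCurveOn_congr (fun t ht => hproj p hp t ht)
        (h.isMIntegralCurveOn p.proj hp) s hs
  · intro s hs
    refine ⟨fun p hp => ?_, hinj s hs, fun q hq => ?_⟩
    · change f (γ' p s).proj = _
      rw [hproj p hp s hs]
      exact (h.bijOn s hs).mapsTo hp
    · obtain ⟨x, hx, hxq⟩ := (h.bijOn s hs).surjOn (show q.proj ∈ f ⁻¹' {ℓ (δ + s)} from hq)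
      obtain ⟨p, rfl⟩ := proj_surjective (I := 𝓡∂ 4) x
      rcases eq_or_eq_flip ((hproj p hx s hs).trans hxq) with h1 | h1
      · exact ⟨p, hx, h1⟩
      · refine ⟨p.flip, hx, ?_⟩
        simp only
        rw [hflip p hx s hs, h1, OrientationCover.flip_flip]

/-- Antipodal points have the same image in `N_g`, hence go to points over the same point of `X`. As
`e'` is injective, the images differ, and a fibre of the cover has just two points. -/
theorem IsFiberParametrization.antipodal {g : ℕ} {f : X → S} {y : S} {e : CrosscapSurface g → X}
    {e' : GenusSurface (g - 1) → OrientationCover (𝓡∂ 4) X}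
    (he' : IsFiberParametrization (f ∘ OrientationCover.proj) y e')
    (h : ∀ v, (e' v).proj = e (CrosscapSurface.proj v)) (v : GenusSurface (g - 1)) :
    e' (GenusSurface.antipode v) = (e' v).flip := by
  have hv : CrosscapSurface.proj (g := g) (GenusSurface.antipode v) = CrosscapSurface.proj v :=
    Quotient.sound (s := MulAction.orbitRel ℤˣ (GenusSurface (g - 1)))
      ⟨-1, GenusSurface.neg_one_smul v⟩
  rcases eq_or_eq_flip (p := e' (GenusSurface.antipode v)) (q := e' v)
    (by rw [h, h, hv]) with h1 | h1
  · exact (GenusSurface.antipode_ne v (he'.isSmoothEmbedding.isEmbedding.injective h1)).elim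
  · exact h1

/-- The two lifts of a vanishing cycle to the orientation cover. -/
theorem isAntipodalPair_of_section {g : ℕ} {f : X → S} (hf : ContMDiff (𝓡∂ 4) (𝓡∂ 2) ∞ f)
    {p : OrientationCover (𝓡∂ 4) X} {ℓ : ℝ → S} (hℓ : IsVanishingPath f p.proj ℓ)
    (χ : LefschetzChart f p.proj) {σ : X → OrientationCover (𝓡∂ 4) X}
    (hσ : ContinuousOn σ χ.φ.source) (hσ' : ∀ x ∈ χ.φ.source, (σ x).proj = x)
    (hp : σ p.proj = p) {δ : ℝ} (hδ : δ ∈ Ioc (0 : ℝ) 1)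
    (hχ : ∀ t ∈ Icc 0 δ, ℓ t ∈ χ.ψ.source ∧ matchingCircle (χ.ψ (ℓ t)) ⊆ χ.φ.target)
    {γ : X → ℝ → X}
    {W' : (p : OrientationCover (𝓡∂ 4) X) → TangentSpace (𝓡∂ 4) p}
    {γ' : OrientationCover (𝓡∂ 4) X → ℝ → OrientationCover (𝓡∂ 4) X}
    (hγ' : IsParallelTransport (f ∘ OrientationCover.proj) ℓ δ W' γ')
    (hγγ' : ∀ p ∈ (f ∘ OrientationCover.proj) ⁻¹' {ℓ δ}, ∀ s ∈ Icc 0 (1 - δ),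
        (γ' p s).proj = γ p.proj s ∧ γ' p.flip s = (γ' p s).flip)
    {C : Set X} (hC : C = χ.φ.symm '' matchingCircle (χ.ψ (ℓ δ))) :
    IsAntipodalPair g f p ℓ ((fun x => γ x (1 - δ)) '' C)
      ((fun q => γ' q (1 - δ)) '' (σ '' C))
      (OrientationCover.flip '' ((fun q => γ' q (1 - δ)) '' (σ '' C))) := by
  have hs : 1 - δ ∈ Icc 0 (1 - δ) := right_mem_Icc.2 (by linarith [hδ.2])
  have hCs : C ⊆ χ.φ.source := by
    rw [hC]
    rintro _ ⟨y, hy, rfl⟩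
    exact χ.φ.map_target ((hχ δ (right_mem_Icc.2 hδ.1.le)).2 hy)
  have hCf : ∀ x ∈ C, f x = ℓ δ := by
    intro x hx
    refine χ.ψ.injOn (χ.mapsTo (hCs hx)) (hχ δ (right_mem_Icc.2 hδ.1.le)).1 ?_
    rw [χ.normal_form x (hCs hx)]
    rw [hC] at hx
    obtain ⟨y, hy, rfl⟩ := hx
    rw [χ.φ.right_inv ((hχ δ (right_mem_Icc.2 hδ.1.le)).2 hy)]
    exact hy.1
  have hσf : ∀ x ∈ C, σ x ∈ (f ∘ OrientationCover.proj) ⁻¹' {ℓ δ} := fun x hx => by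
    change f (σ x).proj = ℓ δ
    rw [hσ' x (hCs hx), hCf x hx]
  -- Transport commutes with `flip`, so the second cycle is the transport of the circle lifted by
  -- the opposite section.
  have hflip : OrientationCover.flip '' ((fun q => γ' q (1 - δ)) '' (σ '' C)) =
      (fun q => γ' q (1 - δ)) '' ((OrientationCover.flip ∘ σ) '' C) := by
    rw [image_image, image_image, image_image]
    exact image_congr fun x hx => ((hγγ' _ (hσf x hx) _ hs).2).symm
  -- Kept general in `q` and the section so that it serves `p` with `σ` as well as `p.flip` with
  -- `flip ∘ σ`.
  have hlift : ∀ (q : OrientationCover (𝓡∂ 4) X) (χ' : LefschetzChart f q.proj)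
      (hχ' : χ'.φ = χ.φ ∧ χ'.ψ = χ.ψ) {σ : X → OrientationCover (𝓡∂ 4) X}
      (hσ : ContinuousOn σ χ'.φ.source) (hσ' : ∀ x ∈ χ'.φ.source, (σ x).proj = x)
      (hp : σ q.proj = q), IsVanishingPath f q.proj ℓ →
      IsVanishingCycle (f ∘ OrientationCover.proj) q ℓ
        ((fun q => γ' q (1 - δ)) '' (σ '' C)) := by
    rintro q χ' ⟨h1, h2⟩ σ hσ hσ' hp hℓ
    refine ⟨(isVanishingPath_comp_proj_iff hf).2 hℓ, χ'.lift σ hσ hσ' hp, δ, hδ, ?_, W', γ', hγ', ?_⟩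
    · rw [← h1, ← h2] at hχ
      exact hχ
    · rw [hC, ← h1, ← h2, image_image σ]
      rfl
  refine ⟨hlift p χ ⟨rfl, rfl⟩ hσ hσ' hp hℓ, ?_, ?_, ?_, rfl, ?_⟩
  · rw [hflip]
    exact hlift p.flip χ ⟨rfl, rfl⟩ (continuous_flip.comp_continuousOn hσ) hσ'
      (congrArg OrientationCover.flip hp) hℓ
  · ext q
    constructor
    · rintro ⟨x, hx, hxq⟩
      have h1 := (hγγ' _ (hσf x hx) _ hs).1
      rw [hσ' x (hCs hx)] at h1
      rcases eq_or_eq_flip (hxq.symm.trans h1.symm) with h2 | h2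
      · exact Or.inl ⟨_, ⟨x, hx, rfl⟩, h2.symm⟩
      · exact Or.inr ⟨_, ⟨_, ⟨x, hx, rfl⟩, rfl⟩, h2.symm⟩
    · rintro (⟨_, ⟨x, hx, rfl⟩, rfl⟩ | ⟨_, ⟨_, ⟨x, hx, rfl⟩, rfl⟩, rfl⟩)
      · refine ⟨x, hx, ?_⟩
        rw [(hγγ' _ (hσf x hx) _ hs).1, hσ' x (hCs hx)]
      · refine ⟨x, hx, ?_⟩
        rw [proj_flip, (hγγ' _ (hσf x hx) _ hs).1, hσ' x (hCs hx)]
  -- Injectivity of the transport moves a common point back to the initial fibre. There its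
  -- projection forces `x = y`, and a point would equal its own mirror image.
  · rw [hflip, disjoint_left]
    rintro _ ⟨_, ⟨x, hx, rfl⟩, rfl⟩ ⟨_, ⟨y, hy, rfl⟩, h1⟩
    have h2 := (hγ'.bijOn _ hs).injOn (show (σ y).flip ∈ _ from hσf y hy) (hσf x hx) h1
    have h3 := congrArg OrientationCover.proj h2
    rw [proj_flip, hσ' x (hCs hx), hσ' y (hCs hy)] at h3
    rw [h3] at h2
    exact flip_ne _ h2
  · intro e e' he he' hee'
    ext v
    simp only [mem_preimage]
    rw [he'.antipodal hee']
    constructor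
    · rintro ⟨q, hq, h1⟩
      rwa [← h1, OrientationCover.flip_flip]
    · intro h1
      exact ⟨_, h1, OrientationCover.flip_flip _⟩

theorem exists_isAntipodalPair {g : ℕ} {f : X → S} (hf : ContMDiff (𝓡∂ 4) (𝓡∂ 2) ∞ f)
    {p : OrientationCover (𝓡∂ 4) X} {ℓ : ℝ → S} {c : Set X} (hc : IsVanishingCycle f p.proj ℓ c) :
    ∃ c₁ c₂, IsAntipodalPair g f p ℓ c c₁ c₂ := by
  obtain ⟨hℓ, χ, δ, hδ, hχ, W, γ, hγ, rfl⟩ := hc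
  obtain ⟨σ, h1, h2, h3⟩ := χ.exists_section
  obtain ⟨W', γ', hγ', h4⟩ := hγ.exists_lift hf hδ
  exact ⟨_, _, isAntipodalPair_of_section hf hℓ χ h1 h2 h3 hδ hχ hγ' h4 rfl⟩

end LiftedVanishingCycles

/-! ### Vanishing cycles are cores of annuli -/

section TwoSided

/-- Parametrization of the affine conic `{zw = ε}`, whose core is the circle `|z| = |w|`. -/
noncomputable def conicMap (ε : ℂ) (θ : Circle) (s : ℝ) : ℂ × ℂ :=
  (((√‖ε‖ * Real.exp s : ℝ) : ℂ) * θ, ε * ((((√‖ε‖ * Real.exp s)⁻¹ : ℝ) : ℂ) * (θ⁻¹ : Circle)))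

theorem sqrt_norm_pos {ε : ℂ} (hε : ε ≠ 0) : 0 < √‖ε‖ := Real.sqrt_pos.2 (norm_pos_iff.2 hε)

theorem conicMap_mul {ε : ℂ} (hε : ε ≠ 0) (θ : Circle) (s : ℝ) :
    (conicMap ε θ s).1 * (conicMap ε θ s).2 = ε := by
  have h1 : ((√‖ε‖ * Real.exp s : ℝ) : ℂ) ≠ 0 :=
    Complex.ofReal_ne_zero.2 (mul_pos (sqrt_norm_pos hε) (Real.exp_pos s)).ne'
  have h2 : (θ : ℂ) ≠ 0 := Circle.coe_ne_zero θ
  simp only [conicMap, Circle.coe_inv, Complex.ofReal_inv]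
  field_simp

theorem norm_conicMap_fst (ε : ℂ) (θ : Circle) (s : ℝ) :
    ‖(conicMap ε θ s).1‖ = √‖ε‖ * Real.exp s := by
  simp only [conicMap, norm_mul, Circle.norm_coe, mul_one, Complex.norm_real]
  rw [Real.norm_of_nonneg (Real.sqrt_nonneg _), Real.norm_of_nonneg (Real.exp_pos _).le]

/-- Polar coordinates of the first entry give `θ` and the radial parameter, normalized to vanish at
radius `√‖ε‖`; the second entry is then forced by the equation `zw = ε`. -/
theorem conicMap_surj {ε : ℂ} (hε : ε ≠ 0) {y : ℂ × ℂ} (hy : y.1 * y.2 = ε) :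
    ∃ θ : Circle, y = conicMap ε θ (Real.log (‖y.1‖ / √‖ε‖)) := by
  have hy1 : y.1 ≠ 0 := fun h => hε (by rw [← hy, h, zero_mul])
  have hr := sqrt_norm_pos hε
  have hn : 0 < ‖y.1‖ := norm_pos_iff.2 hy1
  have hθ : ‖y.1 / ‖y.1‖‖ = 1 := by
    rw [norm_div, Complex.norm_real, norm_norm, div_self hn.ne']
  set θ : Circle := ⟨y.1 / ‖y.1‖, mem_sphere_zero_iff_norm.2 hθ⟩ with hθ'
  refine ⟨θ, ?_⟩
  have hs : √‖ε‖ * Real.exp (Real.log (‖y.1‖ / √‖ε‖)) = ‖y.1‖ := by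
    rw [Real.exp_log (by positivity)]
    field_simp
  have h1 : y.1 = (conicMap ε θ
      (Real.log (‖y.1‖ / √‖ε‖))).1 := by
    simp only [conicMap]
    rw [hs]
    have : (‖y.1‖ : ℂ) ≠ 0 := Complex.ofReal_ne_zero.2 hn.ne'
    change y.1 = (‖y.1‖ : ℂ) * (y.1 / ‖y.1‖)
    field_simp
  refine Prod.ext h1 ?_
  have h2 := conicMap_mul hε θ
    (Real.log (‖y.1‖ / √‖ε‖))
  rw [← h1, ← hy] at h2
  rw [hy] at h2
  exact (mul_left_cancel₀ hy1 (h2.trans hy.symm)).symm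

theorem conicMap_injective {ε : ℂ} (hε : ε ≠ 0) :
    Function.Injective fun p : Circle × ℝ => conicMap ε p.1 p.2 := by
  rintro ⟨θ, s⟩ ⟨θ', s'⟩ h
  simp only at h
  have hr := sqrt_norm_pos hε
  have h1 : s = s' := by
    have := congrArg (fun y : ℂ × ℂ => ‖y.1‖) h
    simp only [norm_conicMap_fst] at this
    exact Real.exp_injective (mul_left_cancel₀ hr.ne' this)
  subst h1
  have h2 : (√‖ε‖ * Real.exp s : ℝ) ≠ 0 := (mul_pos hr (Real.exp_pos s)).ne'
  have h3 := congrArg Prod.fst h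
  simp only [conicMap] at h3
  have h4 := mul_left_cancel₀ (Complex.ofReal_ne_zero.2 h2) h3
  rw [Circle.ext h4]

theorem continuousOn_conicMap :
    ContinuousOn (fun p : ℂ × Circle × ℝ => conicMap p.1 p.2.1 p.2.2) {p | p.1 ≠ 0} := by
  unfold conicMap
  have h1 : ∀ p ∈ {p : ℂ × Circle × ℝ | p.1 ≠ 0}, √‖p.1‖ * Real.exp p.2.2 ≠ 0 := fun p hp =>
    (mul_pos (sqrt_norm_pos hp) (Real.exp_pos _)).ne'
  have h2 : Continuous fun p : ℂ × Circle × ℝ => √‖p.1‖ * Real.exp p.2.2 := by fun_prop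
  refine ContinuousOn.prodMk (by fun_prop) (continuousOn_fst.mul (ContinuousOn.mul ?_ ?_))
  · exact Complex.continuous_ofReal.comp_continuousOn (h2.continuousOn.inv₀ h1)
  · fun_prop

theorem continuous_conicMap {ε : ℂ} (hε : ε ≠ 0) :
    Continuous fun p : Circle × ℝ => conicMap ε p.1 p.2 :=
  continuousOn_conicMap.comp_continuous (f := fun p : Circle × ℝ => (ε, p)) (by fun_prop)
    fun _ => hε

theorem isEmbedding_conicMap {ε : ℂ} (hε : ε ≠ 0) :
    IsEmbedding fun p : Circle × ℝ => conicMap ε p.1 p.2 := by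
  have hr := sqrt_norm_pos hε
  refine ⟨?_, conicMap_injective hε⟩
  have h1 : IsInducing (fun p : Circle × ℝ => ((p.1 : ℂ), p.2)) :=
    IsInducing.subtypeVal.prodMap IsInducing.id
  -- A continuous inverse on the part where the first entry is nonzero: its direction and the
  -- logarithm of its normalized modulus.
  let G : ℂ × ℂ → ℂ × ℝ := fun y => (y.1 / ‖y.1‖, Real.log (‖y.1‖ / √‖ε‖))
  have hG : ∀ p : Circle × ℝ, G (conicMap ε p.1 p.2) = ((p.1 : ℂ), p.2) := by
    intro p
    have h2 : 0 < √‖ε‖ * Real.exp p.2 := mul_pos hr (Real.exp_pos _)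
    simp only [G, norm_conicMap_fst]
    refine Prod.ext ?_ ?_
    · have h3 : ((√‖ε‖ * Real.exp p.2 : ℝ) : ℂ) ≠ 0 := Complex.ofReal_ne_zero.2 h2.ne'
      simp only [conicMap]
      exact mul_div_cancel_left₀ _ h3
    · simp only
      rw [mul_div_cancel_left₀ _ hr.ne', Real.log_exp]
  have hGc : ContinuousOn G {y | y.1 ≠ 0} := by
    refine ContinuousOn.prodMk (ContinuousOn.div (by fun_prop) (by fun_prop) fun y hy => ?_)
      (ContinuousOn.log (by fun_prop) fun y hy => ?_)
    · exact Complex.ofReal_ne_zero.2 (norm_pos_iff.2 hy).ne'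
    · exact (div_pos (norm_pos_iff.2 hy) hr).ne'
  have hmem : ∀ p : Circle × ℝ, conicMap ε p.1 p.2 ∈ {y : ℂ × ℂ | y.1 ≠ 0} := fun p h => by
    have := norm_conicMap_fst ε p.1 p.2
    rw [h, norm_zero] at this
    exact (mul_pos hr (Real.exp_pos _)).ne this
  have h3 : IsInducing (fun p : Circle × ℝ => (⟨_, hmem p⟩ : {y : ℂ × ℂ | y.1 ≠ 0})) := by
    refine IsInducing.of_comp (g := fun y : {y : ℂ × ℂ | y.1 ≠ 0} => G y)
      ((continuous_conicMap hε).subtype_mk _)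
      (continuousOn_iff_continuous_domRestrict.1 hGc) ?_
    have : (fun y : {y : ℂ × ℂ | y.1 ≠ 0} => G y) ∘
        (fun p : Circle × ℝ => (⟨_, hmem p⟩ : {y : ℂ × ℂ | y.1 ≠ 0})) =
        fun p : Circle × ℝ => ((p.1 : ℂ), p.2) := funext hG
    rw [this]
    exact h1
  exact IsInducing.subtypeVal.comp h3

/-- On the conic the moduli multiply to `‖ε‖`, so they are equal exactly when the first one is
`√‖ε‖`, that is, when the radial parameter is zero. -/
theorem range_conicMap_zero {ε : ℂ} (hε : ε ≠ 0) :
    (range fun θ => conicMap ε θ 0) = matchingCircle ε := by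
  have hr := sqrt_norm_pos hε
  ext y
  constructor
  · rintro ⟨θ, rfl⟩
    refine ⟨conicMap_mul hε θ 0, ?_⟩
    have h1 := congrArg norm (conicMap_mul hε θ 0)
    rw [norm_mul] at h1
    have h2 := norm_conicMap_fst ε θ 0
    rw [Real.exp_zero, mul_one] at h2
    rw [h2] at h1 ⊢
    have h3 := Real.mul_self_sqrt (norm_nonneg ε)
    rw [← h3] at h1
    simp only [h3] at h1
    have : √‖ε‖ * ‖(conicMap ε θ 0).2‖ = √‖ε‖ * √‖ε‖ := by rw [h1, h3]
    exact (mul_left_cancel₀ hr.ne' this).symm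
  · rintro ⟨h1, h2⟩
    obtain ⟨θ, hθ⟩ := conicMap_surj hε h1
    have h3 : ‖y.1‖ = √‖ε‖ := by
      rw [← h1, norm_mul, ← h2, Real.sqrt_mul_self (norm_nonneg _)]
    rw [h3, div_self hr.ne', Real.log_one] at hθ
    exact ⟨θ, hθ.symm⟩

variable {X S : Type*} [TopologicalSpace X] [ChartedSpace (EuclideanHalfSpace 4) X]
  [TopologicalSpace S] [ChartedSpace (EuclideanHalfSpace 2) S]

namespace LefschetzChart

variable {f : X → S} {x₀ : X} (χ : LefschetzChart f x₀)

/-- Near `z` the map `f` factors through the product `zw`, whose differential vanishes at the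
origin. -/
theorem mem_criticalSet {z : X} (hz : z ∈ χ.φ.source) (h0 : χ.φ z = 0) : z ∈ criticalSet f := by
  have h1 : HasMFDerivAt (𝓡∂ 4) 𝓘(ℝ, ℂ × ℂ) χ.φ z (mfderiv (𝓡∂ 4) 𝓘(ℝ, ℂ × ℂ) χ.φ z) :=
    ((χ.contMDiffOn_φ.contMDiffAt (χ.φ.open_source.mem_nhds hz)).mdifferentiableAt
      (by simp)).hasMFDerivAt
  have h2 : HasFDerivAt (fun y : ℂ × ℂ => y.1 * y.2) (0 : ℂ × ℂ →L[ℝ] ℂ) (χ.φ z) := by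
    rw [h0]
    have := (hasFDerivAt_fst (𝕜 := ℝ) (p := (0 : ℂ × ℂ))).mul
      (hasFDerivAt_snd (𝕜 := ℝ) (p := (0 : ℂ × ℂ)))
    refine this.congr_fderiv ?_
    ext <;> simp
  have h3 := h2.hasMFDerivAt.comp z h1
  have hfz : χ.ψ (f z) = (χ.φ z).1 * (χ.φ z).2 := χ.normal_form z hz
  have h4 : HasMFDerivAt 𝓘(ℝ, ℂ) (𝓡∂ 2) χ.ψ.symm ((χ.φ z).1 * (χ.φ z).2)
      (mfderiv 𝓘(ℝ, ℂ) (𝓡∂ 2) χ.ψ.symm ((χ.φ z).1 * (χ.φ z).2)) :=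
    ((χ.contMDiffOn_ψ_symm.contMDiffAt (χ.ψ.open_target.mem_nhds
      (hfz ▸ χ.ψ.map_source (χ.mapsTo hz)))).mdifferentiableAt (by simp)).hasMFDerivAt
  have h5 := HasMFDerivAt.comp z h4 h3
  have h6 : f =ᶠ[𝓝 z] (χ.ψ.symm ∘ (fun y : ℂ × ℂ => y.1 * y.2) ∘ χ.φ) := by
    filter_upwards [χ.φ.open_source.mem_nhds hz] with y hy
    simp only [Function.comp_apply]
    rw [← χ.normal_form y hy, χ.ψ.left_inv (χ.mapsTo hy)]
  have h7 := (h5.congr_of_eventuallyEq h6).mfderiv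
  intro hs
  obtain ⟨v, hv⟩ := hs (EuclideanSpace.single (0 : Fin 2) (1 : ℝ) : EuclideanSpace ℝ (Fin 2))
  rw [h7] at hv
  have h8 : (EuclideanSpace.single (0 : Fin 2) (1 : ℝ) : EuclideanSpace ℝ (Fin 2)) = 0 := by
    refine hv.symm.trans ?_
    exact map_zero (mfderiv 𝓘(ℝ, ℂ) (𝓡∂ 2) χ.ψ.symm ((χ.φ z).1 * (χ.φ z).2))
  have := congrArg (fun v : EuclideanSpace ℝ (Fin 2) => v 0) h8
  simp at this

/-- For the value `0` the matching circle is the origin. If the origin lies in the range of the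
chart, it corresponds to a critical point over `y`. So over a regular value the circle is a genuine
circle. -/
theorem apply_ne_zero {y : S} (hy : y ∉ f '' criticalSet f) (hψ : y ∈ χ.ψ.source)
    (hm : matchingCircle (χ.ψ y) ⊆ χ.φ.target) : χ.ψ y ≠ 0 := by
  intro h0
  rw [h0] at hm
  have h1 : (0 : ℂ × ℂ) ∈ χ.φ.target := hm ⟨by simp, by simp⟩
  have h2 := χ.φ.map_target h1
  refine hy ⟨χ.φ.symm 0, χ.mem_criticalSet h2 (χ.φ.right_inv h1), ?_⟩
  refine χ.ψ.injOn (χ.mapsTo h2) hψ ?_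
  rw [χ.normal_form _ h2, χ.φ.right_inv h1, h0]
  simp

theorem apply_symm_eq {y : S} (hψ : y ∈ χ.ψ.source) {v : ℂ × ℂ} (hv : v ∈ χ.φ.target)
    (h : v.1 * v.2 = χ.ψ y) : f (χ.φ.symm v) = y := by
  refine χ.ψ.injOn (χ.mapsTo (χ.φ.map_target hv)) hψ ?_
  rw [χ.normal_form _ (χ.φ.map_target hv), χ.φ.right_inv hv, h]

/-- A matching circle in a fibre is the core of an annulus in the fibre. -/
theorem isTwoSidedIn {y : S} (hψ : y ∈ χ.ψ.source) (h0 : χ.ψ y ≠ 0)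
    (hm : matchingCircle (χ.ψ y) ⊆ χ.φ.target) :
    IsTwoSidedIn (f ⁻¹' {y}) (χ.φ.symm '' matchingCircle (χ.ψ y)) := by
  set ε := χ.ψ y with hε
  have hr := sqrt_norm_pos h0
  -- By compactness of the circle, a whole band about it in the conic stays in the open range of the
  -- chart.
  obtain ⟨ρ, hρ, hρt⟩ : ∃ ρ > 0, ∀ θ : Circle, ∀ s : ℝ, |s| < ρ → conicMap ε θ s ∈ χ.φ.target := by
    have h1 : IsOpen ((fun p : Circle × ℝ => conicMap ε p.1 p.2) ⁻¹' χ.φ.target) :=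
      χ.φ.open_target.preimage (continuous_conicMap h0)
    obtain ⟨u, v, hu, hv, huu, hvv, huv⟩ := generalized_tube_lemma (isCompact_univ (X := Circle))
      (isCompact_singleton (x := (0 : ℝ))) h1 (by
        rintro ⟨θ, s⟩ ⟨-, hs⟩
        obtain rfl : s = 0 := hs
        exact hm (range_conicMap_zero h0 ▸ mem_range_self θ))
    obtain ⟨ρ, hρ, hb⟩ := Metric.isOpen_iff.1 hv 0 (hvv rfl)
    exact ⟨ρ, hρ, fun θ s hs => huv (⟨huu (mem_univ θ), hb (by simpa using hs)⟩ :
      (θ, s) ∈ u ×ˢ v)⟩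
  have hs : ∀ s : Ioo (-1 : ℝ) 1, |ρ * s| < ρ := fun s => by
    rw [abs_mul, abs_of_pos hρ]
    have := abs_lt.2 s.2
    nlinarith
  let e : Circle × Ioo (-1 : ℝ) 1 → X := fun p => χ.φ.symm (conicMap ε p.1 (ρ * p.2))
  have het : ∀ p : Circle × Ioo (-1 : ℝ) 1, conicMap ε p.1 (ρ * p.2) ∈ χ.φ.target :=
    fun p => hρt _ _ (hs p.2)
  have hscale : IsEmbedding fun p : Circle × Ioo (-1 : ℝ) 1 => (p.1, ρ * (p.2 : ℝ)) :=
    IsEmbedding.id.prodMap ((Homeomorph.mulLeft₀ ρ hρ.ne').isEmbedding.comp IsEmbedding.subtypeVal)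
  have he : IsEmbedding e := by
    have h1 : IsEmbedding fun p : Circle × Ioo (-1 : ℝ) 1 =>
        (⟨conicMap ε p.1 (ρ * p.2), het p⟩ : χ.φ.target) :=
      IsEmbedding.codRestrict ((isEmbedding_conicMap h0).comp hscale) _ _
    have h2 := χ.φ.toHomeomorphSourceTarget.symm.isEmbedding.comp h1
    exact IsEmbedding.subtypeVal.comp h2
  -- On the conic the radial parameter is determined by the modulus of the first entry, so these two
  -- strict inequalities cut exactly the band `|s| < ρ` out of the fibre.
  refine ⟨e, he, ⟨χ.φ.source ∩ χ.φ ⁻¹' {v | √‖ε‖ * Real.exp (-ρ) < ‖v.1‖ ∧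
    ‖v.1‖ < √‖ε‖ * Real.exp ρ}, ?_, ?_⟩, ?_⟩
  · refine χ.φ.isOpen_inter_preimage ?_
    have hc : Continuous fun v : ℂ × ℂ => ‖v.1‖ := by fun_prop
    exact (isOpen_lt continuous_const hc).inter (isOpen_lt hc continuous_const)
  · apply Subset.antisymm
    · rintro _ ⟨p, rfl⟩
      refine ⟨χ.apply_symm_eq hψ (het p) (conicMap_mul h0 _ _), χ.φ.map_target (het p), ?_⟩
      have := abs_lt.1 (hs p.2)
      rw [mem_preimage, χ.φ.right_inv (het p), mem_ofPred_eq, norm_conicMap_fst]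
      exact ⟨by gcongr; exact this.1, by gcongr; exact this.2⟩
    · rintro x ⟨hx, hxs, h1, h2⟩
      have h3 : (χ.φ x).1 * (χ.φ x).2 = ε := by
        rw [← χ.normal_form x hxs, hx]
      obtain ⟨θ, hθ⟩ := conicMap_surj h0 h3
      have h4 : Real.log (‖(χ.φ x).1‖ / √‖ε‖) ∈ Ioo (-ρ) ρ := by
        have hpos : 0 < ‖(χ.φ x).1‖ := lt_trans (by positivity) h1
        rw [mem_Ioo, Real.lt_log_iff_exp_lt (by positivity), Real.log_lt_iff_lt_exp (by positivity),
          lt_div_iff₀ hr, div_lt_iff₀ hr]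
        constructor <;> linarith
      refine ⟨(θ, ⟨Real.log (‖(χ.φ x).1‖ / √‖ε‖) / ρ, ?_, ?_⟩), ?_⟩
      · rw [lt_div_iff₀ hρ]; linarith [h4.1]
      · rw [div_lt_iff₀ hρ]; linarith [h4.2]
      · simp only [e]
        rw [mul_div_cancel₀ _ hρ.ne', ← hθ, χ.φ.left_inv hxs]
  · rw [← range_conicMap_zero h0, ← range_comp]
    simp only [e, mul_zero]
    rfl

end LefschetzChart

/-- A continuous bijection from a compact set to a Hausdorff one is a homeomorphism, so it carries
annuli that are open in `F` to annuli that are open in `F'`. -/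
theorem IsTwoSidedIn.image {M : Type*} [TopologicalSpace M] [T2Space M] {F F' c : Set M}
    (hc : IsTwoSidedIn F c) (hF : IsCompact F) {Υ : M → M} (hΥ : ContinuousOn Υ F)
    (hb : BijOn Υ F F') : IsTwoSidedIn F' (Υ '' c) := by
  obtain ⟨e, he, ⟨O, hO, hr⟩, hcore⟩ := hc
  have : CompactSpace F := isCompact_iff_compactSpace.1 hF
  let h : F ≃ₜ F' := Continuous.homeoOfEquivCompactToT2 (f := hb.equiv Υ)
    ((continuousOn_iff_continuous_domRestrict.1 hΥ).subtype_mk _)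
  have hh : ∀ x : F, (h x : M) = Υ x := fun x => rfl
  have heF : ∀ p, e p ∈ F := fun p => (hr.le (mem_range_self p)).1
  refine ⟨fun p => Υ (e p), ?_, ?_, ?_⟩
  · exact IsEmbedding.subtypeVal.comp (h.isEmbedding.comp (he.codRestrict F heF))
  · obtain ⟨O', hO', h1⟩ := (h.isOpenMap _ (hO.preimage continuous_subtype_val))
    refine ⟨O', hO', ?_⟩
    ext x
    constructor
    · rintro ⟨p, rfl⟩
      refine ⟨hb.mapsTo (heF p), ?_⟩
      have : h ⟨e p, heF p⟩ ∈ Subtype.val ⁻¹' O' :=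
        h1 ▸ ⟨_, (hr.le (mem_range_self p)).2, rfl⟩
      exact this
    · rintro ⟨hx, hxO⟩
      have : (⟨x, hx⟩ : F') ∈ h '' (Subtype.val ⁻¹' O) := h1 ▸ hxO
      obtain ⟨z, hz, hzx⟩ := this
      obtain ⟨p, hp⟩ := hr.ge ⟨z.2, hz⟩
      exact ⟨p, by simp only; rw [hp, ← hh, hzx]⟩
  · rw [← hcore, ← range_comp]
    rfl

theorem IsVanishingCycle.isTwoSidedIn [IsManifold (𝓡∂ 4) ∞ X]
    [IsManifold (𝓡∂ 2) ∞ S] [CompactSpace X] [T2Space X] [T2Space S] {f : X → S}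
    (hf : Continuous f) {x₀ : X} {ℓ : ℝ → S} {c : Set X} (hc : IsVanishingCycle f x₀ ℓ c) :
    IsTwoSidedIn (f ⁻¹' {ℓ 1}) c := by
  obtain ⟨hℓ, χ, δ, hδ, hχ, W, γ, hγ, rfl⟩ := hc
  have h1 := hχ δ (right_mem_Icc.2 hδ.1.le)
  have hs : 1 - δ ∈ Icc 0 (1 - δ) := right_mem_Icc.2 (by linarith [hδ.2])
  have h2 := hγ.bijOn _ hs
  rw [add_sub_cancel] at h2
  refine (χ.isTwoSidedIn h1.1 (χ.apply_ne_zero (hℓ.regular δ hδ) h1.1 h1.2) h1.2).image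
    (isClosed_singleton.preimage hf).isCompact ?_ h2
  exact hγ.continuousOn.comp (f := fun x => (x, 1 - δ)) (by fun_prop) fun x hx => ⟨hx, hs⟩

end TwoSided

/-! ### The inverse function theorem on half-spaces -/

section HalfSpaceInverse

variable {E F : Type*} [NormedAddCommGroup E] [NormedSpace ℝ E] [NormedAddCommGroup F]
  [NormedSpace ℝ F]

/-- A continuous right inverse of a smooth map with invertible differentials is smooth. -/
theorem contDiffOn_of_rightInverse [CompleteSpace E] {f : E → F} {g : F → E} {s : Set E}
    {t : Set F} (hs : UniqueDiffOn ℝ s) (ht : UniqueDiffOn ℝ t) (hf : ContDiffOn ℝ ∞ f s)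
    (hg : ContinuousOn g t) (hgt : MapsTo g t s) (hfg : ∀ y ∈ t, f (g y) = y)
    (hf' : ∀ x ∈ s, ∃ A : E ≃L[ℝ] F, (A : E →L[ℝ] F) = fderivWithin ℝ f s x) :
    ContDiffOn ℝ ∞ g t := by
  have hd : ∀ y ∈ t, HasFDerivWithinAt g (ContinuousLinearMap.inverse (fderivWithin ℝ f s (g y)))
      t y := by
    intro y hy
    obtain ⟨A, hA⟩ := hf' _ (hgt hy)
    have h1 : HasFDerivWithinAt f (A : E →L[ℝ] F) s (g y) :=
      hA ▸ ((hf.differentiableOn (by simp)) _ (hgt hy)).hasFDerivWithinAt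
    rw [← hA, ContinuousLinearMap.inverse_equiv]
    exact h1.of_local_left_inverse ((hg y hy).tendsto_nhdsWithin hgt) hy
      (Filter.eventually_of_mem self_mem_nhdsWithin hfg)
  -- Bootstrapping: the derivative of `g` is the inverse of the derivative of `f` at `g y`, and
  -- inversion is smooth, so the derivative is as regular as `g` itself.
  have key : ∀ n : ℕ, ContDiffOn ℝ n g t := by
    intro n
    induction n with
    | zero => exact contDiffOn_zero.2 hg
    | succ n ih =>
      push_cast
      rw [contDiffOn_succ_iff_fderivWithin ht]
      refine ⟨fun y hy => (hd y hy).differentiableWithinAt, by simp, ?_⟩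
      have h2 : ContDiffOn ℝ n (fderivWithin ℝ f s) s :=
        hf.fderivWithin hs (by exact_mod_cast le_top)
      have h3 : ContDiffOn ℝ n (fun y => ContinuousLinearMap.inverse (fderivWithin ℝ f s (g y)))
          t := by
        intro y hy
        obtain ⟨A, hA⟩ := hf' _ (hgt hy)
        have h4 : ContDiffAt ℝ n ContinuousLinearMap.inverse (fderivWithin ℝ f s (g y)) :=
          hA ▸ contDiffAt_map_inverse A
        exact h4.comp_contDiffWithinAt y ((h2.comp ih hgt) y hy)
      exact h3.congr fun y hy => (hd y hy).fderivWithin (ht y hy)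
  exact contDiffOn_infty.2 key

theorem uniqueDiffOn_halfSpace (lam : E →L[ℝ] ℝ) {w : E} (hw : lam w = 1) :
    UniqueDiffOn ℝ {x | 0 ≤ lam x} := by
  refine uniqueDiffOn_convex ?_ ⟨w, ?_⟩
  · exact (convex_Ici (𝕜 := ℝ) (0 : ℝ)).linear_preimage lam.toLinearMap
  · refine mem_interior.2 ⟨{x | 0 < lam x}, fun x (hx : 0 < lam x) => (hx.le : 0 ≤ lam x),
      isOpen_lt continuous_const lam.continuous, ?_⟩
    change 0 < lam w
    rw [hw]; exact one_pos

/-- The inverse function theorem for maps between half-spaces that map boundary points to boundary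
points and interior points to interior points. -/
theorem exists_inverse_halfSpace [FiniteDimensional ℝ E] [FiniteDimensional ℝ F]
    (lam : E →L[ℝ] ℝ) {w : E} (hw : lam w = 1) (mu : F →L[ℝ] ℝ) {v : F} (hv : mu v = 1)
    {f : E → F} {U : Set E} (hU : IsOpen U) {x₀ : E} (hx₀ : x₀ ∈ U) (hx₀' : 0 ≤ lam x₀)
    (hf : ContDiffOn ℝ ∞ f ({x | 0 ≤ lam x} ∩ U))
    (hfm : ∀ x ∈ {x | 0 ≤ lam x} ∩ U, 0 ≤ mu (f x) ∧ (mu (f x) = 0 ↔ lam x = 0))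
    (A : E ≃L[ℝ] F) (hA : HasFDerivWithinAt f (A : E →L[ℝ] F) {x | 0 ≤ lam x} x₀) :
    ∃ (U' : Set E) (V : Set F) (g : F → E), IsOpen U' ∧ U' ⊆ U ∧ x₀ ∈ U' ∧ IsOpen V ∧
      ContDiffOn ℝ ∞ g (V ∩ {y | 0 ≤ mu y}) ∧
      (∀ y ∈ V ∩ {y | 0 ≤ mu y}, g y ∈ U' ∩ {x | 0 ≤ lam x} ∧ f (g y) = y) ∧
      ∀ x ∈ U' ∩ {x | 0 ≤ lam x}, f x ∈ V ∧ g (f x) = x := by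
  set s : Set E := {x | 0 ≤ lam x} with hs
  have hsu : UniqueDiffOn ℝ s := uniqueDiffOn_halfSpace lam hw
  have hsU : UniqueDiffOn ℝ (s ∩ U) := hsu.inter hU
  have hd : ContinuousOn (fderivWithin ℝ f (s ∩ U)) (s ∩ U) :=
    hf.continuousOn_fderivWithin hsU (by simp)
  have hd0 : fderivWithin ℝ f (s ∩ U) x₀ = A :=
    (hA.mono inter_subset_left).fderivWithin (hsU x₀ ⟨hx₀', hx₀⟩)
  -- The extension theorem used below costs the factor `lipschitzExtensionConstant F`. The witness
  -- makes the product with it half of the admissible bound.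
  obtain ⟨c, hc0, hc⟩ : ∃ c : NNReal, 0 < c ∧ (Subsingleton E ∨
      lipschitzExtensionConstant F * c < ‖(A.symm : F →L[ℝ] E)‖₊⁻¹) := by
    have hne : Nontrivial E := ⟨w, 0, fun h => by rw [h, map_zero] at hw; exact zero_ne_one hw⟩
    have h1 : 0 < ‖(A.symm : F →L[ℝ] E)‖₊⁻¹ := inv_pos.2 A.nnnorm_symm_pos
    have h2 : 0 < lipschitzExtensionConstant F := lipschitzExtensionConstant_pos F
    refine ⟨‖(A.symm : F →L[ℝ] E)‖₊⁻¹ / (2 * lipschitzExtensionConstant F), by positivity,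
      Or.inr ?_⟩
    rw [mul_div_assoc', mul_comm, mul_div_mul_right _ _ h2.ne']
    exact half_lt_self h1
  have hopen : {D : E →L[ℝ] F | ‖D - A‖ < c} ∩ range ContinuousLinearEquiv.toContinuousLinearMap ∈
      𝓝 (A : E →L[ℝ] F) := by
    refine Filter.inter_mem ?_ (ContinuousLinearEquiv.nhds A)
    refine (isOpen_lt (by fun_prop) continuous_const).mem_nhds ?_
    simpa using hc0
  have hev : ∀ᶠ x in 𝓝[s ∩ U] x₀, fderivWithin ℝ f (s ∩ U) x ∈
      {D : E →L[ℝ] F | ‖D - A‖ < c} ∩ range ContinuousLinearEquiv.toContinuousLinearMap :=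
    (hd x₀ ⟨hx₀', hx₀⟩).eventually (by rw [hd0]; exact hopen)
  obtain ⟨r, hr, hB⟩ : ∃ r > 0, Metric.ball x₀ r ⊆ U ∧ ∀ x ∈ Metric.ball x₀ r, x ∈ s →
      fderivWithin ℝ f (s ∩ U) x ∈
      {D : E →L[ℝ] F | ‖D - A‖ < c} ∩ range ContinuousLinearEquiv.toContinuousLinearMap := by
    obtain ⟨r, hr, h⟩ := Metric.mem_nhds_iff.1
      (Filter.inter_mem (hU.mem_nhds hx₀) (eventually_nhdsWithin_iff.1 hev))
    exact ⟨r, hr, fun x hx => (h hx).1, fun x hx hxs => (h hx).2 ⟨hxs, (h hx).1⟩⟩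
  set B := Metric.ball x₀ r with hBdef
  have hsB : s ∩ B ⊆ s ∩ U := inter_subset_inter_right _ hB.1
  have hder : ∀ x ∈ s ∩ B, HasFDerivWithinAt f (fderivWithin ℝ f (s ∩ U) x) (s ∩ B) x :=
    fun x hx => ((hf.differentiableOn (by simp)) x (hsB hx)).hasFDerivWithinAt.mono hsB
  have hsBu : UniqueDiffOn ℝ (s ∩ B) := hsu.inter Metric.isOpen_ball
  have hconv : Convex ℝ (s ∩ B) :=
    ((convex_Ici (𝕜 := ℝ) (0 : ℝ)).linear_preimage lam.toLinearMap).inter (convex_ball _ _)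
  -- The half-ball is convex, so the mean value inequality applies although it is not open. `f` then
  -- extends to a homeomorphism `G` of the whole spaces; what remains is that `G` matches the two
  -- half-spaces near `x₀`.
  have happ : ApproximatesLinearOn f (A : E →L[ℝ] F) (s ∩ B) c := by
    intro x hx y hy
    exact hconv.norm_image_sub_le_of_norm_hasFDerivWithin_le' hder
      (fun z hz => (hB.2 z hz.2 hz.1).1.le) hy hx
  obtain ⟨G, hG⟩ := happ.exists_homeomorph_extension hc
  have hx₀B : x₀ ∈ B := Metric.mem_ball_self hr
  obtain ⟨ρ, hρ, hVO⟩ : ∃ ρ > 0, Metric.ball (f x₀) ρ ⊆ G '' B := by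
    refine Metric.isOpen_iff.1 (G.isOpen_image.2 Metric.isOpen_ball) _ ⟨x₀, hx₀B, ?_⟩
    exact (hG ⟨hx₀', hx₀B⟩).symm
  set V := Metric.ball (f x₀) ρ with hV
  have hVB : ∀ z ∈ V, G.symm z ∈ B := by
    intro z hz
    obtain ⟨x, hx, rfl⟩ := hVO hz
    rwa [G.symm_apply_apply]
  -- The open half-ball in the target is connected, and its preimage under `G` never meets the wall,
  -- because boundary points go to boundary points. So it lies on one side, which is decided by the
  -- image of a point slightly inside from `x₀` in the direction `w`.
  have hpos : V ∩ {z | 0 < mu z} ⊆ {z | 0 < lam (G.symm z)} := by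
    refine IsPreconnected.subset_left_of_subset_union (v := {z | lam (G.symm z) < 0})
      (isOpen_lt continuous_const (by fun_prop)) (isOpen_lt (by fun_prop) continuous_const)
      (disjoint_left.2 fun z (h1 : 0 < lam (G.symm z)) (h2 : lam (G.symm z) < 0) =>
        lt_asymm h1 h2) ?_ ?_ ?_
    · rintro z ⟨hz, hzm⟩
      rcases lt_trichotomy (lam (G.symm z)) 0 with h | h | h
      · exact Or.inr h
      · exfalso
        have h1 : G.symm z ∈ s ∩ B := ⟨h.ge, hVB z hz⟩
        have h2 := (hfm _ (hsB h1)).2.2 h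
        rw [hG h1, G.apply_symm_apply] at h2
        exact (ne_of_gt hzm) h2
      · exact Or.inl h
    · have h1 : ContinuousAt (fun ε : ℝ => x₀ + ε • w) 0 := by fun_prop
      have h2 : ContinuousAt (fun ε : ℝ => G (x₀ + ε • w)) 0 := by fun_prop
      have h3 : ∀ᶠ ε : ℝ in 𝓝[>] 0, x₀ + ε • w ∈ B ∧ G (x₀ + ε • w) ∈ V ∧ 0 < ε := by
        refine (Filter.Eventually.filter_mono nhdsWithin_le_nhds (h1.eventually
          (Metric.isOpen_ball.mem_nhds ?_))).and ((Filter.Eventually.filter_mono nhdsWithin_le_nhds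
          (h2.eventually (Metric.isOpen_ball.mem_nhds ?_))).and self_mem_nhdsWithin)
        · beta_reduce
          rw [zero_smul, add_zero]
          exact hx₀B
        · beta_reduce
          rw [zero_smul, add_zero, ← hG ⟨hx₀', hx₀B⟩]
          exact Metric.mem_ball_self hρ
      obtain ⟨ε, h4, h5, h6⟩ := h3.exists
      have h7 : 0 < lam (x₀ + ε • w) := by
        rw [map_add, map_smul, hw, smul_eq_mul, mul_one]
        have : 0 ≤ lam x₀ := hx₀'
        linarith
      have h8 : x₀ + ε • w ∈ s ∩ B := ⟨h7.le, h4⟩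
      refine ⟨G (x₀ + ε • w), ⟨h5, ?_⟩, ?_⟩
      · have h9 := hfm _ (hsB h8)
        rw [hG h8] at h9
        exact lt_of_le_of_ne h9.1 fun h => h7.ne' (h9.2.1 h.symm)
      · change 0 < lam (G.symm (G (x₀ + ε • w)))
        rwa [G.symm_apply_apply]
    · refine Convex.isPreconnected ((convex_ball _ _).inter ?_)
      exact (convex_Ioi (𝕜 := ℝ) (0 : ℝ)).linear_preimage mu.toLinearMap
  -- Boundary points of the target are reached as limits from the inside, along `v`.
  have hnonneg : ∀ z ∈ V, 0 ≤ mu z → 0 ≤ lam (G.symm z) := by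
    intro z hz hzm
    have h1 : Filter.Tendsto (fun ε : ℝ => lam (G.symm (z + ε • v))) (𝓝[>] 0)
        (𝓝 (lam (G.symm z))) := by
      have : ContinuousAt (fun ε : ℝ => lam (G.symm (z + ε • v))) 0 := by fun_prop
      have h := this.tendsto
      simp only [zero_smul, add_zero] at h
      exact h.mono_left nhdsWithin_le_nhds
    refine ge_of_tendsto h1 ?_
    have h2 : ContinuousAt (fun ε : ℝ => z + ε • v) 0 := by fun_prop
    filter_upwards [nhdsWithin_le_nhds (h2.preimage_mem_nhds
      (Metric.isOpen_ball.mem_nhds (by rw [zero_smul, add_zero]; exact hz))), self_mem_nhdsWithin] with ε h3 h4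
    refine (hpos ⟨h3, ?_⟩ : 0 < lam (G.symm (z + ε • v))).le
    change 0 < mu (z + ε • v)
    rw [map_add, map_smul, hv, smul_eq_mul, mul_one]
    have : 0 < ε := h4
    linarith
  have hright : ∀ y ∈ V ∩ {y | 0 ≤ mu y}, G.symm y ∈ s ∩ B ∧ f (G.symm y) = y := by
    rintro y ⟨hy, hym⟩
    have h1 : G.symm y ∈ s ∩ B := ⟨hnonneg y hy hym, hVB y hy⟩
    exact ⟨h1, by rw [hG h1, G.apply_symm_apply]⟩
  refine ⟨B ∩ G ⁻¹' V, V, G.symm, Metric.isOpen_ball.inter (Metric.isOpen_ball.preimage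
    G.continuous), fun x hx => hB.1 hx.1, ⟨hx₀B, ?_⟩, Metric.isOpen_ball, ?_, ?_, ?_⟩
  · rw [mem_preimage, ← hG ⟨hx₀', hx₀B⟩]
    exact Metric.mem_ball_self hρ
  · have hVu : UniqueDiffOn ℝ (V ∩ {y | 0 ≤ mu y}) := by
      rw [inter_comm]
      exact (uniqueDiffOn_halfSpace mu hv).inter Metric.isOpen_ball
    refine contDiffOn_of_rightInverse hsBu hVu (hf.mono hsB) G.symm.continuous.continuousOn
      (fun y hy => (hright y hy).1) (fun y hy => (hright y hy).2) fun x hx => ?_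
    obtain ⟨A', hA'⟩ := (hB.2 x hx.2 hx.1).2
    exact ⟨A', hA'.trans ((hder x hx).fderivWithin (hsBu x hx)).symm⟩
  · intro y hy
    obtain ⟨h1, h2⟩ := hright y hy
    exact ⟨⟨⟨h1.2, by rw [mem_preimage, G.apply_symm_apply]; exact hy.1⟩, h1.1⟩, h2⟩
  · rintro x ⟨⟨hxB, hxV⟩, hxs⟩
    rw [hG ⟨hxs, hxB⟩]
    exact ⟨hxV, G.symm_apply_apply x⟩

end HalfSpaceInverse

/-! ### The parameter of an embedded arc as a smooth function -/

section PathParameter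

/-- The map `f` takes closed subsets of the compact set `K` to closed sets, and preimages under `g`
within the image are such images. -/
theorem ContinuousOn.continuousOn_leftInvOn {α β : Type*} [TopologicalSpace α] [TopologicalSpace β]
    [T2Space β] {f : α → β} {g : β → α} {K : Set α} (hK : IsCompact K) (hf : ContinuousOn f K)
    (hg : LeftInvOn g f K) : ContinuousOn g (f '' K) := by
  refine continuousOn_iff_isClosed.2 fun t ht => ⟨f '' (K ∩ t), ?_, ?_⟩
  · exact ((hK.inter_right ht).image_of_continuousOn (hf.mono inter_subset_left)).isClosed
  · ext y
    constructor
    · rintro ⟨hy, x, hx, rfl⟩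
      rw [mem_preimage, hg hx] at hy
      exact ⟨⟨x, ⟨hx, hy⟩, rfl⟩, x, hx, rfl⟩
    · rintro ⟨⟨x, ⟨hx, hxt⟩, rfl⟩, hy⟩
      exact ⟨by rwa [mem_preimage, hg hx], hy⟩

/-- Positive derivative makes `h` strictly increasing, so its image is a nondegenerate interval,
where derivatives within the set are unique. Then `contDiffOn_of_rightInverse` applies, the
endpoints included. -/
theorem exists_contDiffOn_inverse_Icc {h : ℝ → ℝ} {p q : ℝ} (hpq : p < q)
    (hh : ContDiffOn ℝ ∞ h (Icc p q)) (hd : ∀ t ∈ Icc p q, 0 < derivWithin h (Icc p q) t) :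
    ∃ g : ℝ → ℝ, ContDiffOn ℝ ∞ g (h '' Icc p q) ∧ LeftInvOn g h (Icc p q) := by
  have hmono : StrictMonoOn h (Icc p q) := by
    refine strictMonoOn_of_deriv_pos (convex_Icc p q) hh.continuousOn fun t ht => ?_
    rw [← derivWithin_of_mem_nhds (mem_interior_iff_mem_nhds.1 ht)]
    exact hd t (interior_subset ht)
  have hinv : LeftInvOn (Function.invFunOn h (Icc p q)) h (Icc p q) :=
    hmono.injOn.leftInvOn_invFunOn
  refine ⟨_, ?_, hinv⟩
  refine contDiffOn_of_rightInverse (uniqueDiffOn_Icc hpq) ?_ hh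
    (hh.continuousOn.continuousOn_leftInvOn isCompact_Icc hinv) ?_ ?_ ?_
  · have hpre : IsPreconnected (h '' Icc p q) := isPreconnected_Icc.image _ hh.continuousOn
    refine uniqueDiffOn_convex hpre.ordConnected.convex ?_
    have h1 : p ∈ Icc p q := left_mem_Icc.2 hpq.le
    have h2 : q ∈ Icc p q := right_mem_Icc.2 hpq.le
    refine Set.Nonempty.mono (interior_mono (hpre.Icc_subset (mem_image_of_mem h h1)
      (mem_image_of_mem h h2))) ?_
    rw [interior_Icc]
    exact nonempty_Ioo.2 (hmono h1 h2 hpq)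
  · rintro _ ⟨t, ht, rfl⟩
    rwa [hinv ht]
  · rintro _ ⟨t, ht, rfl⟩
    rw [hinv ht]
  · intro t ht
    refine ⟨ContinuousLinearEquiv.unitsEquivAut ℝ (Units.mk0 _ (hd t ht).ne'), ?_⟩
    ext
    simp [derivWithin]

variable {N : Type*} [TopologicalSpace N] [ChartedSpace (EuclideanHalfSpace 2) N]
  [IsManifold (𝓡∂ 2) ∞ N]

/-- The parameter of a point on a smoothly embedded arc is a smooth function of the point. -/
theorem exists_contMDiffOn_parameter [T2Space N] {ℓ : ℝ → N}
    (hℓ : ContMDiffOn 𝓘(ℝ, ℝ) (𝓡∂ 2) ∞ ℓ (Icc 0 1)) (hinj : InjOn ℓ (Icc 0 1))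
    (hd : ∀ t ∈ Icc (0 : ℝ) 1, mfderivWithin 𝓘(ℝ, ℝ) (𝓡∂ 2) ℓ (Icc 0 1) t ≠ 0) :
    ∃ τ : N → ℝ, ContMDiffOn (𝓡∂ 2) 𝓘(ℝ, ℝ) ∞ τ (ℓ '' Icc 0 1) ∧ LeftInvOn τ ℓ (Icc 0 1) := by
  have hinv : LeftInvOn (Function.invFunOn ℓ (Icc 0 1)) ℓ (Icc 0 1) := hinj.leftInvOn_invFunOn
  refine ⟨_, ?_, hinv⟩
  set τ := Function.invFunOn ℓ (Icc 0 1) with hτ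
  have hτc : ContinuousOn τ (ℓ '' Icc 0 1) :=
    hℓ.continuousOn.continuousOn_leftInvOn isCompact_Icc hinv
  rintro _ ⟨t₀, ht₀, rfl⟩
  set ψ := extChartAt (𝓡∂ 2) (ℓ t₀) with hψ
  have hmem : ∀ t ∈ Icc (0 : ℝ) 1, UniqueMDiffWithinAt 𝓘(ℝ, ℝ) (Icc (0 : ℝ) 1) t := fun t ht =>
    (uniqueDiffOn_Icc zero_lt_one t ht).uniqueMDiffWithinAt
  have hk : ContDiffWithinAt ℝ ∞ (ψ ∘ ℓ) (Icc 0 1) t₀ :=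
    contMDiffWithinAt_iff_contDiffWithinAt.1
      ((contMDiffAt_extChartAt (I := 𝓡∂ 2) (n := ∞) (x := ℓ t₀)).comp_contMDiffWithinAt t₀
        (hℓ t₀ ht₀))
  have hkd : derivWithin (ψ ∘ ℓ) (Icc 0 1) t₀ ≠ 0 := by
    intro h0
    have h1 := mfderiv_comp_mfderivWithin t₀
      (mdifferentiableAt_extChartAt (I := 𝓡∂ 2) (mem_chart_source _ (ℓ t₀)))
      ((hℓ t₀ ht₀).mdifferentiableWithinAt (by simp)) (hmem t₀ ht₀)
    have h2 : mfderivWithin 𝓘(ℝ, ℝ) 𝓘(ℝ, EuclideanSpace ℝ (Fin 2)) (ψ ∘ ℓ) (Icc 0 1) t₀ = 0 := by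
      rw [mfderivWithin_eq_fderivWithin]
      ext1
      exact h0
    rw [h2] at h1
    apply hd t₀ ht₀
    obtain ⟨B, hB⟩ := isInvertible_mfderiv_extChartAt (I := 𝓡∂ 2) (mem_extChartAt_source (ℓ t₀))
    refine ContinuousLinearMap.ext fun v => ?_
    have h3 : mfderiv (𝓡∂ 2) 𝓘(ℝ, EuclideanSpace ℝ (Fin 2)) ψ (ℓ t₀)
        (mfderivWithin 𝓘(ℝ, ℝ) (𝓡∂ 2) ℓ (Icc 0 1) t₀ v) = 0 :=
      (congrArg (fun D : ℝ →L[ℝ] EuclideanSpace ℝ (Fin 2) => D v) h1).symm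
    rw [hψ, ← hB] at h3
    exact B.injective (h3.trans (map_zero B).symm)
  -- A linear form with value `1` on the velocity at `t₀`: along the arc `κ ∘ ψ` is locally an
  -- invertible function of the parameter, so `τ` is near `ℓ t₀` its inverse after `κ ∘ ψ`.
  obtain ⟨κ, hκ⟩ := SeparatingDual.exists_eq_one (R := ℝ) hkd
  have hsm : ContDiffWithinAt ℝ ∞ (fun t => κ (ψ (ℓ t))) (Icc 0 1) t₀ :=
    κ.contDiff.comp_contDiffWithinAt hk
  have hev : ∀ᶠ t in 𝓝[Icc 0 1] t₀, ContMDiffWithinAt 𝓘(ℝ, ℝ) 𝓘(ℝ, ℝ) ∞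
      (fun t => κ (ψ (ℓ t))) (Icc 0 1) t := by
    have h1 : ∀ᶠ t in 𝓝[Icc 0 1] t₀, ℓ t ∈ (chartAt (EuclideanHalfSpace 2) (ℓ t₀)).source :=
      (hℓ.continuousOn t₀ ht₀).eventually
        ((chartAt (EuclideanHalfSpace 2) (ℓ t₀)).open_source.mem_nhds (mem_chart_source _ _))
    filter_upwards [h1, self_mem_nhdsWithin] with t h2 h3
    exact (κ.contDiff (n := ∞)).contMDiff.contMDiffAt.comp_contMDiffWithinAt t
      ((contMDiffAt_extChartAt' (n := ∞) h2).comp_contMDiffWithinAt t (hℓ t h3))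
  obtain ⟨r, hr, hball⟩ : ∃ r > 0, ∀ t ∈ Icc (0 : ℝ) 1, |t - t₀| < r →
      ContDiffWithinAt ℝ ∞ (fun t => κ (ψ (ℓ t))) (Icc 0 1) t ∧
      ℓ t ∈ (chartAt (EuclideanHalfSpace 2) (ℓ t₀)).source := by
    have h1 : ∀ᶠ t in 𝓝[Icc 0 1] t₀, ℓ t ∈ (chartAt (EuclideanHalfSpace 2) (ℓ t₀)).source :=
      (hℓ.continuousOn t₀ ht₀).eventually
        ((chartAt (EuclideanHalfSpace 2) (ℓ t₀)).open_source.mem_nhds (mem_chart_source _ _))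
    obtain ⟨r, hr, h⟩ := Metric.mem_nhdsWithin_iff.1 (hev.and h1)
    exact ⟨r, hr, fun t ht htr => ⟨contMDiffWithinAt_iff_contDiffWithinAt.1 (h ⟨htr, ht⟩).1,
      (h ⟨htr, ht⟩).2⟩⟩
  set J₀ : Set ℝ := Icc 0 1 ∩ Metric.ball t₀ r with hJ₀
  have hJ₀u : UniqueDiffOn ℝ J₀ := (uniqueDiffOn_Icc zero_lt_one).inter Metric.isOpen_ball
  have hcd : ContDiffOn ℝ ∞ (fun t => κ (ψ (ℓ t))) J₀ := fun t ht =>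
    (hball t ht.1 ht.2).1.mono inter_subset_left
  have ht₀J : t₀ ∈ J₀ := ⟨ht₀, Metric.mem_ball_self hr⟩
  have hpos : derivWithin (fun t => κ (ψ (ℓ t))) J₀ t₀ = 1 := by
    have h1 : HasDerivWithinAt (ψ ∘ ℓ) (derivWithin (ψ ∘ ℓ) (Icc 0 1) t₀) J₀ t₀ :=
      (hk.differentiableWithinAt (by simp)).hasDerivWithinAt.mono inter_subset_left
    have h2 := (κ.hasFDerivAt.comp_hasDerivWithinAt t₀ h1).derivWithin (hJ₀u t₀ ht₀J)
    rwa [hκ] at h2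
  have hcont : ContinuousOn (derivWithin (fun t => κ (ψ (ℓ t))) J₀) J₀ :=
    hcd.continuousOn_derivWithin hJ₀u (by simp)
  obtain ⟨r', hr', hr'r, hball'⟩ : ∃ r' > 0, r' < r ∧ ∀ t ∈ J₀, |t - t₀| < r' →
      0 < derivWithin (fun t => κ (ψ (ℓ t))) J₀ t := by
    have h1 : ∀ᶠ t in 𝓝[J₀] t₀, 0 < derivWithin (fun t => κ (ψ (ℓ t))) J₀ t :=
      (hcont t₀ ht₀J).eventually (lt_mem_nhds (by rw [hpos]; exact one_pos))
    obtain ⟨r', hr', h⟩ := Metric.mem_nhdsWithin_iff.1 h1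
    exact ⟨min r' (r / 2), by positivity, (min_le_right _ _).trans_lt (half_lt_self hr),
      fun t ht htr => h ⟨htr.trans_le (min_le_left _ _), ht⟩⟩
  -- A compact interval about `t₀`, truncated to the unit interval; half of `r'` keeps the closed
  -- interval where the derivative is positive.
  set p := max 0 (t₀ - r' / 2) with hp
  set q := min 1 (t₀ + r' / 2) with hq
  have hpq : p < q := by
    rw [hp, hq]
    refine max_lt (lt_min one_pos ?_) (lt_min ?_ ?_)
    · linarith [ht₀.1]
    · linarith [ht₀.2]
    · linarith
  have hJ : ∀ t ∈ Icc p q, t ∈ J₀ ∧ |t - t₀| < r' := by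
    rintro t ⟨h1, h2⟩
    have h3 : |t - t₀| < r' := abs_lt.2 ⟨by linarith [(le_max_right 0 (t₀ - r' / 2)).trans h1],
      by linarith [h2.trans (min_le_right 1 (t₀ + r' / 2))]⟩
    exact ⟨⟨⟨(le_max_left _ _).trans h1, h2.trans (min_le_left _ _)⟩, h3.trans hr'r⟩, h3⟩
  obtain ⟨g, hg, hgi⟩ := exists_contDiffOn_inverse_Icc hpq (hcd.mono fun t ht => (hJ t ht).1)
    fun t ht => by
      rw [((hcd.differentiableOn (by simp) t (hJ t ht).1).hasDerivWithinAt.mono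
        fun t ht => (hJ t ht).1).derivWithin (uniqueDiffOn_Icc hpq t ht)]
      exact hball' t (hJ t ht).1 (hJ t ht).2
  set A : Set N := ℓ '' Icc p q with hA
  -- The arc does not return close to `ℓ t₀` at remote times: this is the continuity of `τ`, which
  -- comes from compactness.
  have hAn : A ∈ 𝓝[ℓ '' Icc 0 1] ℓ t₀ := by
    have h1 : ∀ᶠ y in 𝓝[ℓ '' Icc 0 1] ℓ t₀, |τ y - t₀| < r' / 2 := by
      have h2 : Filter.Tendsto τ (𝓝[ℓ '' Icc 0 1] ℓ t₀) (𝓝 t₀) := by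
        have := hτc _ (mem_image_of_mem ℓ ht₀)
        rwa [ContinuousWithinAt, hinv ht₀] at this
      exact h2.eventually (Metric.ball_mem_nhds t₀ (half_pos hr'))
    filter_upwards [h1, self_mem_nhdsWithin] with y hy hy'
    obtain ⟨t, ht, rfl⟩ := hy'
    rw [hinv ht] at hy
    have := abs_lt.1 hy
    exact ⟨t, ⟨max_le ht.1 (by linarith), le_min ht.2 (by linarith)⟩, rfl⟩
  refine ContMDiffWithinAt.mono_of_mem_nhdsWithin (s := A) ?_ hAn
  have ht₀pq : t₀ ∈ Icc p q := ⟨max_le ht₀.1 (by linarith), le_min ht₀.2 (by linarith)⟩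
  have h1 : ContMDiffWithinAt (𝓡∂ 2) 𝓘(ℝ, ℝ) ∞ (fun y => κ (ψ y)) A (ℓ t₀) :=
    ((κ.contDiff (n := ∞)).contMDiff.contMDiffAt.comp (ℓ t₀)
      (contMDiffAt_extChartAt (I := 𝓡∂ 2) (n := ∞) (x := ℓ t₀))).contMDiffWithinAt
  have h2 : ContMDiffWithinAt 𝓘(ℝ, ℝ) 𝓘(ℝ, ℝ) ∞ g ((fun t => κ (ψ (ℓ t))) '' Icc p q)
      (κ (ψ (ℓ t₀))) := (hg _ ⟨t₀, ht₀pq, rfl⟩).contMDiffWithinAt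
  refine (h2.comp (ℓ t₀) h1 ?_).congr ?_ ?_
  · rintro _ ⟨t, ht, rfl⟩
    exact ⟨t, ht, rfl⟩
  · rintro _ ⟨t, ht, rfl⟩
    rw [hinv (hJ t ht).1.1]
    exact (hgi ht).symm
  · rw [hinv ht₀]
    exact (hgi ht₀pq).symm

end PathParameter

/-! ### A smooth vector field over the velocity of the path -/

section HorizontalLift

variable {X S : Type*} [TopologicalSpace X] [ChartedSpace (EuclideanHalfSpace 4) X]
  [IsManifold (𝓡∂ 4) ∞ X] [TopologicalSpace S] [ChartedSpace (EuclideanHalfSpace 2) S]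
  [IsManifold (𝓡∂ 2) ∞ S]

theorem trivializationAt_tangent_snd {n : ℕ} [NeZero n] {M : Type*} [TopologicalSpace M]
    [ChartedSpace (EuclideanHalfSpace n) M] [IsManifold (𝓡∂ n) ∞ M] {x y : M}
    (hy : y ∈ (chartAt (EuclideanHalfSpace n) x).source) (v : TangentSpace (𝓡∂ n) y) :
    (trivializationAt (EuclideanSpace ℝ (Fin n)) (TangentSpace (𝓡∂ n)) x ⟨y, v⟩).2 =
      mfderiv (𝓡∂ n) 𝓘(ℝ, EuclideanSpace ℝ (Fin n)) (extChartAt (𝓡∂ n) x) y v := by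
  rw [← TangentBundle.continuousLinearMapAt_trivializationAt hy]
  exact (Bundle.Trivialization.continuousLinearMapAt_apply_of_mem (R := ℝ)
    (e := trivializationAt (EuclideanSpace ℝ (Fin n)) (TangentSpace (𝓡∂ n)) x) hy v).symm

/-- The coordinate expression of `f` lives on a relatively open part of a half-space. In the form
`range ∩ Ω` unique differentiability is available, and derivatives within the range are meaningful
at boundary points. -/
theorem exists_isOpen_contDiffOn_writtenInExtChartAt {f : X → S}
    (hf : ContMDiff (𝓡∂ 4) (𝓡∂ 2) ∞ f) (x : X) :
    ∃ Ω : Set (EuclideanSpace ℝ (Fin 4)), IsOpen Ω ∧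
      range (𝓡∂ 4) ∩ Ω = {p ∈ (extChartAt (𝓡∂ 4) x).target |
        f ((extChartAt (𝓡∂ 4) x).symm p) ∈ (extChartAt (𝓡∂ 2) (f x)).source} ∧
      ContDiffOn ℝ ∞ (writtenInExtChartAt (𝓡∂ 4) (𝓡∂ 2) x f) (range (𝓡∂ 4) ∩ Ω) := by
  have hO : IsOpen (f ⁻¹' (extChartAt (𝓡∂ 2) (f x)).source) :=
    (isOpen_extChartAt_source (f x)).preimage hf.continuous
  refine ⟨(𝓡∂ 4).symm ⁻¹' ((chartAt (EuclideanHalfSpace 4) x).symm.source ∩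
    (chartAt (EuclideanHalfSpace 4) x).symm ⁻¹' (f ⁻¹' (extChartAt (𝓡∂ 2) (f x)).source)),
    ((chartAt (EuclideanHalfSpace 4) x).symm.isOpen_inter_preimage hO).preimage
      (𝓡∂ 4).continuous_symm, ?_⟩
  have heq : range (𝓡∂ 4) ∩ (𝓡∂ 4).symm ⁻¹' ((chartAt (EuclideanHalfSpace 4) x).symm.source ∩
      (chartAt (EuclideanHalfSpace 4) x).symm ⁻¹' (f ⁻¹' (extChartAt (𝓡∂ 2) (f x)).source)) =
      (extChartAt (𝓡∂ 4) x).target ∩ (extChartAt (𝓡∂ 4) x).symm ⁻¹'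
        (f ⁻¹' (extChartAt (𝓡∂ 2) (f x)).source) := by
    rw [extChartAt_target, extChartAt_coe_symm]
    ext p
    simp only [mem_inter_iff, mem_preimage, OpenPartialHomeomorph.symm_source, Function.comp]
    tauto
  rw [heq]
  exact ⟨rfl, (contMDiff_iff.1 hf).2 x (f x)⟩

theorem fderivWithin_writtenInExtChartAt_comp {f : X → S} (hf : ContMDiff (𝓡∂ 4) (𝓡∂ 2) ∞ f)
    {x z : X} (hz : z ∈ (extChartAt (𝓡∂ 4) x).source)
    (hz' : f z ∈ (extChartAt (𝓡∂ 2) (f x)).source) (v : EuclideanSpace ℝ (Fin 4)) :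
    fderivWithin ℝ (writtenInExtChartAt (𝓡∂ 4) (𝓡∂ 2) x f) (range (𝓡∂ 4))
      (extChartAt (𝓡∂ 4) x z)
        (mfderiv (𝓡∂ 4) 𝓘(ℝ, EuclideanSpace ℝ (Fin 4)) (extChartAt (𝓡∂ 4) x) z v) =
    mfderiv (𝓡∂ 2) 𝓘(ℝ, EuclideanSpace ℝ (Fin 2)) (extChartAt (𝓡∂ 2) (f x)) (f z)
      (mfderiv (𝓡∂ 4) (𝓡∂ 2) f z v) := by
  obtain ⟨Ω, hΩ, hΩe, hsm⟩ := exists_isOpen_contDiffOn_writtenInExtChartAt hf x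
  have hzc : z ∈ (chartAt (EuclideanHalfSpace 4) x).source := by rwa [extChartAt_source] at hz
  have hzc' : f z ∈ (chartAt (EuclideanHalfSpace 2) (f x)).source := by
    rwa [extChartAt_source] at hz'
  have hmem : extChartAt (𝓡∂ 4) x z ∈ range (𝓡∂ 4) ∩ Ω := by
    rw [hΩe]
    exact ⟨(extChartAt (𝓡∂ 4) x).map_source hz, by rwa [(extChartAt (𝓡∂ 4) x).left_inv hz]⟩
  have h1 : MDifferentiableWithinAt 𝓘(ℝ, EuclideanSpace ℝ (Fin 4)) 𝓘(ℝ, EuclideanSpace ℝ (Fin 2))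
      (writtenInExtChartAt (𝓡∂ 4) (𝓡∂ 2) x f) (range (𝓡∂ 4)) (extChartAt (𝓡∂ 4) x z) := by
    refine mdifferentiableWithinAt_iff_differentiableWithinAt.2 ?_
    refine ((hsm.differentiableOn (by simp)) _ hmem).mono_of_mem_nhdsWithin ?_
    exact inter_mem_nhdsWithin _ (hΩ.mem_nhds hmem.2)
  have h2 : MDifferentiableAt (𝓡∂ 4) 𝓘(ℝ, EuclideanSpace ℝ (Fin 4)) (extChartAt (𝓡∂ 4) x) z :=
    mdifferentiableAt_extChartAt hzc
  have h3 := mfderivWithin_comp z (s := univ) h1 h2.mdifferentiableWithinAt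
    (fun p _ => mem_range_self _) (uniqueMDiffWithinAt_univ _)
  have h4 := mfderiv_comp z (mdifferentiableAt_extChartAt hzc')
    (hf.mdifferentiableAt (by simp) (x := z))
  rw [mfderivWithin_univ, mfderivWithin_univ, mfderivWithin_eq_fderivWithin] at h3
  have h5 : mfderiv (𝓡∂ 4) 𝓘(ℝ, EuclideanSpace ℝ (Fin 2))
      (writtenInExtChartAt (𝓡∂ 4) (𝓡∂ 2) x f ∘ extChartAt (𝓡∂ 4) x) z =
      mfderiv (𝓡∂ 4) 𝓘(ℝ, EuclideanSpace ℝ (Fin 2)) (extChartAt (𝓡∂ 2) (f x) ∘ f) z := by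
    refine Filter.EventuallyEq.mfderiv_eq ?_
    filter_upwards [(isOpen_extChartAt_source (I := 𝓡∂ 4) x).mem_nhds hz] with y hy
    simp only [writtenInExtChartAt, Function.comp, (extChartAt (𝓡∂ 4) x).left_inv hy]
  rw [h3] at h5
  have h6 := h5.trans h4
  exact congrArg (fun D : EuclideanSpace ℝ (Fin 4) →L[ℝ] EuclideanSpace ℝ (Fin 2) => D v) h6

/-- Smoothness of a vector field along `f` is tested on its components in one fixed chart instead of
the chart of each point. -/
theorem contMDiffOn_section_of_extChartAt {Y : Type*} {m : ℕ} {E : Type*} [NormedAddCommGroup E]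
    [NormedSpace ℝ E] {H : Type*} [TopologicalSpace H] {I : ModelWithCorners ℝ E H}
    [TopologicalSpace Y] [ChartedSpace H Y] [NeZero m] {M : Type*} [TopologicalSpace M]
    [ChartedSpace (EuclideanHalfSpace m) M] [IsManifold (𝓡∂ m) ∞ M] (x : M) {f : Y → M} {K : Set Y}
    {v : (z : Y) → TangentSpace (𝓡∂ m) (f z)}
    (hK : ∀ z ∈ K, f z ∈ (extChartAt (𝓡∂ m) x).source) :
    ContMDiffOn I (𝓡∂ m).tangent ∞ (fun z => (⟨f z, v z⟩ : TangentBundle (𝓡∂ m) M)) K ↔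
      ContMDiffOn I (𝓡∂ m) ∞ f K ∧ ContMDiffOn I 𝓘(ℝ, EuclideanSpace ℝ (Fin m)) ∞
        (fun z => (mfderiv (𝓡∂ m) 𝓘(ℝ, EuclideanSpace ℝ (Fin m)) (extChartAt (𝓡∂ m) x) (f z)
          (v z) : EuclideanSpace ℝ (Fin m))) K := by
  have hK' : ∀ z ∈ K, f z ∈ (chartAt (EuclideanHalfSpace m) x).source := fun z hz => by
    simpa only [extChartAt_source] using hK z hz
  rw [(trivializationAt (EuclideanSpace ℝ (Fin m)) (TangentSpace (𝓡∂ m)) x).contMDiffOn_iff]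
  · refine and_congr Iff.rfl (contMDiffOn_congr fun z hz => ?_)
    exact (trivializationAt_tangent_snd (hK' z hz) (v z))
  · intro z hz
    exact (Bundle.Trivialization.mem_source _).2 (hK' z hz)

/-- Near a regular point, smooth vector fields along `f` over a subset lift to smooth vector
fields. -/
theorem exists_local_lift {f : X → S} (hf : ContMDiff (𝓡∂ 4) (𝓡∂ 2) ∞ f) {x : X}
    (hx : Function.Surjective (mfderiv (𝓡∂ 4) (𝓡∂ 2) f x)) {K : Set X}
    {v : (z : X) → TangentSpace (𝓡∂ 2) (f z)}
    (hv : ContMDiffOn (𝓡∂ 4) (𝓡∂ 2).tangent ∞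
      (fun z => (⟨f z, v z⟩ : TangentBundle (𝓡∂ 2) S)) K) :
    ∃ U, IsOpen U ∧ x ∈ U ∧ ∃ W : (z : X) → TangentSpace (𝓡∂ 4) z,
      ContMDiffOn (𝓡∂ 4) (𝓡∂ 4).tangent ∞
        (fun z => (⟨z, W z⟩ : TangentBundle (𝓡∂ 4) X)) (K ∩ U) ∧
      ∀ z ∈ U, mfderiv (𝓡∂ 4) (𝓡∂ 2) f z (W z) = v z := by
  obtain ⟨Ω, hΩ, hΩe, hsm⟩ := exists_isOpen_contDiffOn_writtenInExtChartAt hf x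
  set F := writtenInExtChartAt (𝓡∂ 4) (𝓡∂ 2) x f with hF
  set O : Set X := {z ∈ (extChartAt (𝓡∂ 4) x).source |
    f z ∈ (extChartAt (𝓡∂ 2) (f x)).source} with hO
  have hOo : IsOpen O := (isOpen_extChartAt_source x).inter
    ((isOpen_extChartAt_source (f x)).preimage hf.continuous)
  have hxO : x ∈ O := ⟨mem_extChartAt_source x, mem_extChartAt_source (f x)⟩
  have hmaps : ∀ z ∈ O, extChartAt (𝓡∂ 4) x z ∈ range (𝓡∂ 4) ∩ Ω := by
    rintro z ⟨hz, hz'⟩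
    rw [hΩe]
    exact ⟨(extChartAt (𝓡∂ 4) x).map_source hz, by rwa [(extChartAt (𝓡∂ 4) x).left_inv hz]⟩
  set A : X → EuclideanSpace ℝ (Fin 4) →L[ℝ] EuclideanSpace ℝ (Fin 2) :=
    fun z => fderivWithin ℝ F (range (𝓡∂ 4)) (extChartAt (𝓡∂ 4) x z) with hAdef
  have hA : ContMDiffOn (𝓡∂ 4) 𝓘(ℝ, EuclideanSpace ℝ (Fin 4) →L[ℝ] EuclideanSpace ℝ (Fin 2)) ∞
      A O := by
    have h1 : ContDiffOn ℝ ∞ (fderivWithin ℝ F (range (𝓡∂ 4))) (range (𝓡∂ 4) ∩ Ω) := by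
      refine (hsm.fderivWithin ((𝓡∂ 4).uniqueDiffOn.inter hΩ) (by simp)).congr fun p hp => ?_
      exact (fderivWithin_inter (hΩ.mem_nhds hp.2)).symm
    exact h1.contMDiffOn.comp ((contMDiffOn_extChartAt (x := x)).mono fun z hz => by
      simpa only [extChartAt_source] using hz.1) hmaps
  have hAsurj : Function.Surjective (A x) := by
    intro w
    obtain ⟨B, hB⟩ := isInvertible_mfderiv_extChartAt (I := 𝓡∂ 2) (mem_extChartAt_source (f x))
    obtain ⟨u, hu⟩ := hx (B.symm w)
    refine ⟨mfderiv (𝓡∂ 4) 𝓘(ℝ, EuclideanSpace ℝ (Fin 4)) (extChartAt (𝓡∂ 4) x) x u, ?_⟩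
    refine (fderivWithin_writtenInExtChartAt_comp hf hxO.1 hxO.2 u).trans ?_
    rw [hu, ← hB]
    exact B.apply_symm_apply w
  -- A right inverse `R` of the differential at `x` alone is enough: `A z ∘ R` remains invertible
  -- for `z` near `x`, so `R (A z ∘ R)⁻¹` is a right inverse of `A z` that depends smoothly on `z`.
  obtain ⟨R₀, hR₀⟩ := (A x).toLinearMap.exists_rightInverse_of_surjective
    (LinearMap.range_eq_top.2 hAsurj)
  set R : EuclideanSpace ℝ (Fin 2) →L[ℝ] EuclideanSpace ℝ (Fin 4) := R₀.toContinuousLinearMap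
  have hAR : ContMDiffOn (𝓡∂ 4) 𝓘(ℝ, EuclideanSpace ℝ (Fin 2) →L[ℝ] EuclideanSpace ℝ (Fin 2)) ∞
      (fun z => (A z).comp R) O := hA.clm_comp contMDiffOn_const
  set U : Set X := O ∩ (fun z => (A z).comp R) ⁻¹'
    (range ContinuousLinearEquiv.toContinuousLinearMap) with hU
  refine ⟨U, hAR.continuousOn.isOpen_inter_preimage hOo ContinuousLinearEquiv.isOpen,
    ⟨hxO, ContinuousLinearEquiv.refl ℝ _, ?_⟩, fun z =>
      (mfderivWithin 𝓘(ℝ, EuclideanSpace ℝ (Fin 4)) (𝓡∂ 4) (extChartAt (𝓡∂ 4) x).symm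
        (range (𝓡∂ 4)) (extChartAt (𝓡∂ 4) x z)) (R (ContinuousLinearMap.inverse ((A z).comp R)
          (mfderiv (𝓡∂ 2) 𝓘(ℝ, EuclideanSpace ℝ (Fin 2)) (extChartAt (𝓡∂ 2) (f x)) (f z)
            (v z)))), ?_, ?_⟩
  · ext1 w
    exact (congrArg (fun D : EuclideanSpace ℝ (Fin 2) →ₗ[ℝ] EuclideanSpace ℝ (Fin 2) => D w)
      hR₀).symm
  · refine (contMDiffOn_section_of_extChartAt x (fun z hz => hz.2.1.1)).2 ⟨contMDiffOn_id, ?_⟩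
    have h1 := ((contMDiffOn_section_of_extChartAt (f x) (K := K ∩ U)
      (fun z hz => hz.2.1.2)).1 (hv.mono inter_subset_left)).2
    have h2 : ContMDiffOn (𝓡∂ 4)
        𝓘(ℝ, EuclideanSpace ℝ (Fin 2) →L[ℝ] EuclideanSpace ℝ (Fin 2)) ∞
        (fun z => ContinuousLinearMap.inverse ((A z).comp R)) (K ∩ U) := by
      intro z hz
      obtain ⟨B, hB⟩ := hz.2.2
      have h3 : ContDiffAt ℝ ∞ ContinuousLinearMap.inverse ((A z).comp R) := by
        have h4 : (B : EuclideanSpace ℝ (Fin 2) →L[ℝ] EuclideanSpace ℝ (Fin 2)) = (A z).comp R := hB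
        rw [← h4]
        exact contDiffAt_map_inverse B
      exact h3.contMDiffAt.comp_contMDiffWithinAt z
        ((hAR z hz.2.1).mono fun y (hy : y ∈ K ∩ U) => hy.2.1)
    refine ((R.contDiff.contMDiff (n := ∞)).comp_contMDiffOn (h2.clm_apply h1)).congr fun z hz => ?_
    exact congrArg (fun D : EuclideanSpace ℝ (Fin 4) →L[ℝ] EuclideanSpace ℝ (Fin 4) => D _)
      (mfderiv_extChartAt_comp_mfderivWithin_extChartAt_symm' hz.2.1.1)
  · rintro z ⟨hz, B, hB⟩
    obtain ⟨C, hC⟩ := isInvertible_mfderiv_extChartAt (I := 𝓡∂ 2) hz.2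
    have hinj : Function.Injective (mfderiv (𝓡∂ 2) 𝓘(ℝ, EuclideanSpace ℝ (Fin 2))
        (extChartAt (𝓡∂ 2) (f x)) (f z)) := by
      rw [← hC]
      exact C.injective
    apply hinj
    have h1 := fderivWithin_writtenInExtChartAt_comp hf hz.1 hz.2
      ((mfderivWithin 𝓘(ℝ, EuclideanSpace ℝ (Fin 4)) (𝓡∂ 4) (extChartAt (𝓡∂ 4) x).symm
        (range (𝓡∂ 4)) (extChartAt (𝓡∂ 4) x z)) (R (ContinuousLinearMap.inverse ((A z).comp R)
          (mfderiv (𝓡∂ 2) 𝓘(ℝ, EuclideanSpace ℝ (Fin 2)) (extChartAt (𝓡∂ 2) (f x)) (f z)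
            (v z)))))
    refine h1.symm.trans ?_
    refine (congrArg (A z) (congrArg (fun D : EuclideanSpace ℝ (Fin 4) →L[ℝ]
      EuclideanSpace ℝ (Fin 4) => D _)
      (mfderiv_extChartAt_comp_mfderivWithin_extChartAt_symm' hz.1))).trans ?_
    have h2 : ∀ w, A z (R w) = B w := fun w =>
      (congrArg (fun D : EuclideanSpace ℝ (Fin 2) →L[ℝ] EuclideanSpace ℝ (Fin 2) => D w) hB).symm
    refine (h2 _).trans ?_
    have h3 : ContinuousLinearMap.inverse ((A z).comp R) = B.symm :=
      (congrArg ContinuousLinearMap.inverse hB).symm.trans (ContinuousLinearMap.inverse_equiv B)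
    rw [h3]
    exact B.apply_symm_apply _

/-- The velocity of a vanishing path lifts to a smooth vector field on the inverse image of a part
of the path that contains only regular values. -/
theorem IsVanishingPath.exists_vectorField [CompactSpace X] [T2Space X] [T2Space S] {f : X → S}
    (hf : ContMDiff (𝓡∂ 4) (𝓡∂ 2) ∞ f) {x₀ : X} {ℓ : ℝ → S} (hℓ : IsVanishingPath f x₀ ℓ) {δ : ℝ}
    (hδ : δ ∈ Ioc (0 : ℝ) 1) :
    ∃ W : (x : X) → TangentSpace (𝓡∂ 4) x,
      ContMDiffOn (𝓡∂ 4) (𝓡∂ 4).tangent ∞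
        (fun x => (⟨x, W x⟩ : TangentBundle (𝓡∂ 4) X)) (f ⁻¹' (ℓ '' Icc δ 1)) ∧
      ∀ t ∈ Icc δ 1, ∀ x ∈ f ⁻¹' {ℓ t},
        (mfderiv (𝓡∂ 4) (𝓡∂ 2) f x (W x) : EuclideanSpace ℝ (Fin 2)) =
          mfderivWithin 𝓘(ℝ, ℝ) (𝓡∂ 2) ℓ (Icc 0 1) t (1 : ℝ) := by
  obtain ⟨τ, hτ, hinv⟩ := exists_contMDiffOn_parameter hℓ.contMDiffOn hℓ.injOn hℓ.deriv_ne_zero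
  have hsub : Icc δ 1 ⊆ Icc (0 : ℝ) 1 := Icc_subset_Icc_left hδ.1.le
  set K : Set X := f ⁻¹' (ℓ '' Icc δ 1) with hK
  have hKc : IsClosed K := (isCompact_Icc.image_of_continuousOn
    (hℓ.contMDiffOn.continuousOn.mono hsub)).isClosed.preimage hf.continuous
  -- The velocity of the path as a field along `f`; the parameter function makes it depend smoothly
  -- on `z`.
  let v : (z : X) → TangentSpace (𝓡∂ 2) (f z) := fun z =>
    (mfderivWithin 𝓘(ℝ, ℝ) (𝓡∂ 2) ℓ (Icc 0 1) (τ (f z)) (1 : ℝ) : EuclideanSpace ℝ (Fin 2))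
  have hv : ContMDiffOn (𝓡∂ 4) (𝓡∂ 2).tangent ∞
      (fun z => (⟨f z, v z⟩ : TangentBundle (𝓡∂ 2) S)) K := by
    have h1 : ContMDiffOn 𝓘(ℝ, ℝ) (𝓡∂ 2).tangent ∞
        (fun t : ℝ => tangentMapWithin 𝓘(ℝ, ℝ) (𝓡∂ 2) ℓ (Icc 0 1) ⟨t, (1 : ℝ)⟩) (Icc 0 1) := by
      have h2 : ContMDiff 𝓘(ℝ, ℝ) 𝓘(ℝ, ℝ).tangent ∞
          (fun t : ℝ => (⟨t, (1 : ℝ)⟩ : TangentBundle 𝓘(ℝ, ℝ) ℝ)) :=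
        contMDiff_vectorSpace_iff_contDiff.2 contDiff_const
      exact (hℓ.contMDiffOn.contMDiffOn_tangentMapWithin (m := ∞) le_rfl
        (uniqueDiffOn_Icc zero_lt_one).uniqueMDiffOn).comp h2.contMDiffOn fun t ht => ht
    have h3 : ContMDiffOn (𝓡∂ 4) 𝓘(ℝ, ℝ) ∞ (fun z => τ (f z)) K :=
      (hτ.mono (image_mono hsub)).comp hf.contMDiffOn fun z hz => hz
    refine (h1.comp h3 ?_).congr ?_
    · rintro z ⟨t, ht, htz⟩
      change τ (f z) ∈ Icc 0 1
      rw [← htz, hinv (hsub ht)]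
      exact hsub ht
    · rintro z ⟨t, ht, htz⟩
      have h4 : ∀ (a b : S) (u : EuclideanSpace ℝ (Fin 2)), a = b →
          (⟨a, u⟩ : TangentBundle (𝓡∂ 2) S) = ⟨b, u⟩ := by
        rintro a _ u rfl
        rfl
      refine h4 _ _ _ ?_
      change f z = ℓ (τ (f z))
      rw [← htz, hinv (hsub ht)]
  have hreg : ∀ z ∈ K, Function.Surjective (mfderiv (𝓡∂ 4) (𝓡∂ 2) f z) := by
    rintro z ⟨t, ht, htz⟩
    by_contra hz
    exact hℓ.regular t ⟨hδ.1.trans_le ht.1, ht.2⟩ ⟨z, hz, htz.symm⟩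
  have hloc : ∀ x : K, ∃ U, IsOpen U ∧ (x : X) ∈ U ∧ ∃ W : (z : X) → TangentSpace (𝓡∂ 4) z,
      ContMDiffOn (𝓡∂ 4) (𝓡∂ 4).tangent ∞
        (fun z => (⟨z, W z⟩ : TangentBundle (𝓡∂ 4) X)) (K ∩ U) ∧
      ∀ z ∈ U, mfderiv (𝓡∂ 4) (𝓡∂ 2) f z (W z) = v z := fun x =>
    exists_local_lift hf (hreg x x.2) hv
  choose U hUo hxU W hW hWv using hloc
  -- Being a lift of `v` is an affine condition, so an average of local lifts with weights of sum
  -- one is again a lift.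
  obtain ⟨ρ, hρ⟩ := SmoothPartitionOfUnity.exists_isSubordinate (𝓡∂ 4) hKc U hUo
    fun x hx => mem_iUnion.2 ⟨⟨x, hx⟩, hxU ⟨x, hx⟩⟩
  refine ⟨fun z => ∑ᶠ j, ρ j z • W j z, ?_, ?_⟩
  · intro z hz
    refine ContMDiffWithinAt.finsum_section_of_locallyFinite ?_ fun j => ?_
    · refine ρ.locallyFinite.subset fun j y (hy : ρ j y • W j y ≠ 0) => ?_
      exact left_ne_zero_of_smul hy
    -- The local lift is smooth only on its own open set; outside the support of the weight the
    -- product vanishes near `z`.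
    · by_cases hzj : z ∈ tsupport (ρ j)
      · have h1 : ContMDiffWithinAt (𝓡∂ 4) (𝓡∂ 4).tangent ∞
            (fun z => (⟨z, W j z⟩ : TangentBundle (𝓡∂ 4) X)) K z :=
          (hW j z ⟨hz, hρ j hzj⟩).mono_of_mem_nhdsWithin
            (inter_mem_nhdsWithin _ ((hUo j).mem_nhds (hρ j hzj)))
        exact ContMDiffWithinAt.smul_section ((ρ j).contMDiff z).contMDiffWithinAt h1
      · have h1 : ContMDiffWithinAt (𝓡∂ 4) (𝓡∂ 4).tangent ∞
            (fun z => (⟨z, 0⟩ : TangentBundle (𝓡∂ 4) X)) K z :=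
          (Bundle.contMDiff_zeroSection ℝ (TangentSpace (𝓡∂ 4) : X → Type _) z).contMDiffWithinAt
        refine h1.congr_of_eventuallyEq ?_ ?_
        · filter_upwards [nhdsWithin_le_nhds ((isClosed_tsupport (ρ j)).isOpen_compl.mem_nhds hzj)]
            with y hy
          rw [image_eq_zero_of_notMem_tsupport hy, zero_smul]
        · rw [image_eq_zero_of_notMem_tsupport hzj, zero_smul]
  · intro t ht x hx
    have hxK : x ∈ K := ⟨t, ht, hx.symm⟩
    have hvx : v x = mfderivWithin 𝓘(ℝ, ℝ) (𝓡∂ 2) ℓ (Icc 0 1) t (1 : ℝ) := by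
      change mfderivWithin 𝓘(ℝ, ℝ) (𝓡∂ 2) ℓ (Icc 0 1) (τ (f x)) (1 : ℝ) = _
      rw [show f x = ℓ t from hx, hinv (hsub ht)]
    rw [← hvx]
    have hfin : (Function.support fun j => ρ j x • W j x).Finite := by
      refine (ρ.locallyFinite.point_finite x).subset fun j hj => ?_
      exact left_ne_zero_of_smul hj
    have h1 : mfderiv (𝓡∂ 4) (𝓡∂ 2) f x (∑ᶠ j, ρ j x • W j x) =
        ∑ᶠ j, mfderiv (𝓡∂ 4) (𝓡∂ 2) f x (ρ j x • W j x) :=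
      (mfderiv (𝓡∂ 4) (𝓡∂ 2) f x).toLinearMap.toAddMonoidHom.map_finsum hfin
    refine h1.trans ?_
    have h2 : ∀ j, mfderiv (𝓡∂ 4) (𝓡∂ 2) f x (ρ j x • W j x) = ρ j x • v x := by
      intro j
      by_cases hj : ρ j x = 0
      · rw [hj, zero_smul, zero_smul, map_zero]
      · rw [map_smul, hWv j x (hρ j (subset_tsupport _ hj))]
    rw [finsum_congr h2, ← finsum_smul, ρ.sum_eq_one hxK, one_smul]

end HorizontalLift

/-! ### Straightening a submersion that respects the boundaries -/

section FlowBox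

/-- Boundary points may be recognized in any chart around them, not only in their preferred one.
This turns the equality of boundaries into the hypothesis of the half-space inverse function
theorem. -/
theorem mem_boundary_iff_extChartAt {n : ℕ} [NeZero n] {M : Type*} [TopologicalSpace M]
    [ChartedSpace (EuclideanHalfSpace n) M] [IsManifold (𝓡∂ n) ∞ M] {x z : M}
    (hz : z ∈ (extChartAt (𝓡∂ n) x).source) :
    z ∈ (𝓡∂ n).boundary M ↔ extChartAt (𝓡∂ n) x z 0 = 0 := by
  have hz' : z ∈ (chartAt (EuclideanHalfSpace n) x).source := by rwa [extChartAt_source] at hz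
  have h1 : z ∈ (𝓡∂ n).interior M ↔
      extChartAt (𝓡∂ n) x z ∈ interior (extChartAt (𝓡∂ n) x).target :=
    ModelWithCorners.isInteriorPoint_iff_of_mem_atlas (n := ∞) (by simp) (chart_mem_atlas _ x) hz'
  have h2 : extChartAt (𝓡∂ n) x z ∈ interior (extChartAt (𝓡∂ n) x).target ↔
      0 < extChartAt (𝓡∂ n) x z 0 := by
    rw [extChartAt_target, interior_inter, IsOpen.interior_eq
      ((chartAt (EuclideanHalfSpace n) x).open_target.preimage (𝓡∂ n).continuous_symm),
      interior_range_modelWithCornersEuclideanHalfSpace]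
    refine ⟨fun h => h.2, fun h => ⟨?_, h⟩⟩
    have := (extChartAt (𝓡∂ n) x).map_source hz
    rw [extChartAt_target] at this
    exact this.1
  have h3 : 0 ≤ extChartAt (𝓡∂ n) x z 0 := by
    have : extChartAt (𝓡∂ n) x z ∈ range (𝓡∂ n) := mem_range_self _
    rwa [range_modelWithCornersEuclideanHalfSpace] at this
  rw [← ModelWithCorners.compl_interior, mem_compl_iff, h1, h2, not_lt]
  exact ⟨fun h => le_antisymm h h3, fun h => h.le⟩

/-- Take for `P` a projection onto the kernel of `A`, identified with a plane. Where both `P` and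
`A` vanish, a vector lies in the kernel and is fixed by the projection, hence is zero; equality of
dimensions gives the isomorphism. -/
theorem exists_complement_equiv (A : EuclideanSpace ℝ (Fin 4) →L[ℝ] EuclideanSpace ℝ (Fin 2))
    (hA : Function.Surjective A) :
    ∃ (P : EuclideanSpace ℝ (Fin 4) →L[ℝ] EuclideanSpace ℝ (Fin 2))
      (B : EuclideanSpace ℝ (Fin 4) ≃L[ℝ] EuclideanSpace ℝ (Fin 2) × EuclideanSpace ℝ (Fin 2)),
      (B : EuclideanSpace ℝ (Fin 4) →L[ℝ] _) = P.prod A := by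
  have hker : Module.finrank ℝ (LinearMap.ker A.toLinearMap) =
      Module.finrank ℝ (EuclideanSpace ℝ (Fin 2)) := by
    have h1 := LinearMap.finrank_range_add_finrank_ker A.toLinearMap
    rw [LinearMap.range_eq_top.2 hA, finrank_top] at h1
    simp only [finrank_euclideanSpace, Fintype.card_fin] at h1 ⊢
    omega
  obtain ⟨q, hq⟩ := (LinearMap.ker A.toLinearMap).subtype.exists_leftInverse_of_injective
    (Submodule.ker_subtype _)
  set P₀ := (LinearEquiv.ofFinrankEq _ _ hker).toLinearMap ∘ₗ q with hP₀
  set P := P₀.toContinuousLinearMap with hP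
  have hinj : Function.Injective (P.prod A).toLinearMap := by
    rw [injective_iff_map_eq_zero]
    intro v hv
    have h1 : P₀ v = 0 := congrArg Prod.fst hv
    have h2 : A v = 0 := congrArg Prod.snd hv
    have h3 : q v = 0 := (LinearEquiv.ofFinrankEq _ _ hker).map_eq_zero_iff.1 h1
    have h4 : q v = ⟨v, h2⟩ := congrArg (fun D => D ⟨v, h2⟩) hq
    rw [h3] at h4
    exact (congrArg Subtype.val h4).symm
  refine ⟨P, (LinearMap.linearEquivOfInjective _ hinj (by simp)).toContinuousLinearEquiv, ?_⟩
  ext1 v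
  rfl

variable {X S : Type*} [TopologicalSpace X] [ChartedSpace (EuclideanHalfSpace 4) X]
  [IsManifold (𝓡∂ 4) ∞ X] [TopologicalSpace S] [ChartedSpace (EuclideanHalfSpace 2) S]
  [IsManifold (𝓡∂ 2) ∞ S]

/-- Near a regular point, a map that is compatible with the boundaries is a projection in suitable
coordinates. -/
theorem exists_flowBox {f : X → S} (hf : ContMDiff (𝓡∂ 4) (𝓡∂ 2) ∞ f)
    (hb : (𝓡∂ 4).boundary X = f ⁻¹' (𝓡∂ 2).boundary S) {x : X}
    (hx : Function.Surjective (mfderiv (𝓡∂ 4) (𝓡∂ 2) f x)) :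
    ∃ (P : EuclideanSpace ℝ (Fin 4) →L[ℝ] EuclideanSpace ℝ (Fin 2)) (U : Set X)
      (V : Set (EuclideanSpace ℝ (Fin 2) × EuclideanSpace ℝ (Fin 2)))
      (g : EuclideanSpace ℝ (Fin 2) × EuclideanSpace ℝ (Fin 2) → EuclideanSpace ℝ (Fin 4)),
      IsOpen U ∧ x ∈ U ∧ (∀ z ∈ U, z ∈ (extChartAt (𝓡∂ 4) x).source ∧
        f z ∈ (extChartAt (𝓡∂ 2) (f x)).source) ∧ IsOpen V ∧
      ContDiffOn ℝ ∞ g (V ∩ {p | 0 ≤ p.2 0}) ∧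
      (∀ p ∈ V ∩ {p | 0 ≤ p.2 0}, g p ∈ (extChartAt (𝓡∂ 4) x).target ∧
        (extChartAt (𝓡∂ 4) x).symm (g p) ∈ U ∧ P (g p) = p.1 ∧
        extChartAt (𝓡∂ 2) (f x) (f ((extChartAt (𝓡∂ 4) x).symm (g p))) = p.2) ∧
      (∀ z ∈ U, (P (extChartAt (𝓡∂ 4) x z), extChartAt (𝓡∂ 2) (f x) (f z)) ∈ V ∧
        g (P (extChartAt (𝓡∂ 4) x z), extChartAt (𝓡∂ 2) (f x) (f z)) =
          extChartAt (𝓡∂ 4) x z) ∧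
      ∀ z ∈ U, DifferentiableWithinAt ℝ (writtenInExtChartAt (𝓡∂ 4) (𝓡∂ 2) x f) (range (𝓡∂ 4))
        (extChartAt (𝓡∂ 4) x z) ∧ ∀ a b, P a = P b →
        fderivWithin ℝ (writtenInExtChartAt (𝓡∂ 4) (𝓡∂ 2) x f) (range (𝓡∂ 4))
          (extChartAt (𝓡∂ 4) x z) a =
        fderivWithin ℝ (writtenInExtChartAt (𝓡∂ 4) (𝓡∂ 2) x f) (range (𝓡∂ 4))
          (extChartAt (𝓡∂ 4) x z) b → a = b := by
  obtain ⟨Ω, hΩ, hΩe, hsm⟩ := exists_isOpen_contDiffOn_writtenInExtChartAt hf x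
  set F := writtenInExtChartAt (𝓡∂ 4) (𝓡∂ 2) x f with hF
  have hxs : x ∈ (extChartAt (𝓡∂ 4) x).source := mem_extChartAt_source x
  have hfxs : f x ∈ (extChartAt (𝓡∂ 2) (f x)).source := mem_extChartAt_source (f x)
  have hmaps : ∀ z ∈ (extChartAt (𝓡∂ 4) x).source, f z ∈ (extChartAt (𝓡∂ 2) (f x)).source →
      extChartAt (𝓡∂ 4) x z ∈ range (𝓡∂ 4) ∩ Ω := by
    rintro z hz hz'
    rw [hΩe]
    exact ⟨(extChartAt (𝓡∂ 4) x).map_source hz, by rwa [(extChartAt (𝓡∂ 4) x).left_inv hz]⟩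
  have hdiff : ∀ p ∈ range (𝓡∂ 4) ∩ Ω, DifferentiableWithinAt ℝ F (range (𝓡∂ 4)) p :=
    fun p hp => ((hsm.differentiableOn (by simp)) p hp).mono_of_mem_nhdsWithin
      (inter_mem_nhdsWithin _ (hΩ.mem_nhds hp.2))
  have hsurj : Function.Surjective (fderivWithin ℝ F (range (𝓡∂ 4)) (extChartAt (𝓡∂ 4) x x)) := by
    intro w
    obtain ⟨B, hB⟩ := isInvertible_mfderiv_extChartAt (I := 𝓡∂ 2) hfxs
    obtain ⟨u, hu⟩ := hx (B.symm w)
    refine ⟨mfderiv (𝓡∂ 4) 𝓘(ℝ, EuclideanSpace ℝ (Fin 4)) (extChartAt (𝓡∂ 4) x) x u, ?_⟩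
    refine (fderivWithin_writtenInExtChartAt_comp hf hxs hfxs u).trans ?_
    rw [hu, ← hB]
    exact B.apply_symm_apply w
  obtain ⟨P, B, hB⟩ := exists_complement_equiv _ hsurj
  have hrange : range (𝓡∂ 4) =
      {p | 0 ≤ (EuclideanSpace.proj 0 : EuclideanSpace ℝ (Fin 4) →L[ℝ] ℝ) p} :=
    range_modelWithCornersEuclideanHalfSpace 4
  -- The new coordinates are `(P, F)`: position in the fibre direction and coordinates of the image.
  -- The walls are the zero sets of the first coordinates of `X` and of `S`, and they correspond
  -- because of `hb`.
  obtain ⟨U', V, g, hU', hU'Ω, hxU', hV, hg, hgr, hgl⟩ := exists_inverse_halfSpace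
    (EuclideanSpace.proj 0 : EuclideanSpace ℝ (Fin 4) →L[ℝ] ℝ)
    (w := EuclideanSpace.single 0 1) (by simp)
    ((EuclideanSpace.proj 0 : EuclideanSpace ℝ (Fin 2) →L[ℝ] ℝ).comp
      (ContinuousLinearMap.snd ℝ (EuclideanSpace ℝ (Fin 2)) (EuclideanSpace ℝ (Fin 2))))
    (v := (0, EuclideanSpace.single 0 1)) (by simp) (f := fun p => (P p, F p)) hΩ
    (hmaps x hxs hfxs).2 (by
      have h := (hmaps x hxs hfxs).1
      rw [hrange] at h
      exact h)
    (by
      rw [← hrange]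
      exact P.contDiff.contDiffOn.prodMk hsm)
    (by
      rw [← hrange, hΩe]
      rintro p ⟨hp, hp'⟩
      have h0 : 0 ≤ extChartAt (𝓡∂ 2) (f x) (f ((extChartAt (𝓡∂ 4) x).symm p)) 0 := by
        have : extChartAt (𝓡∂ 2) (f x) (f ((extChartAt (𝓡∂ 4) x).symm p)) ∈ range (𝓡∂ 2) :=
          mem_range_self _
        rwa [range_modelWithCornersEuclideanHalfSpace] at this
      refine ⟨h0, ?_⟩
      have h1 := mem_boundary_iff_extChartAt ((extChartAt (𝓡∂ 4) x).map_target hp)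
      rw [hb, mem_preimage, mem_boundary_iff_extChartAt hp',
        (extChartAt (𝓡∂ 4) x).right_inv hp] at h1
      exact h1)
    B (by
      rw [hB, ← hrange]
      exact P.hasFDerivWithinAt.prodMk (hdiff _ (hmaps x hxs hfxs)).hasFDerivWithinAt)
  rw [← hrange] at hgl hgr
  have hsymm : ∀ p ∈ U' ∩ range (𝓡∂ 4), p ∈ (extChartAt (𝓡∂ 4) x).target ∧
      f ((extChartAt (𝓡∂ 4) x).symm p) ∈ (extChartAt (𝓡∂ 2) (f x)).source := fun p hp => by
    have : p ∈ range (𝓡∂ 4) ∩ Ω := ⟨hp.2, hU'Ω hp.1⟩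
    rwa [hΩe] at this
  have hUr : ∀ z ∈ (extChartAt (𝓡∂ 4) x).source, extChartAt (𝓡∂ 4) x z ∈ U' →
      extChartAt (𝓡∂ 4) x z ∈ U' ∩ range (𝓡∂ 4) := fun z _ hz' => ⟨hz', mem_range_self _⟩
  have hFe : ∀ z ∈ (extChartAt (𝓡∂ 4) x).source,
      F (extChartAt (𝓡∂ 4) x z) = extChartAt (𝓡∂ 2) (f x) (f z) := fun z hz => by
    simp only [hF, writtenInExtChartAt, Function.comp, (extChartAt (𝓡∂ 4) x).left_inv hz]
  refine ⟨P, (extChartAt (𝓡∂ 4) x).source ∩ extChartAt (𝓡∂ 4) x ⁻¹' U', V, g,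
    (continuousOn_extChartAt x).isOpen_inter_preimage (isOpen_extChartAt_source x) hU',
    ⟨hxs, hxU'⟩, ?_, hV, hg, ?_, ?_, ?_⟩
  · rintro z ⟨hz, hz'⟩
    refine ⟨hz, ?_⟩
    have := (hsymm _ (hUr z hz hz')).2
    rwa [(extChartAt (𝓡∂ 4) x).left_inv hz] at this
  · intro p hp
    obtain ⟨h1, h2⟩ := hgr p hp
    have h3 := (hsymm _ h1).1
    refine ⟨h3, ⟨(extChartAt (𝓡∂ 4) x).map_target h3, ?_⟩, congrArg Prod.fst h2,
      congrArg Prod.snd h2⟩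
    rw [mem_preimage, (extChartAt (𝓡∂ 4) x).right_inv h3]
    exact h1.1
  · rintro z ⟨hz, hz'⟩
    have h1 := hgl _ (hUr z hz hz')
    simp only [hFe z hz] at h1
    exact h1
  · rintro z ⟨hz, hz'⟩
    have h1 := hUr z hz hz'
    have h2 := hdiff _ ⟨h1.2, hU'Ω h1.1⟩
    -- Differentiating `g ∘ (P, F) = id` within a set of unique differentiability shows that the
    -- derivative of `(P, F)` has a left inverse.
    refine ⟨h2, fun a b hab hab' => ?_⟩
    set p := extChartAt (𝓡∂ 4) x z with hp
    have h3 : HasFDerivWithinAt (fun p => (P p, F p)) (P.prod (fderivWithin ℝ F (range (𝓡∂ 4)) p))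
        (U' ∩ range (𝓡∂ 4)) p :=
      (P.hasFDerivWithinAt.prodMk h2.hasFDerivWithinAt).mono inter_subset_right
    have hmt : MapsTo (fun p => (P p, F p)) (U' ∩ range (𝓡∂ 4))
        (V ∩ {p : EuclideanSpace ℝ (Fin 2) × EuclideanSpace ℝ (Fin 2) | 0 ≤ p.2 0}) := by
      intro q hq
      refine ⟨(hgl q hq).1, ?_⟩
      have : F q ∈ range (𝓡∂ 2) := mem_range_self _
      rwa [range_modelWithCornersEuclideanHalfSpace] at this
    have h4 := (hg.differentiableOn (by simp) _ (hmt h1)).hasFDerivWithinAt.comp p h3 hmt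
    have h5 : HasFDerivWithinAt id (ContinuousLinearMap.id ℝ (EuclideanSpace ℝ (Fin 4)))
      (U' ∩ range (𝓡∂ 4)) p := hasFDerivWithinAt_id p _
    have hu : UniqueDiffWithinAt ℝ (U' ∩ range (𝓡∂ 4)) p := by
      rw [inter_comm]
      exact (𝓡∂ 4).uniqueDiffOn.inter hU' p ⟨h1.2, h1.1⟩
    have h6 := hu.eq h5 (h4.congr (fun q hq => ((hgl q hq).2).symm) ((hgl p h1).2).symm)
    have h7 : ∀ c, c = fderivWithin ℝ g (V ∩ {p | 0 ≤ p.2 0}) (P p, F p)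
        (P c, fderivWithin ℝ F (range (𝓡∂ 4)) p c) := fun c =>
      congrArg (fun D : EuclideanSpace ℝ (Fin 4) →L[ℝ] EuclideanSpace ℝ (Fin 4) => D c) h6
    rw [h7 a, h7 b, hab, hab']

end FlowBox

/-! ### Time-dependent ordinary differential equations on a closed ball -/

section LocalFlow

open Metric in
/-- The Picard-Lindelöf theorem with solutions that are known to stay in the closed ball. -/
theorem IsPicardLindelof.exists_localFlow_mem_closedBall {E : Type*} [NormedAddCommGroup E]
    [NormedSpace ℝ E] [CompleteSpace E] {f : ℝ → E → E} {tmin tmax : ℝ} {t₀ : Icc tmin tmax}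
    {x₀ : E} {a r L K : NNReal} (hf : IsPicardLindelof f t₀ x₀ a r L K) :
    ∃ α : E × ℝ → E, (∀ x ∈ closedBall x₀ r, α (x, t₀) = x ∧ ∀ t ∈ Icc tmin tmax,
      α (x, t) ∈ closedBall x₀ a ∧
        HasDerivWithinAt (fun t => α (x, t)) (f t (α (x, t))) (Icc tmin tmax) t) ∧
      ContinuousOn α (closedBall x₀ r ×ˢ Icc tmin tmax) := by
  classical
  have (x) (hx : x ∈ closedBall x₀ r) := ODE.FunSpace.exists_isFixedPt_next hf hx
  choose α hα using this
  set α' := fun (x : E) ↦ if hx : x ∈ closedBall x₀ r then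
    α x hx |>.compProj else 0 with hα'
  have h1 : ∀ x ∈ closedBall x₀ r, α' x t₀ = x ∧ ∀ t ∈ Icc tmin tmax,
      α' x t ∈ closedBall x₀ a ∧
        HasDerivWithinAt (fun t => α' x t) (f t (α' x t)) (Icc tmin tmax) t := by
    intro x hx
    have hx' : α' x = (α x hx).compProj := by rw [hα']; beta_reduce; rw [dif_pos hx]
    refine ⟨?_, fun t ht => ⟨?_, ?_⟩⟩
    · rw [hx', ODE.FunSpace.compProj_val, ← hα, ODE.FunSpace.next_apply₀]
    · rw [hx']
      exact (α x hx).compProj_mem_closedBall hf.mul_max_le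
    · rw [hx']
      refine (ODE.hasDerivWithinAt_picard_Icc t₀.2 hf.continuousOn_uncurry
        (α x hx |>.continuous_compProj.continuousOn)
        (fun _ ht' ↦ α x hx |>.compProj_mem_closedBall hf.mul_max_le) x ht).congr_of_mem ?_ ht
      intro t' ht'
      nth_rw 1 [← hα]
      rw [ODE.FunSpace.compProj_of_mem ht', ODE.FunSpace.next_apply]
  obtain ⟨L', h⟩ := ODE.FunSpace.exists_forall_closedBall_funSpace_dist_le_mul hf
  refine ⟨Function.uncurry α', h1, ?_⟩
  refine continuousOn_prod_of_continuousOn_lipschitzOnWith _ L' (fun x hx =>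
    HasDerivWithinAt.continuousOn fun t ht => ((h1 x hx).2 t ht).2) fun t ht =>
      LipschitzOnWith.of_dist_le_mul fun x hx y hy ↦ ?_
  change dist (α' x t) (α' y t) ≤ _
  simp_rw [hα']
  rw [dif_pos hx, dif_pos hy, ODE.FunSpace.compProj_apply, ODE.FunSpace.compProj_apply,
    ← ODE.FunSpace.toContinuousMap_apply_eq_apply, ← ODE.FunSpace.toContinuousMap_apply_eq_apply]
  have : Nonempty (Icc tmin tmax) := ⟨t₀⟩
  apply ContinuousMap.dist_le_iff_of_nonempty.mp
  exact h x y hx hy (α x hx) (α y hy) (hα x hx) (hα y hy)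

/-- With speed at most `L`, a solution that starts in the ball of radius `r / 2` needs at least the
time `r / (2 L)` to leave the ball of radius `r`. This bound on the length serves all subintervals
and all initial times at once, which the later gluing requires. -/
theorem exists_localFlow {E : Type*} [NormedAddCommGroup E] [NormedSpace ℝ E]
    [FiniteDimensional ℝ E] {w : E × ℝ → E} {a₀ : E} {r p q : ℝ} (hr : 0 < r)
    (hw : ContDiffOn ℝ ∞ w (Metric.closedBall a₀ r ×ˢ Icc p q)) :
    ∃ ε > 0, ∀ a b, a ≤ b → Icc a b ⊆ Icc p q → b - a ≤ ε → ∀ s ∈ Icc a b, ∃ α : E × ℝ → E,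
      (∀ x ∈ Metric.closedBall a₀ (r / 2), α (x, s) = x ∧ ∀ t ∈ Icc a b,
        α (x, t) ∈ Metric.closedBall a₀ r ∧
        HasDerivWithinAt (fun t => α (x, t)) (w (α (x, t), t)) (Icc a b) t) ∧
      ContinuousOn α (Metric.closedBall a₀ (r / 2) ×ˢ Icc a b) := by
  have hcomp : IsCompact (Metric.closedBall a₀ r ×ˢ Icc p q) :=
    (isCompact_closedBall a₀ r).prod isCompact_Icc
  obtain ⟨K, hK⟩ := hw.exists_lipschitzOnWith (by simp)
    ((convex_closedBall a₀ r).prod (convex_Icc p q)) hcomp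
  obtain ⟨C, hC⟩ := hcomp.exists_bound_of_continuousOn hw.continuousOn
  -- One is added so that the division by `L` makes sense even if the field vanishes.
  set L : NNReal := C.toNNReal + 1 with hL
  have hL0 : (0 : ℝ) < L := by rw [hL]; push_cast; positivity
  have hCL : ∀ z ∈ Metric.closedBall a₀ r ×ˢ Icc p q, ‖w z‖ ≤ L := by
    intro z hz
    refine (hC z hz).trans ?_
    rw [hL]; push_cast
    linarith [Real.le_coe_toNNReal C]
  refine ⟨r / 2 / L, by positivity, fun a b hab hsub hba s hs => ?_⟩
  have hpl : IsPicardLindelof (fun t x => w (x, t)) (⟨s, hs⟩ : Icc a b) a₀ ⟨r, hr.le⟩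
      ⟨r / 2, by positivity⟩ L K := by
    refine ⟨fun t ht => ?_, fun x hx => ?_, fun t ht x hx => hCL (x, t) ⟨hx, hsub ht⟩, ?_⟩
    · have h1 := hK.comp ((LipschitzWith.prodMk_right t).lipschitzOnWith (s := Metric.closedBall a₀ r))
        fun x hx => ⟨hx, hsub ht⟩
      rw [mul_one] at h1
      exact h1
    · exact hw.continuousOn.comp (by fun_prop) fun t ht => ⟨hx, hsub ht⟩
    · change (L : ℝ) * max (b - s) (s - a) ≤ r - r / 2
      have h1 : max (b - s) (s - a) ≤ r / 2 / L :=
        max_le (by linarith [hs.1]) (by linarith [hs.2])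
      calc (L : ℝ) * max (b - s) (s - a) ≤ L * (r / 2 / L) := by gcongr
        _ = r - r / 2 := by field_simp; ring
  exact hpl.exists_localFlow_mem_closedBall

/-- A smooth field is Lipschitz on the compact convex set, so solutions are unique to the left and
to the right of `s`. -/
theorem eqOn_of_localFlow {E : Type*} [NormedAddCommGroup E] [NormedSpace ℝ E]
    [FiniteDimensional ℝ E] {w : E × ℝ → E} {a₀ : E} {r p q : ℝ}
    (hw : ContDiffOn ℝ ∞ w (Metric.closedBall a₀ r ×ˢ Icc p q)) {a b s : ℝ}
    (hab : Icc a b ⊆ Icc p q) (hs : s ∈ Icc a b) {c c' : ℝ → E}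
    (hc : ∀ t ∈ Icc a b, c t ∈ Metric.closedBall a₀ r ∧
      HasDerivWithinAt c (w (c t, t)) (Icc a b) t)
    (hc' : ∀ t ∈ Icc a b, c' t ∈ Metric.closedBall a₀ r ∧
      HasDerivWithinAt c' (w (c' t, t)) (Icc a b) t) (h : c s = c' s) : EqOn c c' (Icc a b) := by
  obtain ⟨K, hK⟩ := hw.exists_lipschitzOnWith (by simp)
    ((convex_closedBall a₀ r).prod (convex_Icc p q))
    ((isCompact_closedBall a₀ r).prod isCompact_Icc)
  have hlip : ∀ t ∈ Icc a b, LipschitzOnWith K (fun x => w (x, t)) (Metric.closedBall a₀ r) := by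
    intro t ht
    have h1 := hK.comp ((LipschitzWith.prodMk_right t).lipschitzOnWith (s := Metric.closedBall a₀ r))
      fun x hx => ⟨hx, hab ht⟩
    rw [mul_one] at h1
    exact h1
  have hcc : ContinuousOn c (Icc a b) := fun t ht => (hc t ht).2.continuousWithinAt
  have hcc' : ContinuousOn c' (Icc a b) := fun t ht => (hc' t ht).2.continuousWithinAt
  have hl : ∀ t ∈ Ioc a s, t ∈ Icc a b := fun t ht => ⟨ht.1.le, ht.2.trans hs.2⟩
  have hr : ∀ t ∈ Ico s b, t ∈ Icc a b := fun t ht => ⟨hs.1.trans ht.1, ht.2.le⟩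
  have hnl : ∀ t ∈ Ioc a s, Icc a b ∈ 𝓝[Iic t] t := fun t ht =>
    Filter.mem_of_superset (Icc_mem_nhdsLE ht.1) (Icc_subset_Icc_right (hl t ht).2)
  have hnr : ∀ t ∈ Ico s b, Icc a b ∈ 𝓝[Ici t] t := fun t ht =>
    Filter.mem_of_superset (Icc_mem_nhdsGE ht.2) (Icc_subset_Icc_left (hr t ht).1)
  have h1 : EqOn c c' (Icc a s) := ODE_solution_unique_of_mem_Icc_left
    (v := fun t x => w (x, t)) (s := fun _ => Metric.closedBall a₀ r) (K := K)
    (fun t ht => hlip t (hl t ht)) (hcc.mono (Icc_subset_Icc_right hs.2))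
    (fun t ht => (hc t (hl t ht)).2.mono_of_mem_nhdsWithin (hnl t ht))
    (fun t ht => (hc t (hl t ht)).1) (hcc'.mono (Icc_subset_Icc_right hs.2))
    (fun t ht => (hc' t (hl t ht)).2.mono_of_mem_nhdsWithin (hnl t ht))
    (fun t ht => (hc' t (hl t ht)).1) h
  have h2 : EqOn c c' (Icc s b) := ODE_solution_unique_of_mem_Icc_right
    (v := fun t x => w (x, t)) (s := fun _ => Metric.closedBall a₀ r) (K := K)
    (fun t ht => hlip t (hr t ht)) (hcc.mono (Icc_subset_Icc_left hs.1))
    (fun t ht => (hc t (hr t ht)).2.mono_of_mem_nhdsWithin (hnr t ht))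
    (fun t ht => (hc t (hr t ht)).1) (hcc'.mono (Icc_subset_Icc_left hs.1))
    (fun t ht => (hc' t (hr t ht)).2.mono_of_mem_nhdsWithin (hnr t ht))
    (fun t ht => (hc' t (hr t ht)).1) h
  intro t ht
  rcases le_total t s with h3 | h3
  · exact h1 ⟨ht.1, h3⟩
  · exact h2 ⟨h3, ht.2⟩

end LocalFlow

/-! ### Horizontal curves in a flow box -/

section HorizontalBox

variable {X S : Type*} [TopologicalSpace X] [ChartedSpace (EuclideanHalfSpace 4) X]
  [IsManifold (𝓡∂ 4) ∞ X] [TopologicalSpace S] [ChartedSpace (EuclideanHalfSpace 2) S]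
  [IsManifold (𝓡∂ 2) ∞ S]

/-- `W` is a smooth vector field along `f⁻¹(ℓ([δ, 1]))` projected by `f` to the velocity of `ℓ`. -/
structure IsHorizontalField (f : X → S) (ℓ : ℝ → S) (δ : ℝ)
    (W : (x : X) → TangentSpace (𝓡∂ 4) x) : Prop where
  contMDiffOn : ContMDiffOn (𝓡∂ 4) (𝓡∂ 4).tangent ∞
    (fun x => (⟨x, W x⟩ : TangentBundle (𝓡∂ 4) X)) (f ⁻¹' (ℓ '' Icc δ 1))
  projects : ∀ t ∈ Icc δ 1, ∀ x ∈ f ⁻¹' {ℓ t},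
    (mfderiv (𝓡∂ 4) (𝓡∂ 2) f x (W x) : EuclideanSpace ℝ (Fin 2)) =
      mfderivWithin 𝓘(ℝ, ℝ) (𝓡∂ 2) ℓ (Icc 0 1) t (1 : ℝ)

/-- Integral curves of `W` over `ℓ`. -/
structure IsHorizontalCurve (f : X → S) (ℓ : ℝ → S) (W : (x : X) → TangentSpace (𝓡∂ 4) x)
    (c : ℝ → X) (s : Set ℝ) : Prop where
  map_eq : ∀ t ∈ s, f (c t) = ℓ t
  isMIntegralCurveOn : IsMIntegralCurveOn (I := 𝓡∂ 4) c W s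

/-- The coordinates of `W` in the chart about `x`. -/
noncomputable def fieldInChart (x : X) (W : (x : X) → TangentSpace (𝓡∂ 4) x) (z : X) :
    EuclideanSpace ℝ (Fin 4) :=
  mfderiv (𝓡∂ 4) 𝓘(ℝ, EuclideanSpace ℝ (Fin 4)) (extChartAt (𝓡∂ 4) x) z (W z)

theorem smulRight_eq_comp_smulRight {E F : Type*} [NormedAddCommGroup E] [NormedSpace ℝ E]
    [NormedAddCommGroup F] [NormedSpace ℝ F] {D : E →L[ℝ] F} {u : E} {v : F} (h : D u = v) :
    (1 : ℝ →L[ℝ] ℝ).smulRight v = D.comp ((1 : ℝ →L[ℝ] ℝ).smulRight u) := by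
  ext
  simp [h]

theorem hasDerivWithinAt_extChartAt_comp {x : X} {W : (x : X) → TangentSpace (𝓡∂ 4) x} {c : ℝ → X}
    {s : Set ℝ} {t : ℝ} (hc : HasMFDerivWithinAt 𝓘(ℝ, ℝ) (𝓡∂ 4) c s t
      ((1 : ℝ →L[ℝ] ℝ).smulRight (W (c t)))) (ht : c t ∈ (extChartAt (𝓡∂ 4) x).source) :
    HasDerivWithinAt (fun t => extChartAt (𝓡∂ 4) x (c t)) (fieldInChart x W (c t)) s t := by
  have h1 : MDifferentiableAt (𝓡∂ 4) 𝓘(ℝ, EuclideanSpace ℝ (Fin 4)) (extChartAt (𝓡∂ 4) x) (c t) :=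
    mdifferentiableAt_extChartAt (by rwa [extChartAt_source] at ht)
  have h2 := h1.hasMFDerivAt.comp_hasMFDerivWithinAt t hc
  have h3 : HasFDerivWithinAt (fun t => extChartAt (𝓡∂ 4) x (c t))
      ((1 : ℝ →L[ℝ] ℝ).smulRight (fieldInChart x W (c t))) s t := by
    refine hasMFDerivWithinAt_iff_hasFDerivWithinAt.1 ?_
    refine HasMFDerivWithinAt.congr_mfderiv h2 (Eq.symm ?_)
    exact smulRight_eq_comp_smulRight (E := EuclideanSpace ℝ (Fin 4))
      (F := EuclideanSpace ℝ (Fin 4)) (u := W (c t)) rfl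
  refine h3.hasDerivWithinAt.congr_deriv ?_
  simp

theorem hasMFDerivWithinAt_extChartAt_symm_comp {x : X} {W : (x : X) → TangentSpace (𝓡∂ 4) x}
    {c : ℝ → EuclideanSpace ℝ (Fin 4)} {s : Set ℝ} {t : ℝ}
    (hm : ∀ t ∈ s, c t ∈ (extChartAt (𝓡∂ 4) x).target) (ht : t ∈ s)
    (hc : HasDerivWithinAt c (fieldInChart x W ((extChartAt (𝓡∂ 4) x).symm (c t))) s t) :
    HasMFDerivWithinAt 𝓘(ℝ, ℝ) (𝓡∂ 4) (fun t => (extChartAt (𝓡∂ 4) x).symm (c t)) s t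
      ((1 : ℝ →L[ℝ] ℝ).smulRight (W ((extChartAt (𝓡∂ 4) x).symm (c t)))) := by
  have h1 : MDifferentiableWithinAt 𝓘(ℝ, EuclideanSpace ℝ (Fin 4)) (𝓡∂ 4)
      (extChartAt (𝓡∂ 4) x).symm (range (𝓡∂ 4)) (c t) :=
    mdifferentiableWithinAt_extChartAt_symm (hm t ht)
  have h0 : HasFDerivWithinAt c ((1 : ℝ →L[ℝ] ℝ).smulRight
      (fieldInChart x W ((extChartAt (𝓡∂ 4) x).symm (c t)))) s t :=
    hc.hasFDerivWithinAt.congr_fderiv (by ext; simp)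
  have h2 := HasMFDerivWithinAt.comp t h1.hasMFDerivWithinAt h0.hasMFDerivWithinAt
    (fun t ht => extChartAt_target_subset_range x (hm t ht))
  have h3 := mfderivWithin_extChartAt_symm_comp_mfderiv_extChartAt (I := 𝓡∂ 4) (hm t ht)
  have h4 : (mfderivWithin 𝓘(ℝ, EuclideanSpace ℝ (Fin 4)) (𝓡∂ 4) (extChartAt (𝓡∂ 4) x).symm
      (range (𝓡∂ 4)) (c t)) (fieldInChart x W ((extChartAt (𝓡∂ 4) x).symm (c t))) =
      W ((extChartAt (𝓡∂ 4) x).symm (c t)) :=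
    congrArg (fun D : EuclideanSpace ℝ (Fin 4) →L[ℝ] EuclideanSpace ℝ (Fin 4) =>
      D (W ((extChartAt (𝓡∂ 4) x).symm (c t)))) h3
  refine HasMFDerivWithinAt.congr_mfderiv h2 (Eq.symm ?_)
  exact smulRight_eq_comp_smulRight (E := EuclideanSpace ℝ (Fin 4))
    (F := EuclideanSpace ℝ (Fin 4)) h4

/-- The degenerate interval: every linear map is a derivative within one point. It is treated apart
because derivatives are not unique there. -/
theorem isMIntegralCurveOn_singleton {W : (x : X) → TangentSpace (𝓡∂ 4) x} (c : ℝ → X) (a : ℝ) :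
    IsMIntegralCurveOn (I := 𝓡∂ 4) c W {a} := by
  rintro t rfl
  refine ⟨continuousWithinAt_singleton, ?_⟩
  have h : HasFDerivWithinAt (writtenInExtChartAt 𝓘(ℝ, ℝ) (𝓡∂ 4) t c)
      ((1 : ℝ →L[ℝ] ℝ).smulRight (show EuclideanSpace ℝ (Fin 4) from W (c t))) {t} t :=
    HasFDerivWithinAt.singleton
  refine HasFDerivWithinAt.mono h ?_
  simp [chartAt_self_eq]

theorem contMDiffOn_fieldInChart {x : X} {W : (x : X) → TangentSpace (𝓡∂ 4) x} {K : Set X}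
    (hW : ContMDiffOn (𝓡∂ 4) (𝓡∂ 4).tangent ∞
      (fun x => (⟨x, W x⟩ : TangentBundle (𝓡∂ 4) X)) K) :
    ContMDiffOn (𝓡∂ 4) 𝓘(ℝ, EuclideanSpace ℝ (Fin 4)) ∞ (fieldInChart x W)
      (K ∩ (extChartAt (𝓡∂ 4) x).source) :=
  ((contMDiffOn_section_of_extChartAt x (f := id) (fun _ hz => hz.2)).1
    (hW.mono inter_subset_left)).2

/-- In the straightened coordinates a curve over `ℓ` is determined by its component `a` in the fibre
direction, as the other component is that of `ℓ t`. The equation for integral curves becomes `a' = w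
(a, t)` in a plane, without boundary even if `x` is a boundary point. Existence, continuous
dependence and uniqueness are then those of the plane equation. -/
theorem exists_horizontalBox {f : X → S} (hf : ContMDiff (𝓡∂ 4) (𝓡∂ 2) ∞ f)
    (hb : (𝓡∂ 4).boundary X = f ⁻¹' (𝓡∂ 2).boundary S) {x₀ : X} {ℓ : ℝ → S}
    (hℓ : IsVanishingPath f x₀ ℓ) {δ : ℝ} (hδ : δ ∈ Ioc (0 : ℝ) 1)
    {W : (x : X) → TangentSpace (𝓡∂ 4) x} (hW : IsHorizontalField f ℓ δ W) {t₀ : ℝ}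
    (ht₀ : t₀ ∈ Icc δ 1) {x : X} (hx : f x = ℓ t₀) :
    ∃ O, IsOpen O ∧ x ∈ O ∧ ∃ ε > 0, ∀ a b, a ≤ b → Icc a b ⊆ Icc δ 1 →
      (∀ t ∈ Icc a b, |t - t₀| ≤ ε) → ∀ s ∈ Icc a b,
      (∃ Φ : X × ℝ → X, ContinuousOn Φ ((O ∩ f ⁻¹' {ℓ s}) ×ˢ Icc a b) ∧
        ∀ y ∈ O, f y = ℓ s → Φ (y, s) = y ∧
          IsHorizontalCurve f ℓ W (fun t => Φ (y, t)) (Icc a b)) ∧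
      ∀ c c', IsHorizontalCurve f ℓ W c (Icc a b) → IsHorizontalCurve f ℓ W c' (Icc a b) →
        MapsTo c (Icc a b) O → MapsTo c' (Icc a b) O → c s = c' s → EqOn c c' (Icc a b) := by
  have hsub : Icc δ 1 ⊆ Icc (0 : ℝ) 1 := Icc_subset_Icc_left hδ.1.le
  have hreg : Function.Surjective (mfderiv (𝓡∂ 4) (𝓡∂ 2) f x) := by
    by_contra h
    exact hℓ.regular t₀ ⟨hδ.1.trans_le ht₀.1, ht₀.2⟩ ⟨x, h, hx⟩
  obtain ⟨P, U, V, g, hU, hxU, hUs, hV, hg, hgV, hgU, hinj⟩ := exists_flowBox hf hb hreg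
  set e := extChartAt (𝓡∂ 4) x with he
  set ψ := extChartAt (𝓡∂ 2) (f x) with hψ
  have hψr : ∀ y, 0 ≤ ψ y 0 := fun y => by
    have : ψ y ∈ range (𝓡∂ 2) := mem_range_self _
    rwa [range_modelWithCornersEuclideanHalfSpace] at this
  have hℓc : ContinuousOn ℓ (Icc 0 1) := hℓ.contMDiffOn.continuousOn
  have hψo : IsOpen ψ.source := isOpen_extChartAt_source (f x)
  obtain ⟨r, hr, η, hη, hbox⟩ : ∃ r > 0, ∃ η > 0, ∀ a ∈ Metric.closedBall (P (e x)) r,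
      ∀ t ∈ Icc (0 : ℝ) 1, |t - t₀| ≤ η → ℓ t ∈ ψ.source ∧ (a, ψ (ℓ t)) ∈ V := by
    have h1 : ∀ᶠ t in 𝓝[Icc 0 1] t₀, ℓ t ∈ ψ.source := (hℓc t₀ (hsub ht₀)).eventually
      (hψo.mem_nhds (by rw [← hx]; exact mem_extChartAt_source (f x)))
    have h2 : ContinuousWithinAt (fun p : EuclideanSpace ℝ (Fin 2) × ℝ => (p.1, ψ (ℓ p.2)))
        (univ ×ˢ Icc 0 1) (P (e x), t₀) := by
      refine continuousWithinAt_fst.prodMk ?_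
      have h3 : ContinuousAt ψ (ℓ t₀) := by rw [← hx]; exact continuousAt_extChartAt (f x)
      exact (h3.comp_continuousWithinAt (hℓc t₀ (hsub ht₀))).comp (x := (P (e x), t₀))
        (f := Prod.snd) continuousWithinAt_snd fun p hp => hp.2
    have h4 : ∀ᶠ p : EuclideanSpace ℝ (Fin 2) × ℝ in 𝓝[univ ×ˢ Icc 0 1] (P (e x), t₀),
        (p.1, ψ (ℓ p.2)) ∈ V := h2.eventually (hV.mem_nhds (by
          beta_reduce
          rw [← hx]
          exact (hgU x hxU).1))
    have h5 : ∀ᶠ p : EuclideanSpace ℝ (Fin 2) × ℝ in 𝓝[univ ×ˢ Icc 0 1] (P (e x), t₀),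
        ℓ p.2 ∈ ψ.source := by
      rw [nhdsWithin_prod_eq]
      exact Filter.Eventually.prod_inr h1 _
    obtain ⟨ρ, hρ, h6⟩ := Metric.mem_nhdsWithin_iff.1 (h4.and h5)
    refine ⟨ρ / 2, by positivity, ρ / 2, by positivity, fun a ha t ht htt => ?_⟩
    have h7 : (a, t) ∈ Metric.ball (P (e x), t₀) ρ ∩ univ ×ˢ Icc (0 : ℝ) 1 := by
      refine ⟨?_, mem_univ _, ht⟩
      rw [Metric.mem_ball, Prod.dist_eq]
      refine max_lt ?_ ?_
      · exact (Metric.mem_closedBall.1 ha).trans_lt (half_lt_self hρ)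
      · exact lt_of_le_of_lt htt (half_lt_self hρ)
    exact ⟨(h6 h7).2, (h6 h7).1⟩
  set p := max δ (t₀ - η) with hp
  set q := min 1 (t₀ + η) with hq
  have hJ : ∀ t, t ∈ Icc p q ↔ t ∈ Icc δ 1 ∧ |t - t₀| ≤ η := by
    intro t
    rw [hp, hq, abs_le]
    simp only [mem_Icc, max_le_iff, le_min_iff]
    constructor
    · rintro ⟨⟨h1, h2⟩, h3, h4⟩
      exact ⟨⟨h1, h3⟩, by linarith, by linarith⟩
    · rintro ⟨⟨h1, h3⟩, h2, h4⟩
      exact ⟨⟨h1, by linarith⟩, h3, by linarith⟩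
  set B := Metric.closedBall (P (e x)) r with hB
  have hmemV : ∀ a ∈ B, ∀ t ∈ Icc p q, (a, ψ (ℓ t)) ∈ V ∩ {p | 0 ≤ p.2 0} := fun a ha t ht =>
    ⟨(hbox a ha t (hsub ((hJ t).1 ht).1) ((hJ t).1 ht).2).2, hψr _⟩
  have hℓs : ∀ t ∈ Icc p q, ℓ t ∈ ψ.source := fun t ht =>
    (hbox (P (e x)) (Metric.mem_closedBall_self hr.le) t (hsub ((hJ t).1 ht).1)
      ((hJ t).1 ht).2).1
  -- The point of the fibre over `ℓ t` with fibre coordinate `a`.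
  set G : EuclideanSpace ℝ (Fin 2) × ℝ → X := fun z => e.symm (g (z.1, ψ (ℓ z.2))) with hG
  have hGU : ∀ a ∈ B, ∀ t ∈ Icc p q, G (a, t) ∈ U := fun a ha t ht => (hgV _ (hmemV a ha t ht)).2.1
  have hGf : ∀ a ∈ B, ∀ t ∈ Icc p q, f (G (a, t)) = ℓ t := fun a ha t ht =>
    ψ.injOn (hUs _ (hGU a ha t ht)).2 (hℓs t ht) (hgV _ (hmemV a ha t ht)).2.2.2
  have hGe : ∀ a ∈ B, ∀ t ∈ Icc p q, e (G (a, t)) = g (a, ψ (ℓ t)) := fun a ha t ht =>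
    e.right_inv (hgV _ (hmemV a ha t ht)).1
  have hGP : ∀ a ∈ B, ∀ t ∈ Icc p q, P (e (G (a, t))) = a := fun a ha t ht => by
    rw [hGe a ha t ht]
    exact (hgV _ (hmemV a ha t ht)).2.2.1
  have hGinv : ∀ z ∈ U, ∀ t, f z = ℓ t → G (P (e z), t) = z := fun z hz t hzt => by
    change e.symm (g (P (e z), ψ (ℓ t))) = z
    rw [← hzt, (hgU z hz).2]
    exact e.left_inv (hUs z hz).1
  have hGsm : ContMDiffOn 𝓘(ℝ, EuclideanSpace ℝ (Fin 2) × ℝ) (𝓡∂ 4) ∞ G (B ×ˢ Icc p q) := by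
    have h1 : ContMDiffOn 𝓘(ℝ, ℝ) 𝓘(ℝ, EuclideanSpace ℝ (Fin 2)) ∞ (fun t => ψ (ℓ t))
        (Icc p q) := by
      refine (contMDiffOn_extChartAt (x := f x)).comp
        (hℓ.contMDiffOn.mono fun t ht => hsub ((hJ t).1 ht).1) fun t ht => ?_
      have := hℓs t ht
      rwa [hψ, extChartAt_source] at this
    have h2 : ContDiffOn ℝ ∞ (fun z : EuclideanSpace ℝ (Fin 2) × ℝ => (z.1, ψ (ℓ z.2)))
        (B ×ˢ Icc p q) :=
      contDiff_fst.contDiffOn.prodMk ((contMDiffOn_iff_contDiffOn.1 h1).comp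
        contDiff_snd.contDiffOn fun z hz => hz.2)
    have h3 : ContDiffOn ℝ ∞ (fun z : EuclideanSpace ℝ (Fin 2) × ℝ => g (z.1, ψ (ℓ z.2)))
        (B ×ˢ Icc p q) := hg.comp h2 fun z hz => hmemV z.1 hz.1 z.2 hz.2
    exact (contMDiffOn_extChartAt_symm x).comp h3.contMDiffOn
      fun z hz => (hgV _ (hmemV z.1 hz.1 z.2 hz.2)).1
  set w : EuclideanSpace ℝ (Fin 2) × ℝ → EuclideanSpace ℝ (Fin 2) :=
    fun z => P (fieldInChart x W (G z)) with hw
  have hwsm : ContDiffOn ℝ ∞ w (B ×ˢ Icc p q) := by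
    refine P.contDiff.comp_contDiffOn (contMDiffOn_iff_contDiffOn.1
      ((contMDiffOn_fieldInChart hW.contMDiffOn).comp hGsm ?_))
    rintro ⟨a, t⟩ ⟨ha, ht⟩
    exact ⟨⟨t, ((hJ t).1 ht).1, (hGf a ha t ht).symm⟩, (hUs _ (hGU a ha t ht)).1⟩
  have hcurve : ∀ a b, Icc a b ⊆ Icc p q → ∀ c, IsHorizontalCurve f ℓ W c (Icc a b) →
      MapsTo c (Icc a b) U → ∀ t ∈ Icc a b,
      HasDerivWithinAt (fun t => P (e (c t))) (w (P (e (c t)), t)) (Icc a b) t := by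
    intro a b hab c hc hcU t ht
    have h1 := P.hasFDerivAt.comp_hasDerivWithinAt t
      (hasDerivWithinAt_extChartAt_comp (hc.isMIntegralCurveOn t ht) (hUs _ (hcU ht)).1)
    refine h1.congr_deriv ?_
    change P (fieldInChart x W (c t)) = P (fieldInChart x W (G (P (e (c t)), t)))
    rw [hGinv _ (hcU ht) t (hc.map_eq t ht)]
  have hcurve' : ∀ a b, Icc a b ⊆ Icc p q → ∀ α : ℝ → EuclideanSpace ℝ (Fin 2),
      (∀ t ∈ Icc a b, α t ∈ B ∧ HasDerivWithinAt α (w (α t, t)) (Icc a b) t) →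
      IsHorizontalCurve f ℓ W (fun t => G (α t, t)) (Icc a b) := by
    intro a b hab α hα
    refine ⟨fun t ht => hGf _ (hα t ht).1 t (hab ht), ?_⟩
    -- Comparing derivatives needs a nondegenerate interval.
    rcases lt_trichotomy a b with hlt | rfl | hlt
    rotate_left
    · rw [Icc_self]
      exact isMIntegralCurveOn_singleton _ _
    · rw [Icc_eq_empty (not_le.2 hlt)]
      exact fun t ht => absurd ht (notMem_empty t)
    intro t ht
    have hu : UniqueDiffWithinAt ℝ (Icc a b) t := uniqueDiffOn_Icc hlt t ht
    have hαt := hα t ht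
    have hk : HasDerivWithinAt (fun t => ψ (ℓ t))
        (mfderiv (𝓡∂ 2) 𝓘(ℝ, EuclideanSpace ℝ (Fin 2)) ψ (ℓ t)
          (mfderivWithin 𝓘(ℝ, ℝ) (𝓡∂ 2) ℓ (Icc 0 1) t (1 : ℝ))) (Icc a b) t := by
      have h1 : MDifferentiableAt (𝓡∂ 2) 𝓘(ℝ, EuclideanSpace ℝ (Fin 2)) ψ (ℓ t) :=
        mdifferentiableAt_extChartAt (by
          have := hℓs t (hab ht)
          rwa [hψ, extChartAt_source] at this)
      have h2 := (hℓ.contMDiffOn.mdifferentiableOn (by simp)) t (hsub ((hJ t).1 (hab ht)).1)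
      have h3 := h1.hasMFDerivAt.comp_hasMFDerivWithinAt t h2.hasMFDerivWithinAt
      have h4 : HasFDerivWithinAt (fun t => ψ (ℓ t))
          ((show EuclideanSpace ℝ (Fin 2) →L[ℝ] EuclideanSpace ℝ (Fin 2) from
            mfderiv (𝓡∂ 2) 𝓘(ℝ, EuclideanSpace ℝ (Fin 2)) ψ (ℓ t)).comp
          (show ℝ →L[ℝ] EuclideanSpace ℝ (Fin 2) from
            mfderivWithin 𝓘(ℝ, ℝ) (𝓡∂ 2) ℓ (Icc 0 1) t)) (Icc 0 1) t :=
        hasMFDerivWithinAt_iff_hasFDerivWithinAt.1 h3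
      exact h4.hasDerivWithinAt.mono
        fun t ht => hsub ((hJ t).1 (hab ht)).1
    obtain ⟨d, hd⟩ : ∃ d, HasDerivWithinAt (fun t => g (α t, ψ (ℓ t))) d (Icc a b) t :=
      ⟨_, ((hg.differentiableOn (by simp)) _ (hmemV _ hαt.1 t (hab ht))).hasFDerivWithinAt
        |>.comp_hasDerivWithinAt t (hαt.2.prodMk hk) fun t ht => hmemV _ (hα t ht).1 t (hab ht)⟩
    have hcU := hGU _ hαt.1 t (hab ht)
    -- Two vectors with the same image under `P` and under the differential of `f` are equal. The
    -- first equality is the differential equation, the second holds because both project to the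
    -- velocity of `ℓ`.
    have hdY : d = fieldInChart x W (G (α t, t)) := by
      refine (hinj _ hcU).2 _ _ ?_ ?_
      · have h1 := P.hasFDerivAt.comp_hasDerivWithinAt t hd
        refine hu.eq_deriv _ (h1.congr (fun t ht => ?_) ?_) hαt.2
        · exact (hgV _ (hmemV _ (hα t ht).1 t (hab ht))).2.2.1.symm
        · exact (hgV _ (hmemV _ hαt.1 t (hab ht))).2.2.1.symm
      · have h1 : HasDerivWithinAt (fun t => ψ (ℓ t))
            (fderivWithin ℝ (writtenInExtChartAt (𝓡∂ 4) (𝓡∂ 2) x f) (range (𝓡∂ 4))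
              (e (G (α t, t))) d) (Icc a b) t := by
          have h2 := (hinj _ hcU).1.hasFDerivWithinAt
          rw [hGe _ hαt.1 t (hab ht)] at h2 ⊢
          have h3 := h2.comp_hasDerivWithinAt t hd fun t ht =>
            extChartAt_target_subset_range x (hgV _ (hmemV _ (hα t ht).1 t (hab ht))).1
          refine h3.congr (fun t ht => ?_) ?_
          · exact (hgV _ (hmemV _ (hα t ht).1 t (hab ht))).2.2.2.symm
          · exact (hgV _ (hmemV _ hαt.1 t (hab ht))).2.2.2.symm
        have h4 := fderivWithin_writtenInExtChartAt_comp hf (hUs _ hcU).1 (hUs _ hcU).2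
          (W (G (α t, t)))
        refine (hu.eq_deriv _ h1 hk).trans (Eq.trans ?_ h4.symm)
        have h5 := hW.projects t ((hJ t).1 (hab ht)).1 (G (α t, t)) (hGf _ hαt.1 t (hab ht))
        have h6 : ∀ (y y' : S) (u u' : EuclideanSpace ℝ (Fin 2)), y = y' → u = u' →
            (mfderiv (𝓡∂ 2) 𝓘(ℝ, EuclideanSpace ℝ (Fin 2)) ψ y u : EuclideanSpace ℝ (Fin 2)) =
            mfderiv (𝓡∂ 2) 𝓘(ℝ, EuclideanSpace ℝ (Fin 2)) ψ y' u' := by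
          rintro y _ u _ rfl rfl
          rfl
        exact h6 _ _ _ _ (hGf _ hαt.1 t (hab ht)).symm h5.symm
    rw [hdY] at hd
    exact hasMFDerivWithinAt_extChartAt_symm_comp
      (fun t ht => (hgV _ (hmemV _ (hα t ht).1 t (hab ht))).1) ht hd
  obtain ⟨ε, hε, hflow⟩ := exists_localFlow hr hwsm
  -- The half radius leaves room for the flow to move inside the full ball. Since both endpoints are
  -- within `ε / 2` of `t₀`, the interval has length at most `ε`.
  refine ⟨U ∩ (extChartAt (𝓡∂ 4) x).source ∩ (fun z => P (e z)) ⁻¹' Metric.ball (P (e x)) (r / 2),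
    ?_, ⟨⟨hxU, mem_extChartAt_source x⟩, Metric.mem_ball_self (by positivity)⟩,
    min η (ε / 2), by positivity, fun a b hab habδ habε s hs => ?_⟩
  · have h1 : ContinuousOn (fun z => P (e z)) (U ∩ (extChartAt (𝓡∂ 4) x).source) :=
      P.continuous.comp_continuousOn ((continuousOn_extChartAt x).mono inter_subset_right)
    exact h1.isOpen_inter_preimage (hU.inter (isOpen_extChartAt_source x)) Metric.isOpen_ball
  have habJ : Icc a b ⊆ Icc p q := fun t ht =>
    (hJ t).2 ⟨habδ ht, (habε t ht).trans (min_le_left _ _)⟩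
  have hlen : b - a ≤ ε := by
    have h1 := abs_le.1 ((habε a (left_mem_Icc.2 hab)).trans (min_le_right _ _))
    have h2 := abs_le.1 ((habε b (right_mem_Icc.2 hab)).trans (min_le_right _ _))
    linarith [h1.1, h2.2]
  have hball : Metric.ball (P (e x)) (r / 2) ⊆ Metric.closedBall (P (e x)) (r / 2) :=
    Metric.ball_subset_closedBall
  constructor
  · obtain ⟨α, hα, hαc⟩ := hflow a b hab habJ hlen s hs
    refine ⟨fun y => G (α (P (e y.1), y.2), y.2), ?_, ?_⟩
    · have h1 : ContinuousOn (fun y : X × ℝ => P (e y.1))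
          ((U ∩ (extChartAt (𝓡∂ 4) x).source ∩
            (fun z => P (e z)) ⁻¹' Metric.ball (P (e x)) (r / 2) ∩ f ⁻¹' {ℓ s}) ×ˢ Icc a b) :=
        P.continuous.comp_continuousOn ((continuousOn_extChartAt x).comp continuousOn_fst
          fun y hy => hy.1.1.1.2)
      have h2 := hαc.comp (h1.prodMk continuousOn_snd) fun y hy => ⟨hball hy.1.1.2, hy.2⟩
      exact hGsm.continuousOn.comp (h2.prodMk continuousOn_snd) fun y hy =>
        ⟨((hα _ (hball hy.1.1.2)).2 y.2 hy.2).1, habJ hy.2⟩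
    · intro y hy hys
      refine ⟨?_, hcurve' a b habJ _ fun t ht => (hα _ (hball hy.2)).2 t ht⟩
      change G (α (P (e y), s), s) = y
      rw [(hα _ (hball hy.2)).1]
      exact hGinv y hy.1.1 s hys
  · intro c c' hc hc' hcO hcO' hcc
    have h1 : ∀ c : ℝ → X, IsHorizontalCurve f ℓ W c (Icc a b) → MapsTo c (Icc a b)
        (U ∩ (extChartAt (𝓡∂ 4) x).source ∩
          (fun z => P (e z)) ⁻¹' Metric.ball (P (e x)) (r / 2)) →
        ∀ t ∈ Icc a b, P (e (c t)) ∈ B ∧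
          HasDerivWithinAt (fun t => P (e (c t))) (w (P (e (c t)), t)) (Icc a b) t :=
      fun c hc hcO t ht => ⟨Metric.closedBall_subset_closedBall (half_le_self hr.le)
        (hball (hcO ht).2), hcurve a b habJ c hc (fun t ht => (hcO ht).1.1) t ht⟩
    have h2 := eqOn_of_localFlow hwsm habJ hs (h1 c hc hcO) (h1 c' hc' hcO') (by rw [hcc])
    intro t ht
    rw [← hGinv (c t) (hcO ht).1.1 t (hc.map_eq t ht),
      ← hGinv (c' t) (hcO' ht).1.1 t (hc'.map_eq t ht)]
    exact congrArg (fun a => G (a, t)) (h2 ht)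

end HorizontalBox

/-! ### Global existence of parallel transport -/

section ParallelTransport

variable {X S : Type*} [TopologicalSpace X] [ChartedSpace (EuclideanHalfSpace 4) X]
  [IsManifold (𝓡∂ 4) ∞ X] [TopologicalSpace S] [ChartedSpace (EuclideanHalfSpace 2) S]
  [IsManifold (𝓡∂ 2) ∞ S] {f : X → S} {ℓ : ℝ → S} {δ : ℝ} {W : (x : X) → TangentSpace (𝓡∂ 4) x}

theorem IsHorizontalCurve.continuousOn {c : ℝ → X} {s : Set ℝ} (hc : IsHorizontalCurve f ℓ W c s) :
    ContinuousOn c s := fun t ht => (hc.isMIntegralCurveOn t ht).continuousWithinAt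

theorem IsHorizontalCurve.mono {c : ℝ → X} {s s' : Set ℝ} (hc : IsHorizontalCurve f ℓ W c s)
    (h : s' ⊆ s) : IsHorizontalCurve f ℓ W c s' :=
  ⟨fun t ht => hc.map_eq t (h ht), fun t ht => (hc.isMIntegralCurveOn t (h ht)).mono h⟩

theorem IsHorizontalCurve.congr {c c' : ℝ → X} {s : Set ℝ} (hc : IsHorizontalCurve f ℓ W c s)
    (h : ∀ t ∈ s, c' t = c t) : IsHorizontalCurve f ℓ W c' s := by
  refine ⟨fun t ht => by rw [h t ht, hc.map_eq t ht], fun t ht => ?_⟩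
  rw [h t ht]
  exact (hc.isMIntegralCurveOn t ht).congr_of_eventuallyEq
    (Filter.eventually_of_mem self_mem_nhdsWithin h) (h t ht)

theorem IsHorizontalCurve.union {c : ℝ → X} {J J' : Set ℝ} (hJ : IsClosed J) (hJ' : IsClosed J')
    (hc : IsHorizontalCurve f ℓ W c J) (hc' : IsHorizontalCurve f ℓ W c J') :
    IsHorizontalCurve f ℓ W c (J ∪ J') := by
  refine ⟨fun t ht => ht.elim (hc.map_eq t) (hc'.map_eq t), fun t ht => ?_⟩
  by_cases h : t ∈ J <;> by_cases h' : t ∈ J'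
  · exact (hc.isMIntegralCurveOn t h).union (hc'.isMIntegralCurveOn t h')
  · refine (hc.isMIntegralCurveOn t h).mono_of_mem_nhdsWithin ?_
    filter_upwards [nhdsWithin_le_nhds (hJ'.isOpen_compl.mem_nhds h'), self_mem_nhdsWithin]
      with u hu hu' using hu'.resolve_right hu
  · refine (hc'.isMIntegralCurveOn t h').mono_of_mem_nhdsWithin ?_
    filter_upwards [nhdsWithin_le_nhds (hJ.isOpen_compl.mem_nhds h), self_mem_nhdsWithin]
      with u hu hu' using hu'.resolve_left hu
  · exact (ht.elim h h').elim

/-- The fibre over `ℓ s` is moved along horizontal curves over `J`. -/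
def HasFlow (f : X → S) (ℓ : ℝ → S) (W : (x : X) → TangentSpace (𝓡∂ 4) x) (s : ℝ) (J : Set ℝ) :
    Prop :=
  ∃ Φ : X × ℝ → X, ContinuousOn Φ ((f ⁻¹' {ℓ s}) ×ˢ J) ∧
    ∀ y, f y = ℓ s → Φ (y, s) = y ∧ IsHorizontalCurve f ℓ W (fun t => Φ (y, t)) J

/-- Follow the first flow until the time `b` and then the second one. Both pieces are closed and
they agree at the common time, so the result is continuous. The set `J'` may lie on either side of
`J`. -/
theorem HasFlow.union [T2Space S] (hf : Continuous f) {s b : ℝ} {J J' : Set ℝ} (hJ : IsClosed J)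
    (hJ' : IsClosed J') (hs : s ∈ J) (hb : b ∈ J) (hJJ' : J ∩ J' ⊆ {b})
    (h : HasFlow f ℓ W s J) (h' : HasFlow f ℓ W b J') : HasFlow f ℓ W s (J ∪ J') := by
  classical
  obtain ⟨Φ, hΦc, hΦ⟩ := h
  obtain ⟨Ψ, hΨc, hΨ⟩ := h'
  have hmap : ∀ y, f y = ℓ s → f (Φ (y, b)) = ℓ b := fun y hy => (hΦ y hy).2.map_eq b hb
  have h1 : ∀ y, f y = ℓ s → ∀ t ∈ J', (if t ∈ J then Φ (y, t) else Ψ (Φ (y, b), t)) =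
      Ψ (Φ (y, b), t) := by
    intro y hy t ht
    split_ifs with htJ
    · have : t = b := hJJ' ⟨htJ, ht⟩
      rw [this, (hΨ _ (hmap y hy)).1]
    · rfl
  refine ⟨fun p => if p.2 ∈ J then Φ p else Ψ (Φ (p.1, b), p.2), ?_, fun y hy => ⟨?_, ?_⟩⟩
  · have hcl : IsClosed (f ⁻¹' {ℓ s}) := isClosed_singleton.preimage hf
    rw [prod_union]
    refine ContinuousOn.union_of_isClosed ?_ ?_ (hcl.prod hJ) (hcl.prod hJ')
    · exact hΦc.congr fun p hp => if_pos hp.2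
    · refine ContinuousOn.congr (f := fun p : X × ℝ => Ψ (Φ (p.1, b), p.2)) ?_
        fun p hp => h1 p.1 hp.1 p.2 hp.2
      refine hΨc.comp ((hΦc.comp (continuousOn_fst.prodMk continuousOn_const)
        fun p hp => ⟨hp.1, hb⟩).prodMk continuousOn_snd) fun p hp => ⟨hmap p.1 hp.1, hp.2⟩
  · beta_reduce
    rw [if_pos hs, (hΦ y hy).1]
  · refine IsHorizontalCurve.union hJ hJ' ((hΦ y hy).2.congr fun t ht => if_pos ht)
      ((hΨ _ (hmap y hy)).2.congr fun t ht => h1 y hy t ht)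

theorem hasFlow_Icc_trans [T2Space S] (hf : Continuous f) {a b c : ℝ} (hab : a ≤ b) (hbc : b ≤ c)
    (h : ∀ s ∈ Icc a b, HasFlow f ℓ W s (Icc a b)) (h' : ∀ s ∈ Icc b c, HasFlow f ℓ W s (Icc b c)) :
    ∀ s ∈ Icc a c, HasFlow f ℓ W s (Icc a c) := by
  intro s hs
  have hi : Icc a b ∩ Icc b c ⊆ {b} := fun t ht => le_antisymm ht.1.2 ht.2.1
  rw [← Icc_union_Icc_eq_Icc hab hbc] at hs ⊢
  rcases hs with hs | hs
  · exact (h s hs).union hf isClosed_Icc isClosed_Icc hs (right_mem_Icc.2 hab) hi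
      (h' b (left_mem_Icc.2 hbc))
  · rw [union_comm]
    rw [inter_comm] at hi
    exact (h' s hs).union hf isClosed_Icc isClosed_Icc hs (left_mem_Icc.2 hbc) hi
      (h b (right_mem_Icc.2 hab))

section

variable (hf : ContMDiff (𝓡∂ 4) (𝓡∂ 2) ∞ f)
  (hb : (𝓡∂ 4).boundary X = f ⁻¹' (𝓡∂ 2).boundary S) {x₀ : X} (hℓ : IsVanishingPath f x₀ ℓ)
  (hδ : δ ∈ Ioc (0 : ℝ) 1) (hW : IsHorizontalField f ℓ δ W)

include hf hb hℓ hδ hW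

/-- The set of times at which the curves agree is closed because `X` is Hausdorff, and open by
uniqueness in a box about the common point. -/
theorem IsHorizontalCurve.eqOn [T2Space X] {a b s : ℝ} (hab : Icc a b ⊆ Icc δ 1) (hs : s ∈ Icc a b)
    {c c' : ℝ → X} (hc : IsHorizontalCurve f ℓ W c (Icc a b))
    (hc' : IsHorizontalCurve f ℓ W c' (Icc a b)) (h : c s = c' s) : EqOn c c' (Icc a b) := by
  have hcc := continuousOn_iff_continuous_domRestrict.1 hc.continuousOn
  have hcc' := continuousOn_iff_continuous_domRestrict.1 hc'.continuousOn
  have hclopen : IsClopen {t : Icc a b | c t = c' t} := by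
    refine ⟨isClosed_eq hcc hcc', isOpen_iff_mem_nhds.2 fun t₁ ht₁ => ?_⟩
    obtain ⟨O, hO, hcO, ε, hε, hbox⟩ := exists_horizontalBox hf hb hℓ hδ hW (hab t₁.2)
      (hc.map_eq t₁ t₁.2)
    have h1 : ∀ᶠ t in 𝓝[Icc a b] (t₁ : ℝ), c t ∈ O ∧ c' t ∈ O :=
      ((hc.continuousOn t₁ t₁.2).eventually (hO.mem_nhds hcO)).and
        ((hc'.continuousOn t₁ t₁.2).eventually (hO.mem_nhds (by
          rw [← show c t₁ = c' t₁ from ht₁]; exact hcO)))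
    obtain ⟨η, hη, h2⟩ := Metric.mem_nhdsWithin_iff.1 h1
    set ρ := min (η / 2) ε with hρ
    have hρ0 : 0 < ρ := by positivity
    have hsub : Icc (max a (t₁ - ρ)) (min b (t₁ + ρ)) ⊆ Icc a b ∩ {t | |t - t₁| ≤ ρ} := by
      intro t ht
      have h3 := max_le_iff.1 ht.1
      have h4 := le_min_iff.1 ht.2
      exact ⟨⟨h3.1, h4.1⟩,
        (abs_le.2 ⟨by linarith [h3.2], by linarith [h4.2]⟩ : |t - (t₁ : ℝ)| ≤ ρ)⟩
    have hmem : (t₁ : ℝ) ∈ Icc (max a (t₁ - ρ)) (min b (t₁ + ρ)) :=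
      ⟨max_le t₁.2.1 (by linarith), le_min t₁.2.2 (by linarith)⟩
    have hO' : ∀ t ∈ Icc (max a (t₁ - ρ)) (min b (t₁ + ρ)), c t ∈ O ∧ c' t ∈ O := fun t ht =>
      h2 ⟨lt_of_le_of_lt ((hsub ht).2.trans (min_le_left _ _)) (half_lt_self hη), (hsub ht).1⟩
    have heq := (hbox _ _ (hmem.1.trans hmem.2) (fun t ht => hab (hsub ht).1)
      (fun t ht => (hsub ht).2.trans (min_le_right _ _)) t₁ hmem).2 c c'
      (hc.mono fun t ht => (hsub ht).1) (hc'.mono fun t ht => (hsub ht).1)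
      (fun t ht => (hO' t ht).1) (fun t ht => (hO' t ht).2) ht₁
    refine Filter.mem_of_superset (Metric.ball_mem_nhds t₁ hρ0) fun t ht => heq ?_
    have h5 := abs_lt.1 (show |(t : ℝ) - t₁| < ρ from ht)
    exact ⟨max_le t.2.1 (by linarith [h5.1]), le_min t.2.2 (by linarith [h5.2])⟩
  have : PreconnectedSpace (Icc a b) := Subtype.preconnectedSpace isPreconnected_Icc
  have huniv := hclopen.eq_univ ⟨⟨s, hs⟩, h⟩
  intro t ht
  have : (⟨t, ht⟩ : Icc a b) ∈ {t : Icc a b | c t = c' t} := by rw [huniv]; exact mem_univ _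
  exact this

/-- Finitely many boxes cover the compact fibre over `ℓ t₀` and hence all fibres nearby, so a common
time step exists. The local flows agree where they overlap, by uniqueness, and glue. -/
theorem exists_hasFlow_near [CompactSpace X] [T2Space X] [T2Space S] {t₀ : ℝ} (ht₀ : t₀ ∈ Icc δ 1) :
    ∃ ε > 0, ∀ a b, a ≤ b → Icc a b ⊆ Icc δ 1 → (∀ t ∈ Icc a b, |t - t₀| ≤ ε) →
      ∀ s ∈ Icc a b, HasFlow f ℓ W s (Icc a b) := by
  have hsub : Icc δ 1 ⊆ Icc (0 : ℝ) 1 := Icc_subset_Icc_left hδ.1.le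
  choose O hO hxO ε hε hbox using fun x : f ⁻¹' {ℓ t₀} =>
    exists_horizontalBox hf hb hℓ hδ hW ht₀ x.2
  have hcomp : IsCompact (f ⁻¹' {ℓ t₀}) := (isClosed_singleton.preimage hf.continuous).isCompact
  obtain ⟨T, hT⟩ := hcomp.elim_finite_subcover O hO fun x hx => mem_iUnion.2 ⟨⟨x, hx⟩, hxO ⟨x, hx⟩⟩
  set OT := ⋃ x ∈ T, O x with hOT
  have hOTo : IsOpen OT := isOpen_biUnion fun x _ => hO x
  -- The complement of the boxes is compact, so its image is closed; it misses `ℓ t₀` and therefore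
  -- also `ℓ t` for `t` near `t₀`.
  have hcl : IsClosed (f '' OTᶜ) := (hOTo.isClosed_compl.isCompact.image hf.continuous).isClosed
  have hnot : ℓ t₀ ∉ f '' OTᶜ := by
    rintro ⟨y, hy, hyt⟩
    exact hy (hT hyt)
  have hev : ∀ᶠ t in 𝓝[Icc δ 1] t₀, ∀ y, f y = ℓ t → y ∈ OT := by
    filter_upwards [((hℓ.contMDiffOn.continuousOn.mono hsub) t₀ ht₀).eventually
      (hcl.isOpen_compl.mem_nhds hnot)] with t ht y hy
    by_contra hyO
    exact ht ⟨y, hyO, hy⟩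
  obtain ⟨η, hη, hηO⟩ := Metric.mem_nhdsWithin_iff.1 hev
  obtain ⟨ε', hε'T, hε'η, hε'⟩ : ∃ ε', (∀ x ∈ T, ε' ≤ ε x) ∧ ε' < η ∧ 0 < ε' := by
    have h1 : ∀ᶠ e in 𝓝[>] (0 : ℝ), ∀ x ∈ T, e ≤ ε x := by
      refine (Filter.eventually_all_finset T).2 fun x _ => ?_
      exact nhdsWithin_le_nhds (Iic_mem_nhds (hε x))
    have h2 : ∀ᶠ e in 𝓝[>] (0 : ℝ), e < η := nhdsWithin_le_nhds (Iio_mem_nhds hη)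
    exact (h1.and (h2.and self_mem_nhdsWithin)).exists
  refine ⟨ε', hε', fun a b hab habδ habε s hs => ?_⟩
  have hidx : ∀ y, f y = ℓ s → ∃ x ∈ T, y ∈ O x := by
    intro y hy
    have h1 : y ∈ OT := hηO ⟨lt_of_le_of_lt (habε s hs) hε'η, habδ hs⟩ y hy
    simpa [hOT] using h1
  -- An empty fibre over `ℓ t₀` makes the nearby fibres empty as well, and any map is a flow.
  -- Otherwise `X` is nonempty, which `choose!` needs for its default values.
  rcases isEmpty_or_nonempty (f ⁻¹' {ℓ t₀}) with hemp | hne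
  · have h1 : ∀ y, f y ≠ ℓ s := fun y hy => by
      obtain ⟨x, -⟩ := hidx y hy
      exact hemp.elim x
    exact ⟨Prod.fst, continuousOn_fst, fun y hy => absurd hy (h1 y)⟩
  have : Nonempty X := hne.map Subtype.val
  have hloc := fun x (hx : x ∈ T) => (hbox x a b hab habδ
    (fun t ht => (habε t ht).trans (hε'T x hx)) s hs).1
  choose! Φ hΦc hΦ using hloc
  choose! i hiT hiO using hidx
  -- Although `i` is an arbitrary choice of a box, the glued flow coincides near each point with the
  -- flow of one fixed box; this gives its continuity.
  have hagree : ∀ x ∈ T, ∀ y ∈ O x, f y = ℓ s → ∀ t ∈ Icc a b, Φ (i y) (y, t) = Φ x (y, t) := by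
    intro x hx y hy hys t ht
    have h1 := hΦ (i y) (hiT y hys) y (hiO y hys) hys
    have h2 := hΦ x hx y hy hys
    exact IsHorizontalCurve.eqOn hf hb hℓ hδ hW habδ hs h1.2 h2.2 (h1.1.trans h2.1.symm) ht
  refine ⟨fun p => Φ (i p.1) p, ?_, fun y hy => hΦ (i y) (hiT y hy) y (hiO y hy) hy⟩
  rintro ⟨y, t⟩ ⟨hy, ht⟩
  have h1 : ContinuousWithinAt (Φ (i y)) ((O (i y) ∩ f ⁻¹' {ℓ s}) ×ˢ Icc a b) (y, t) :=
    hΦc (i y) (hiT y hy) (y, t) ⟨⟨hiO y hy, hy⟩, ht⟩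
  have h2 : ContinuousWithinAt (Φ (i y)) ((f ⁻¹' {ℓ s}) ×ˢ Icc a b) (y, t) := by
    refine h1.mono_of_mem_nhdsWithin ?_
    have h3 : (O (i y)) ×ˢ (univ : Set ℝ) ∈ 𝓝 (y, t) :=
      ((hO (i y)).prod isOpen_univ).mem_nhds ⟨hiO y hy, mem_univ t⟩
    filter_upwards [nhdsWithin_le_nhds h3, self_mem_nhdsWithin] with p hp hp'
    exact ⟨⟨hp.1, hp'.1⟩, hp'.2⟩
  refine h2.congr_of_eventuallyEq ?_ rfl
  have h3 : (O (i y)) ×ˢ (univ : Set ℝ) ∈ 𝓝 (y, t) :=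
    ((hO (i y)).prod isOpen_univ).mem_nhds ⟨hiO y hy, mem_univ t⟩
  filter_upwards [nhdsWithin_le_nhds h3, self_mem_nhdsWithin] with p hp hp'
  exact hagree (i y) (hiT y hy) p.1 hp.1 hp'.1 p.2 hp'.2

/-- The interval is subdivided so finely that every piece lies within the time step of one of its
points, and the flows are concatenated. All initial times are kept because transport backwards is
needed too. -/
theorem hasFlow_Icc [CompactSpace X] [T2Space X] [T2Space S] :
    ∀ s ∈ Icc δ 1, HasFlow f ℓ W s (Icc δ 1) := by
  choose ε hε hflow using fun t₀ : Icc δ 1 => exists_hasFlow_near hf hb hℓ hδ hW t₀.2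
  obtain ⟨t, ht0, htm, ⟨m, hm⟩, hcov⟩ := exists_monotone_Icc_subset_open_cover_Icc hδ.2
    (c := fun t₀ : Icc δ 1 => Metric.ball t₀ (ε t₀)) (fun _ => Metric.isOpen_ball)
    fun t₀ _ => mem_iUnion.2 ⟨t₀, Metric.mem_ball_self (hε t₀)⟩
  have hstep : ∀ n, ∀ s ∈ Icc (t n : ℝ) (t (n + 1)),
      HasFlow f ℓ W s (Icc (t n : ℝ) (t (n + 1))) := by
    intro n
    obtain ⟨i, hi⟩ := hcov n
    have hsub : Icc (t n : ℝ) (t (n + 1)) ⊆ Icc δ 1 := fun r hr =>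
      ⟨(t n).2.1.trans hr.1, hr.2.trans (t (n + 1)).2.2⟩
    refine hflow i _ _ (htm n.le_succ) hsub fun r hr => ?_
    exact (show dist (⟨r, hsub hr⟩ : Icc δ 1) i < ε i from hi ⟨hr.1, hr.2⟩).le
  have hall : ∀ n, ∀ s ∈ Icc (t 0 : ℝ) (t (n + 1)), HasFlow f ℓ W s (Icc (t 0 : ℝ) (t (n + 1))) := by
    intro n
    induction n with
    | zero => exact hstep 0
    | succ n ih =>
      exact hasFlow_Icc_trans hf.continuous (htm (Nat.zero_le _)) (htm (Nat.le_succ _)) ih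
        (hstep (n + 1))
  have h1 := hall m
  rwa [ht0, hm (m + 1) m.le_succ] at h1

/-- The flow that starts from the fibre over `ℓ (δ + s)` and runs back to time `δ` is the inverse of
the transport by `s`, by uniqueness of horizontal curves. Time is shifted by `δ`. -/
theorem exists_isParallelTransport_of_field [CompactSpace X] [T2Space X] [T2Space S] :
    ∃ γ, IsParallelTransport f ℓ δ W γ := by
  have hflow := hasFlow_Icc hf hb hℓ hδ hW
  obtain ⟨Φ, hΦc, hΦ⟩ := hflow δ (left_mem_Icc.2 hδ.2)
  have hsh : ∀ s ∈ Icc 0 (1 - δ), δ + s ∈ Icc δ 1 := fun s hs =>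
    ⟨by linarith [hs.1], by linarith [hs.2]⟩
  refine ⟨fun x s => Φ (x, δ + s), hW.contMDiffOn, hW.projects, fun x hx => ?_, fun x hx => ?_, ?_,
    fun s hs => ⟨fun x hx => ?_, fun x hx y hy hxy => ?_, fun z hz => ?_⟩⟩
  · rw [add_zero, (hΦ x hx).1]
  · have h1 := (hΦ x hx).2.isMIntegralCurveOn.comp_add δ
    have h2 : IsMIntegralCurveOn (I := 𝓡∂ 4) (fun s => Φ (x, δ + s)) W {s | s + δ ∈ Icc δ 1} := by
      refine Eq.mp ?_ h1
      congr 1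
      funext s
      change Φ (x, s + δ) = _
      rw [add_comm]
    refine h2.mono fun s hs => ?_
    change s + δ ∈ Icc δ 1
    rw [add_comm]
    exact hsh s hs
  · exact hΦc.comp (by fun_prop) fun p hp => ⟨hp.1, hsh _ hp.2⟩
  · exact (hΦ x hx).2.map_eq _ (hsh s hs)
  · have h1 := IsHorizontalCurve.eqOn hf hb hℓ hδ hW subset_rfl (hsh s hs) (hΦ x hx).2 (hΦ y hy).2 hxy
      (left_mem_Icc.2 hδ.2)
    exact (hΦ x hx).1.symm.trans (h1.trans (hΦ y hy).1)
  · obtain ⟨Ψ, -, hΨ⟩ := hflow (δ + s) (hsh s hs)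
    have h0 : f (Ψ (z, δ)) = ℓ δ := (hΨ z hz).2.map_eq δ (left_mem_Icc.2 hδ.2)
    refine ⟨Ψ (z, δ), h0, ?_⟩
    have h1 := IsHorizontalCurve.eqOn hf hb hℓ hδ hW subset_rfl (left_mem_Icc.2 hδ.2) (hΦ _ h0).2
      (hΨ z hz).2 (hΦ _ h0).1 (hsh s hs)
    exact h1.trans (hΨ z hz).1

end

/-- Parallel transport along vanishing paths exists. -/
theorem IsVanishingPath.exists_isParallelTransport [CompactSpace X] [T2Space X] [T2Space S]
    (hf : ContMDiff (𝓡∂ 4) (𝓡∂ 2) ∞ f) (hb : (𝓡∂ 4).boundary X = f ⁻¹' (𝓡∂ 2).boundary S) {x₀ : X}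
    (hℓ : IsVanishingPath f x₀ ℓ) (hδ : δ ∈ Ioc (0 : ℝ) 1) :
    ∃ W γ, IsParallelTransport f ℓ δ W γ := by
  obtain ⟨W, hW⟩ := hℓ.exists_vectorField hf hδ
  exact ⟨W, exists_isParallelTransport_of_field hf hb hℓ hδ ⟨hW.1, hW.2⟩⟩

end ParallelTransport

/-! ### Vanishing cycles of the cover up to isotopy -/

section DescendedVanishingCycles

variable {X S : Type*} [TopologicalSpace X] [ChartedSpace (EuclideanHalfSpace 4) X]
  [TopologicalSpace S] [ChartedSpace (EuclideanHalfSpace 2) S]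

theorem surjective_mul_add {a b : ℂ} (h : (a, b) ≠ 0) :
    Function.Surjective fun v : ℂ × ℂ => a * v.2 + b * v.1 := by
  intro w
  by_cases ha : a = 0
  · have hb : b ≠ 0 := fun hb => h (by rw [ha, hb]; rfl)
    exact ⟨(w / b, 0), by simp [mul_div_cancel₀ w hb]⟩
  · exact ⟨(0, w / a), by simp [mul_div_cancel₀ w ha]⟩

namespace LefschetzChart

/-- The definition of a Lefschetz chart does not require the critical point to sit at the origin. It
does so automatically, since away from the origin the differential of `zw` is onto and the charts
are diffeomorphisms. -/
theorem apply_eq_zero [IsManifold (𝓡∂ 4) ∞ X] [IsManifold (𝓡∂ 2) ∞ S] {f : X → S} {x₀ : X}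
    (χ : LefschetzChart f x₀) {z : X} (hz : z ∈ χ.φ.source)
    (hc : z ∈ criticalSet f) : χ.φ z = 0 := by
  by_contra h0
  refine hc ?_
  have h1 : HasMFDerivAt (𝓡∂ 4) 𝓘(ℝ, ℂ × ℂ) χ.φ z (mfderiv (𝓡∂ 4) 𝓘(ℝ, ℂ × ℂ) χ.φ z) :=
    ((χ.contMDiffOn_φ.contMDiffAt (χ.φ.open_source.mem_nhds hz)).mdifferentiableAt
      (by simp)).hasMFDerivAt
  have h2 := (hasFDerivAt_fst (𝕜 := ℝ) (p := χ.φ z)).mul (hasFDerivAt_snd (𝕜 := ℝ) (p := χ.φ z))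
  have h3 := h2.hasMFDerivAt.comp z h1
  have hfz : χ.ψ (f z) = (χ.φ z).1 * (χ.φ z).2 := χ.normal_form z hz
  have hψ : χ.ψ.MDifferentiable (𝓡∂ 2) 𝓘(ℝ, ℂ) :=
    ⟨χ.contMDiffOn_ψ.mdifferentiableOn (by simp), χ.contMDiffOn_ψ_symm.mdifferentiableOn (by simp)⟩
  have hm : (χ.φ z).1 * (χ.φ z).2 ∈ χ.ψ.target := hfz ▸ χ.ψ.map_source (χ.mapsTo hz)
  have h4 : HasMFDerivAt 𝓘(ℝ, ℂ) (𝓡∂ 2) χ.ψ.symm ((χ.φ z).1 * (χ.φ z).2)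
      (mfderiv 𝓘(ℝ, ℂ) (𝓡∂ 2) χ.ψ.symm ((χ.φ z).1 * (χ.φ z).2)) :=
    (hψ.mdifferentiableAt_symm hm).hasMFDerivAt
  have h5 := HasMFDerivAt.comp z h4 h3
  have h6 : f =ᶠ[𝓝 z] (χ.ψ.symm ∘ (fun y : ℂ × ℂ => y.1 * y.2) ∘ χ.φ) := by
    filter_upwards [χ.φ.open_source.mem_nhds hz] with y hy
    simp only [Function.comp_apply]
    rw [← χ.normal_form y hy, χ.ψ.left_inv (χ.mapsTo hy)]
  have h7 := (h5.congr_of_eventuallyEq h6).mfderiv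
  rw [h7]
  refine (hψ.symm.mfderiv_surjective hm).comp
    (Function.Surjective.comp (g := fun v : ℂ × ℂ => (χ.φ z).1 * v.2 + (χ.φ z).2 * v.1)
    (surjective_mul_add h0) (χ.mdifferentiable_φ.mfderiv_surjective hz))

end LefschetzChart

/-- The norm of the product is the maximum norm; the circle shrinks to the origin with `ε`. -/
theorem norm_eq_of_mem_matchingCircle {ε : ℂ} {v : ℂ × ℂ} (hv : v ∈ matchingCircle ε) :
    ‖v‖ = √‖ε‖ := by
  rw [← hv.1, norm_mul, hv.2, Real.sqrt_mul_self (norm_nonneg _), Prod.norm_def, hv.2, max_self]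

open OrientationCover

variable [IsManifold (𝓡∂ 4) ∞ X] [IsManifold (𝓡∂ 2) ∞ S]

/-- A Lefschetz chart of `f ∘ π` can be restricted to a sheet of the covering. -/
theorem LefschetzChart.exists_descend {f : X → S} {p : OrientationCover (𝓡∂ 4) X}
    (χ : LefschetzChart (f ∘ OrientationCover.proj) p) :
    ∃ (χ₀ : LefschetzChart f p.proj) (σ : X → OrientationCover (𝓡∂ 4) X),
      ContinuousOn σ χ₀.φ.source ∧ (∀ x ∈ χ₀.φ.source, (σ x).proj = x) ∧ σ p.proj = p ∧
      χ₀.ψ = χ.ψ ∧ χ₀.φ.target ⊆ χ.φ.target ∧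
      ∀ v ∈ χ₀.φ.target, σ (χ₀.φ.symm v) = χ.φ.symm v := by
  have hπ : IsLocalHomeomorph (OrientationCover.proj : OrientationCover (𝓡∂ 4) X → X) :=
    isLocalHomeomorph_proj
  let l := hπ.localInverseAt p
  have hl : (l.symm : _ → _) = OrientationCover.proj := hπ.localInverseAt_symm p
  have hlp : ∀ x ∈ l.source, (l x).proj = x := fun x hx => by
    rw [← hl]; exact l.left_inv hx
  have hpt : p ∈ l.target := hπ.self_mem_localInverseAt_target
  have hps : p.proj ∈ l.source := by rw [← hl]; exact l.map_target hpt
  have hlpp : l p.proj = p := by rw [← hl]; exact l.right_inv hpt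
  have hsm : ContMDiffOn (𝓡∂ 4) (𝓡∂ 4) ∞ l l.source := contMDiffOn_comp_symm l.continuousOn hlp
  -- The domain is cut down to one sheet, so the range becomes smaller and may lose the circle from
  -- which the given cycle was made. This is why the radius changes later and an isotopy is needed.
  refine ⟨⟨l.trans χ.φ, χ.ψ, ?_, ?_, χ.contMDiffOn_ψ, χ.contMDiffOn_ψ_symm, ?_, ?_, ?_⟩, l,
    l.continuousOn.mono fun x hx => hx.1, fun x hx => hlp x hx.1, hlpp, rfl,
    fun v hv => hv.1, ?_⟩
  · exact χ.contMDiffOn_φ.comp (hsm.mono fun x hx => hx.1) fun x hx => hx.2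
  · rw [OpenPartialHomeomorph.coe_trans_symm, hl]
    exact contMDiff_proj.comp_contMDiffOn (χ.contMDiffOn_φ_symm.mono fun x hx => hx.1)
  · refine ⟨hps, ?_⟩
    change l p.proj ∈ χ.φ.source
    rw [hlpp]
    exact χ.mem_source
  · intro x hx
    have := χ.mapsTo hx.2
    change f (l x).proj ∈ _ at this
    rwa [hlp x hx.1] at this
  · intro x hx
    have := χ.normal_form _ hx.2
    change χ.ψ (f (l x).proj) = _ at this
    rwa [hlp x hx.1] at this
  · intro v hv
    exact l.right_inv hv.2

/-- The matching circles near the critical point lie in the range of a Lefschetz chart. -/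
theorem LefschetzChart.exists_matchingCircle_subset {f : X → S} {x₀ : X} (χ : LefschetzChart f x₀)
    {ℓ : ℝ → S} (hℓ : IsVanishingPath f x₀ ℓ) :
    ∃ δ > 0, ∀ t ∈ Icc (0 : ℝ) 1, t ≤ δ →
      ℓ t ∈ χ.ψ.source ∧ matchingCircle (χ.ψ (ℓ t)) ⊆ χ.φ.target := by
  have h0 : χ.φ x₀ = 0 := χ.apply_eq_zero χ.mem_source hℓ.mem_criticalSet
  have h1 : χ.ψ (ℓ 0) = 0 := by
    rw [hℓ.start, χ.normal_form _ χ.mem_source, h0]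
    simp
  have h2 : ℓ 0 ∈ χ.ψ.source := by
    rw [hℓ.start]
    exact χ.mapsTo χ.mem_source
  have hc : ContinuousWithinAt ℓ (Icc 0 1) 0 :=
    hℓ.contMDiffOn.continuousOn 0 (by simp)
  obtain ⟨r, hr, hb⟩ := Metric.isOpen_iff.1 χ.φ.open_target 0 (h0 ▸ χ.φ.map_source χ.mem_source)
  have h3 : ContinuousWithinAt (fun t => √‖χ.ψ (ℓ t)‖) (Icc 0 1) 0 :=
    (((χ.ψ.continuousAt h2).comp_continuousWithinAt hc).norm).sqrt
  have h4 : ∀ᶠ t in 𝓝[Icc 0 1] (0 : ℝ), √‖χ.ψ (ℓ t)‖ < r :=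
    h3.eventually (gt_mem_nhds (by simpa [h1] using hr))
  have h5 : ∀ᶠ t in 𝓝[Icc 0 1] (0 : ℝ), ℓ t ∈ χ.ψ.source :=
    hc.eventually (χ.ψ.open_source.mem_nhds h2)
  obtain ⟨δ, hδ, h6⟩ := Metric.mem_nhdsWithin_iff.1 (h4.and h5)
  refine ⟨δ / 2, by positivity, fun t ht htδ => ?_⟩
  have h7 := h6 ⟨by
    rw [Metric.mem_ball, Real.dist_eq, sub_zero, abs_of_nonneg ht.1]
    linarith, ht⟩
  refine ⟨h7.2, fun v hv => hb ?_⟩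
  rw [mem_ball_zero_iff, norm_eq_of_mem_matchingCircle hv]
  exact h7.1

/-- The flow of a compact family of fibres identifies all of them with the last one. -/
theorem exists_retraction_of_transport {Y B : Type*} [TopologicalSpace Y] [CompactSpace Y]
    [T2Space Y] [TopologicalSpace B] [T2Space B] {f : Y → B} (hf : Continuous f) {ℓ : ℝ → B}
    {a : ℝ} (ha : 0 ≤ a) {δ : ℝ} (hℓ : InjOn ℓ (Icc δ (δ + a))) {γ : Y → ℝ → Y}
    (h0 : ∀ y ∈ f ⁻¹' {ℓ δ}, γ y 0 = y)
    (hγ : ContinuousOn (fun p : Y × ℝ => γ p.1 p.2) ((f ⁻¹' {ℓ δ}) ×ˢ Icc 0 a))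
    (hb : ∀ s ∈ Icc 0 a, BijOn (fun y => γ y s) (f ⁻¹' {ℓ δ}) (f ⁻¹' {ℓ (δ + s)})) :
    ∃ T : Y → Y, ContinuousOn T (f ⁻¹' (ℓ '' Icc δ (δ + a))) ∧
      (∀ s ∈ Icc 0 a, InjOn T (f ⁻¹' {ℓ (δ + s)})) ∧
      MapsTo T (f ⁻¹' (ℓ '' Icc δ (δ + a))) (f ⁻¹' {ℓ (δ + a)}) ∧
      EqOn T id (f ⁻¹' {ℓ (δ + a)}) ∧ ∀ y ∈ f ⁻¹' {ℓ δ}, T y = γ y a := by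
  classical
  set K : Set (Y × ℝ) := (f ⁻¹' {ℓ δ}) ×ˢ Icc 0 a with hK
  have hKc : IsCompact K := (isClosed_singleton.preimage hf).isCompact.prod isCompact_Icc
  have : CompactSpace K := isCompact_iff_compactSpace.1 hKc
  have hpa : ∀ {s}, s ∈ Icc 0 a → δ + s ∈ Icc δ (δ + a) := fun hs =>
    ⟨by linarith [hs.1], by linarith [hs.2]⟩
  have hfγ : ∀ k : K, f (γ k.1.1 k.1.2) = ℓ (δ + k.1.2) := fun k =>
    (hb _ k.2.2).mapsTo k.2.1
  -- The flow parametrizes the part over the arc by the initial fibre times an interval. As the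
  -- fibre is compact, this is a homeomorphism, and `T` is its inverse followed by transport to the
  -- end of the arc.
  let q : K → (f ⁻¹' (ℓ '' Icc δ (δ + a)) : Set Y) := fun k =>
    ⟨γ k.1.1 k.1.2, ⟨_, hpa k.2.2, (hfγ k).symm⟩⟩
  have hqc : Continuous q := (continuousOn_iff_continuous_domRestrict.1 hγ).subtype_mk _
  have hqs : Function.Surjective q := by
    rintro ⟨y, t, ht, hty⟩
    have hs : t - δ ∈ Icc 0 a := ⟨by linarith [ht.1], by linarith [ht.2]⟩
    obtain ⟨z, hz, hzy⟩ := (hb _ hs).surjOn (show y ∈ f ⁻¹' {ℓ (δ + (t - δ))} by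
      rw [add_sub_cancel]; exact hty.symm)
    exact ⟨⟨(z, t - δ), hz, hs⟩, Subtype.ext hzy⟩
  have hqi : Function.Injective q := by
    rintro ⟨⟨y, s⟩, hy, hs⟩ ⟨⟨z, t⟩, hz, ht⟩ h
    have h1 : γ y s = γ z t := congrArg Subtype.val h
    have h2 : δ + s = δ + t := hℓ (hpa hs) (hpa ht)
      ((hfγ ⟨(y, s), hy, hs⟩).symm.trans ((congrArg f h1).trans (hfγ ⟨(z, t), hz, ht⟩)))
    obtain rfl : s = t := by linarith
    obtain rfl : y = z := (hb _ hs).injOn hy hz h1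
    rfl
  let Q : K ≃ₜ (f ⁻¹' (ℓ '' Icc δ (δ + a)) : Set Y) :=
    Continuous.homeoOfEquivCompactToT2 (f := Equiv.ofBijective q ⟨hqi, hqs⟩) hqc
  have haa : a ∈ Icc 0 a := right_mem_Icc.2 ha
  have hQ : ∀ y (hy : y ∈ f ⁻¹' {ℓ δ}) s (hs : s ∈ Icc 0 a)
      (hm : γ y s ∈ f ⁻¹' (ℓ '' Icc δ (δ + a))), Q.symm ⟨γ y s, hm⟩ = ⟨(y, s), hy, hs⟩ := by
    intro y hy s hs hm
    rw [Homeomorph.symm_apply_eq]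
    rfl
  let T : Y → Y := fun y => if hy : y ∈ f ⁻¹' (ℓ '' Icc δ (δ + a)) then
    γ (Q.symm ⟨y, hy⟩).1.1 a else y
  have hT : ∀ y ∈ f ⁻¹' {ℓ δ}, ∀ s ∈ Icc 0 a, T (γ y s) = γ y a := by
    intro y hy s hs
    have hm : γ y s ∈ f ⁻¹' (ℓ '' Icc δ (δ + a)) := ⟨_, hpa hs, (hfγ ⟨(y, s), hy, hs⟩).symm⟩
    simp only [T, dif_pos hm]
    rw [hQ y hy s hs hm]
  refine ⟨T, ?_, ?_, ?_, ?_, ?_⟩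
  · rw [continuousOn_iff_continuous_domRestrict]
    have h1 : Continuous fun y : (f ⁻¹' (ℓ '' Icc δ (δ + a)) : Set Y) =>
        γ (Q.symm y).1.1 a :=
      hγ.comp_continuous (f := fun y : (f ⁻¹' (ℓ '' Icc δ (δ + a)) : Set Y) =>
        ((Q.symm y).1.1, a)) (by fun_prop) fun y => ⟨(Q.symm y).2.1, haa⟩
    refine h1.congr fun y => ?_
    simp only [domRestrict_apply, T, dif_pos y.2]
  · intro s hs x hx y hy hxy
    obtain ⟨x', hx', rfl⟩ := (hb s hs).surjOn hx
    obtain ⟨y', hy', rfl⟩ := (hb s hs).surjOn hy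
    simp only at hxy
    rw [hT _ hx' _ hs, hT _ hy' _ hs] at hxy
    rw [(hb a haa).injOn hx' hy' hxy]
  · rintro y ⟨t, ht, hty⟩
    have hs : t - δ ∈ Icc 0 a := ⟨by linarith [ht.1], by linarith [ht.2]⟩
    obtain ⟨z, hz, rfl⟩ := (hb _ hs).surjOn (show y ∈ f ⁻¹' {ℓ (δ + (t - δ))} by
      rw [add_sub_cancel]; exact hty.symm)
    simp only
    rw [hT _ hz _ hs]
    exact (hb a haa).mapsTo hz
  · intro y hy
    obtain ⟨z, hz, rfl⟩ := (hb a haa).surjOn hy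
    exact hT _ hz _ haa
  · intro y hy
    have := hT y hy 0 (left_mem_Icc.2 ha)
    rwa [h0 y hy] at this

/-- Different radii of the matching circle and different vector fields lead to isotopic vanishing
cycles. -/
theorem LefschetzChart.isIsotopicIn [CompactSpace X] [T2Space X] [T2Space S] {f : X → S}
    (hf : Continuous f) {x₀ : X} (χ : LefschetzChart f x₀) {ℓ : ℝ → S}
    (hℓ : IsVanishingPath f x₀ ℓ) {δ δ' : ℝ} (hδ : 0 < δ) (hδδ : δ ≤ δ') (hδ' : δ' ≤ 1)
    (hχ : ∀ t ∈ Icc 0 δ', ℓ t ∈ χ.ψ.source ∧ matchingCircle (χ.ψ (ℓ t)) ⊆ χ.φ.target)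
    {W W' : (x : X) → TangentSpace (𝓡∂ 4) x} {γ γ' : X → ℝ → X}
    (hγ : IsParallelTransport f ℓ δ W γ) (hγ' : IsParallelTransport f ℓ δ' W' γ') :
    IsIsotopicIn (f ⁻¹' {ℓ 1})
      ((fun x => γ' x (1 - δ')) '' (χ.φ.symm '' matchingCircle (χ.ψ (ℓ δ'))))
      ((fun x => γ x (1 - δ)) '' (χ.φ.symm '' matchingCircle (χ.ψ (ℓ δ)))) := by
  have hδ1 : δ ≤ 1 := hδδ.trans hδ'
  obtain ⟨T, hTc, hTi, hTm, hTe, hT0⟩ := exists_retraction_of_transport hf (a := 1 - δ)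
    (by linarith) (hℓ.injOn.mono (Icc_subset_Icc hδ.le (by linarith))) hγ.start hγ.continuousOn
    hγ.bijOn
  rw [add_sub_cancel] at hTc hTm hTe
  have hne : ∀ t ∈ Ioc 0 δ', χ.ψ (ℓ t) ≠ 0 := fun t ht =>
    χ.apply_ne_zero (hℓ.regular t ⟨ht.1, ht.2.trans hδ'⟩) (hχ t ⟨ht.1.le, ht.2⟩).1
      (hχ t ⟨ht.1.le, ht.2⟩).2
  have hmem : ∀ t ∈ Ioc 0 δ', ∀ θ, conicMap (χ.ψ (ℓ t)) θ 0 ∈ χ.φ.target := fun t ht θ =>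
    (hχ t ⟨ht.1.le, ht.2⟩).2 (range_conicMap_zero (hne t ht) ▸ mem_range_self θ)
  let E : ℝ → Circle → X := fun t θ => χ.φ.symm (conicMap (χ.ψ (ℓ t)) θ 0)
  have hEf : ∀ t ∈ Ioc 0 δ', ∀ θ, E t θ ∈ f ⁻¹' {ℓ t} := fun t ht θ =>
    χ.apply_symm_eq (hχ t ⟨ht.1.le, ht.2⟩).1 (hmem t ht θ) (conicMap_mul (hne t ht) θ 0)
  have hEi : ∀ t ∈ Ioc 0 δ', Function.Injective (E t) := fun t ht θ θ' h => by
    have := χ.φ.symm.injOn (hmem t ht θ) (hmem t ht θ') h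
    exact congrArg Prod.fst (conicMap_injective (hne t ht) (a₁ := (θ, 0)) (a₂ := (θ', 0)) this)
  have hEr : ∀ t ∈ Ioc 0 δ', range (E t) = χ.φ.symm '' matchingCircle (χ.ψ (ℓ t)) :=
    fun t ht => by
      rw [← range_conicMap_zero (hne t ht), ← range_comp]
      rfl
  have hEc : ContinuousOn (fun q : ℝ × Circle => E q.1 q.2) (Ioc 0 δ' ×ˢ univ) := by
    refine χ.φ.continuousOn_symm.comp ?_ fun q hq => hmem q.1 hq.1 q.2
    refine continuousOn_conicMap.comp (f := fun q : ℝ × Circle => (χ.ψ (ℓ q.1), q.2, (0 : ℝ))) ?_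
      fun q hq => hne q.1 hq.1
    refine ContinuousOn.prodMk (χ.ψ.continuousOn.comp ?_ fun q hq =>
      (hχ q.1 ⟨hq.1.1.le, hq.1.2⟩).1) (by fun_prop)
    exact hℓ.contMDiffOn.continuousOn.comp continuousOn_fst fun q hq =>
      ⟨hq.1.1.le, hq.1.2.trans hδ'⟩
  -- The time runs backwards from `1` to `δ`: the isotopy starts with the cycle made at `δ'` and
  -- ends with the one made at `δ`.
  let r : unitInterval → ℝ := fun s => 1 - s * (1 - δ)
  have hr : ∀ s, r s ∈ Icc δ 1 := fun s =>
    ⟨by nlinarith [s.2.1, s.2.2], by nlinarith [s.2.1, s.2.2]⟩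
  have hrc : Continuous r := by fun_prop
  -- Clamped times keep both branches of the next definition continuous everywhere, also where they
  -- are not selected.
  have hmin : ∀ s, min (r s) δ' ∈ Ioc 0 δ' := fun s =>
    ⟨lt_min (hδ.trans_le (hr s).1) (hδ.trans_le hδδ), min_le_right _ _⟩
  have hδδ' : δ' ∈ Ioc 0 δ' := ⟨hδ.trans_le hδδ, le_rfl⟩
  have hmax : ∀ s, max (r s) δ' - δ' ∈ Icc 0 (1 - δ') := fun s =>
    ⟨by linarith [le_max_right (r s) δ'], by linarith [max_le (hr s).2 hδ']⟩
  -- Embedded circles in the moving fibre over `ℓ (r s)`: down to the time `δ'` the circle at `δ'`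
  -- transported by `γ'` for a shorter and shorter time, then the matching circles themselves. The
  -- map `T`, which is injective on each fibre, pushes all of them into the last fibre.
  let K : unitInterval × Circle → X := fun q =>
    if r q.1 ≤ δ' then E (min (r q.1) δ') q.2 else γ' (E δ' q.2) (max (r q.1) δ' - δ')
  have hKle : ∀ {s}, r s ≤ δ' → ∀ θ, K (s, θ) = E (r s) θ := fun {s} hs θ => by
    simp only [K, if_pos hs, min_eq_left hs]
  have hKge : ∀ {s}, δ' ≤ r s → ∀ θ, K (s, θ) = γ' (E δ' θ) (r s - δ') := fun {s} hs θ => by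
    rcases hs.eq_or_lt with h | h
    · rw [hKle h.ge, ← h, sub_self, hγ'.start _ (hEf δ' hδδ' θ)]
    · simp only [K, if_neg h.not_ge, max_eq_left hs]
  have hKc : Continuous K := by
    refine Continuous.if_le ?_ ?_ (by fun_prop) continuous_const fun q hq => ?_
    · exact hEc.comp_continuous (f := fun q : unitInterval × Circle => (min (r q.1) δ', q.2))
        (by fun_prop) fun q => ⟨hmin q.1, mem_univ _⟩
    · have h1 : Continuous (E δ') := hEc.comp_continuous (f := fun θ : Circle => (δ', θ))
        (by fun_prop) fun θ => ⟨hδδ', mem_univ _⟩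
      exact hγ'.continuousOn.comp_continuous
        (f := fun q : unitInterval × Circle => (E δ' q.2, max (r q.1) δ' - δ'))
        (by fun_prop) fun q => ⟨hEf δ' hδδ' _, hmax q.1⟩
    · rw [hq, min_self, max_self, sub_self, hγ'.start _ (hEf δ' hδδ' q.2)]
  have hKf : ∀ q, K q ∈ f ⁻¹' {ℓ (r q.1)} := by
    rintro ⟨s, θ⟩
    rcases le_total (r s) δ' with h | h
    · rw [hKle h]
      exact hEf _ ⟨hδ.trans_le (hr s).1, h⟩ θ
    · rw [hKge h]
      have := (hγ'.bijOn (r s - δ') ⟨by linarith, by linarith [(hr s).2]⟩).mapsTo (hEf δ' hδδ' θ)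
      rwa [add_sub_cancel] at this
  have hKi : ∀ s, Function.Injective fun θ => K (s, θ) := by
    intro s θ θ' hθ
    rcases le_total (r s) δ' with h | h
    · simp only [hKle h] at hθ
      exact hEi _ ⟨hδ.trans_le (hr s).1, h⟩ hθ
    · simp only [hKge h] at hθ
      exact hEi _ hδδ' ((hγ'.bijOn (r s - δ') ⟨by linarith, by linarith [(hr s).2]⟩).injOn
        (hEf δ' hδδ' θ) (hEf δ' hδδ' θ') hθ)
  have hKm : ∀ q, K q ∈ f ⁻¹' (ℓ '' Icc δ 1) := fun q => ⟨r q.1, hr q.1, (hKf q).symm⟩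
  refine ⟨fun q => T (K q), hTc.comp_continuous hKc hKm, fun s θ θ' h => ?_,
    fun q => hTm (hKm q), ?_, ?_⟩
  · refine hKi s (hTi (r s - δ) ⟨by linarith [(hr s).1], by linarith [(hr s).2]⟩ ?_ ?_ h) <;>
    · rw [add_sub_cancel]
      exact hKf _
  · have h0 : r 0 = 1 := by simp [r]
    have h1 : ∀ θ, T (K (0, θ)) = γ' (E δ' θ) (1 - δ') := fun θ => by
      have h2 := hKf (0, θ)
      rw [h0] at h2
      rw [hTe h2, hKge (h0.symm ▸ hδ'), h0]
      rfl
    simp only [h1]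
    rw [← hEr δ' hδδ', ← range_comp]
    rfl
  · have h0 : r 1 = δ := by simp [r]
    have h1 : ∀ θ, T (K (1, θ)) = γ (E δ θ) (1 - δ) := fun θ => by
      rw [hKle (h0.symm ▸ hδδ), h0, hT0 _ (hEf δ ⟨hδ, hδδ⟩ θ)]
    simp only [h1]
    rw [← hEr δ ⟨hδ, hδδ⟩, ← range_comp]
    rfl

/-- Every vanishing cycle of `f ∘ π` is isotopic to a lift of a vanishing cycle of `f`. -/
theorem IsVanishingCycle.exists_isIsotopicIn [CompactSpace X] [T2Space X] [T2Space S] (g : ℕ)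
    {f : X → S} (hf : ContMDiff (𝓡∂ 4) (𝓡∂ 2) ∞ f)
    (hb : (𝓡∂ 4).boundary X = f ⁻¹' (𝓡∂ 2).boundary S)
    {p : OrientationCover (𝓡∂ 4) X} {ℓ : ℝ → S} {c' : Set (OrientationCover (𝓡∂ 4) X)}
    (hc : IsVanishingCycle (f ∘ OrientationCover.proj) p ℓ c') :
    ∃ c c₁ c₂, IsVanishingCycle f p.proj ℓ c ∧ IsAntipodalPair g f p ℓ c c₁ c₂ ∧
      IsIsotopicIn ((f ∘ OrientationCover.proj) ⁻¹' {ℓ 1}) c' c₁ := by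
  have : CompactSpace (OrientationCover (𝓡∂ 4) X) := compactSpace
  have : T2Space (OrientationCover (𝓡∂ 4) X) := t2Space
  obtain ⟨hℓ', χ, δ', hδ', hχ, W₀, γ₀, hγ₀, rfl⟩ := hc
  have hℓ : IsVanishingPath f p.proj ℓ := (isVanishingPath_comp_proj_iff hf).1 hℓ'
  obtain ⟨χ₀, σ, hσ, hσ', hp, hψ, hφ, hσφ⟩ := χ.exists_descend
  obtain ⟨δ₀, hδ₀, hχ₀⟩ := χ₀.exists_matchingCircle_subset hℓ
  -- The bound `δ₀` puts the circles into the smaller chart of `f`, and `δ'` keeps them among the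
  -- circles that the given chart of `f ∘ π` is known to contain.
  set δ := min δ₀ δ'
  have hδ : δ ∈ Ioc (0 : ℝ) 1 := ⟨lt_min hδ₀ hδ'.1, (min_le_right _ _).trans hδ'.2⟩
  have hχδ : ∀ t ∈ Icc 0 δ, ℓ t ∈ χ₀.ψ.source ∧ matchingCircle (χ₀.ψ (ℓ t)) ⊆ χ₀.φ.target :=
    fun t ht => hχ₀ t ⟨ht.1, ht.2.trans hδ.2⟩ (ht.2.trans (min_le_left _ _))
  obtain ⟨W, γ, hγ⟩ := hℓ.exists_isParallelTransport hf hb hδ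
  obtain ⟨W', γ', hγ', h4⟩ := hγ.exists_lift hf hδ
  refine ⟨_, _, _, ⟨hℓ, χ₀, δ, hδ, hχδ, W, γ, hγ, rfl⟩,
    isAntipodalPair_of_section hf hℓ χ₀ hσ hσ' hp hδ hχδ hγ' h4 rfl, ?_⟩
  have h1 : σ '' (χ₀.φ.symm '' matchingCircle (χ₀.ψ (ℓ δ))) =
      χ.φ.symm '' matchingCircle (χ.ψ (ℓ δ)) := by
    rw [image_image, hψ]
    exact image_congr fun v hv => hσφ v ((hχδ δ (right_mem_Icc.2 hδ.1.le)).2 (hψ ▸ hv))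
  rw [h1]
  exact χ.isIsotopicIn (hf.continuous.comp continuous_proj) hℓ' hδ.1 (min_le_right _ _) hδ'.2 hχ
    hγ' hγ₀

end DescendedVanishingCycles

/-! ### Orienting the middle term of an exact sequence of planes -/

section BlockOrientation

variable {P V Q : Type*} [AddCommGroup P] [Module ℝ P] [AddCommGroup V] [Module ℝ V]
  [AddCommGroup Q] [Module ℝ Q]

/-- An exact sequence of planes `0 → P → V → Q → 0` allows to compute determinants in `V`. -/
theorem exists_basis_det_append_eq_mul [FiniteDimensional ℝ V] {i : P →ₗ[ℝ] V}
    (hi : Function.Injective i)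
    {π : V →ₗ[ℝ] Q} (hπ : Function.Surjective π) (hiπ : ∀ w, π (i w) = 0)
    (hV : Module.finrank ℝ V = 4) (p : Module.Basis (Fin 2) ℝ P) (q : Module.Basis (Fin 2) ℝ Q) :
    ∃ C : Module.Basis (Fin 4) ℝ V, ∀ (w : Fin 2 → P) (R : Fin 2 → V),
      C.det (Fin.append (m := 2) (n := 2) (i ∘ w) R) = p.det w * q.det (π ∘ R) := by
  -- A splitting identifies `V` with `P × Q`. The determinant does not see the choice, since the
  -- splitting affects only the off-diagonal block.
  obtain ⟨s, hs⟩ := π.exists_rightInverse_of_surjective (LinearMap.range_eq_top.2 hπ)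
  have hs' : ∀ z, π (s z) = z := fun z => congrArg (fun D : Q →ₗ[ℝ] Q => D z) hs
  have hL : Function.Injective (i.coprod s) := by
    rw [← LinearMap.ker_eq_bot, LinearMap.ker_eq_bot']
    rintro ⟨w, z⟩ h
    rw [LinearMap.coprod_apply] at h
    have h1 := congrArg π h
    rw [map_add, hiπ, hs', zero_add, map_zero] at h1
    obtain rfl : z = 0 := h1
    rw [map_zero, add_zero] at h
    rw [show w = 0 from hi (h.trans (map_zero i).symm)]
    rfl
  have : FiniteDimensional ℝ P := p.finiteDimensional_of_finite
  have : FiniteDimensional ℝ Q := q.finiteDimensional_of_finite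
  let A : (P × Q) ≃ₗ[ℝ] V := LinearEquiv.ofInjectiveOfFinrankEq _ hL (by
    rw [Module.finrank_prod, Module.finrank_eq_card_basis p, Module.finrank_eq_card_basis q, hV]
    rfl)
  have hA : ∀ w z, A (w, z) = i w + s z := fun w z => rfl
  have hA1 : ∀ w, A.symm (i w) = (w, 0) := fun w => by
    rw [LinearEquiv.symm_apply_eq, hA, map_zero, add_zero]
  have hA2 : ∀ v, (A.symm v).2 = π v := fun v => by
    obtain ⟨⟨w, z⟩, rfl⟩ := A.surjective v
    rw [A.symm_apply_apply, hA, map_add, hiπ, hs', zero_add]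
  refine ⟨((p.prod q).reindex finSumFinEquiv).map A, fun w R => ?_⟩
  rw [Module.Basis.det_map, Module.Basis.det_reindex, Module.Basis.det_apply,
    Module.Basis.det_apply, Module.Basis.det_apply]
  -- The vectors from `P` have no component in `Q`, so the matrix is block triangular.
  rw [← Matrix.det_fromBlocks_zero₂₁ (p.toMatrix w) (p.toMatrix fun j => (A.symm (R j)).1)
    (q.toMatrix (π ∘ R))]
  have h1 : ∀ b, Fin.append (m := 2) (n := 2) (i ∘ w) R (finSumFinEquiv (Sum.inl b)) = i (w b) :=
    fun b => by rw [finSumFinEquiv_apply_left, Fin.append_left]; rfl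
  have h2 : ∀ b, Fin.append (m := 2) (n := 2) (i ∘ w) R (finSumFinEquiv (Sum.inr b)) = R b :=
    fun b => by rw [finSumFinEquiv_apply_right, Fin.append_right]
  congr 1
  ext (a | a) (b | b)
  · simp [Module.Basis.toMatrix_apply, hA1, h1]
  · simp [Module.Basis.toMatrix_apply, h2]
  · simp [Module.Basis.toMatrix_apply, hA1, h1]
  · simp [Module.Basis.toMatrix_apply, hA2, h2]

theorem exists_basis_eq_smul_det {α : P [⋀^Fin 2]→ₗ[ℝ] ℝ} (hα : α ≠ 0)
    (hP : Module.finrank ℝ P = 2) :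
    ∃ (p : Module.Basis (Fin 2) ℝ P) (k : ℝ), k ≠ 0 ∧ ∀ w, α w = k * p.det w := by
  have : FiniteDimensional ℝ P := Module.finite_of_finrank_pos (by omega)
  let p := Module.finBasisOfFinrankEq ℝ P hP
  have h1 := α.eq_smul_basis_det p
  refine ⟨p, α p, fun h => hα ?_, fun w => ?_⟩
  · rw [h1, h, zero_smul]
  · exact congrArg (fun β : P [⋀^Fin 2]→ₗ[ℝ] ℝ => β w) h1

/-- An exact sequence of planes `0 → P → V → Q → 0` and orientations of `P` and `Q` determine an
orientation of `V`. -/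
theorem exists_orientation_append [FiniteDimensional ℝ V] {i : P →ₗ[ℝ] V}
    (hi : Function.Injective i)
    {π : V →ₗ[ℝ] Q} (hπ : Function.Surjective π) (hiπ : ∀ w, π (i w) = 0)
    (hV : Module.finrank ℝ V = 4) (hP : Module.finrank ℝ P = 2) (hQ : Module.finrank ℝ Q = 2)
    {α : P [⋀^Fin 2]→ₗ[ℝ] ℝ} (hα : α ≠ 0) {ρ : Q [⋀^Fin 2]→ₗ[ℝ] ℝ} (hρ : ρ ≠ 0) :
    (∃ o : Orientation ℝ V (Fin 4), ∀ (w : Fin 2 → P) (R : Fin 2 → V), 0 < α w * ρ (π ∘ R) →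
      ∃ B : Module.Basis (Fin 4) ℝ V, ⇑B = Fin.append (m := 2) (n := 2) (i ∘ w) R ∧
        o = B.orientation) ∧
    ∃ (w : Fin 2 → P) (R : Fin 2 → V), 0 < α w * ρ (π ∘ R) := by
  obtain ⟨p, k, hk, hαk⟩ := exists_basis_eq_smul_det hα hP
  obtain ⟨q, l, hl, hρl⟩ := exists_basis_eq_smul_det hρ hQ
  obtain ⟨C, hC⟩ := exists_basis_det_append_eq_mul hi hπ hiπ hV p q
  constructor
  · have key : ∀ (w : Fin 2 → P) (R : Fin 2 → V), α w * ρ (π ∘ R) =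
        (k * l) * C.det (Fin.append (m := 2) (n := 2) (i ∘ w) R) := fun w R => by
      rw [hαk, hρl, hC]
      ring
    have hB : ∀ (w : Fin 2 → P) (R : Fin 2 → V), 0 < α w * ρ (π ∘ R) →
        ∃ B : Module.Basis (Fin 4) ℝ V, ⇑B = Fin.append (m := 2) (n := 2) (i ∘ w) R :=
      fun w R h => by
        rw [key] at h
        obtain ⟨h1, h2⟩ := C.is_basis_iff_det.2
          (isUnit_iff_ne_zero.2 (right_ne_zero_of_mul h.ne'))
        exact ⟨Module.Basis.mk h1 h2.ge, Module.Basis.coe_mk _ _⟩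
    rcases (mul_ne_zero hk hl).lt_or_gt with h0 | h0
    · refine ⟨-C.orientation, fun w R h => ?_⟩
      obtain ⟨B, hB⟩ := hB w R h
      refine ⟨B, hB, ?_⟩
      rw [key, ← hB] at h
      rw [eq_comm, ← Module.Basis.orientation_ne_iff_eq_neg, ne_comm, Ne,
        Module.Basis.orientation_eq_iff_det_pos]
      nlinarith
    · refine ⟨C.orientation, fun w R h => ?_⟩
      obtain ⟨B, hB⟩ := hB w R h
      refine ⟨B, hB, ?_⟩
      rw [key, ← hB] at h
      rw [Module.Basis.orientation_eq_iff_det_pos]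
      exact (pos_iff_pos_of_mul_pos h).1 h0
  · obtain ⟨R, hR⟩ : ∃ R : Fin 2 → V, π ∘ R = q := by
      choose R hR using fun j => hπ (q j)
      exact ⟨R, funext hR⟩
    have h1 : α p * ρ (π ∘ R) ≠ 0 := by
      rw [hR, hαk, hρl, p.det_self, q.det_self]
      simpa using ⟨hk, hl⟩
    -- If the sign is wrong, negating one vector of the basis of `P` corrects it.
    rcases h1.lt_or_gt with h | h
    · refine ⟨Function.update p 0 (-p 0), R, ?_⟩
      rw [α.map_update_neg, Function.update_eq_self]
      linarith
    · exact ⟨p, R, h⟩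

/-- Changing the sign of the first vector changes the orientation. -/
theorem orientation_ne_of_neg {B B' : Module.Basis (Fin 4) ℝ V}
    (h : ⇑B' = Function.update B 0 (-B 0)) : B.orientation ≠ B'.orientation := by
  rw [Ne, Module.Basis.orientation_eq_iff_det_pos, h, AlternatingMap.map_update_neg,
    Function.update_eq_self, B.det_self]
  norm_num

end BlockOrientation

/-! ### Immersions and local diffeomorphisms -/

section Immersions

variable {E H E' G : Type*} [NormedAddCommGroup E] [NormedSpace ℝ E]
  [TopologicalSpace H] [NormedAddCommGroup E'] [NormedSpace ℝ E'] [TopologicalSpace G]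
  {I : ModelWithCorners ℝ E H} {J : ModelWithCorners ℝ E' G}
  {N N' M M' : Type*} [TopologicalSpace N] [ChartedSpace H N]
  [TopologicalSpace N'] [ChartedSpace H N']
  [TopologicalSpace M] [ChartedSpace G M]
  [TopologicalSpace M'] [ChartedSpace G M']

theorem IsManifold.trans_mem_maximalAtlas [IsManifold I ∞ N] [IsManifold I ∞ N']
    {l : OpenPartialHomeomorph N' N}
    (hl : ContMDiffOn I I ∞ l l.source) (hl' : ContMDiffOn I I ∞ l.symm l.target)
    {φ : OpenPartialHomeomorph N H} (hφ : φ ∈ IsManifold.maximalAtlas I ∞ N) :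
    l.trans φ ∈ IsManifold.maximalAtlas I ∞ N' := by
  rw [IsManifold.mem_maximalAtlas_iff_contMDiffOn] at hφ ⊢
  exact ⟨hφ.1.comp (hl.mono fun x hx => hx.1) fun x hx => hx.2,
    hl'.comp (hφ.2.mono fun x hx => hx.1) fun x hx => hx.2⟩

/-- A continuous lift of an immersion through local diffeomorphisms is an immersion. -/
theorem Manifold.IsImmersionAtOfComplement.lift [IsManifold I ∞ N] [IsManifold I ∞ N']
    [IsManifold J ∞ M] [IsManifold J ∞ M'] {F : Type*} [NormedAddCommGroup F] [NormedSpace ℝ F]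
    {l : OpenPartialHomeomorph N' N} (hl : ContMDiffOn I I ∞ l l.source)
    (hl' : ContMDiffOn I I ∞ l.symm l.target)
    {m : OpenPartialHomeomorph M' M} (hm : ContMDiffOn J J ∞ m m.source)
    (hm' : ContMDiffOn J J ∞ m.symm m.target) {e : N → M} {e' : N' → M'} {v : N'}
    (hv : v ∈ l.source) (hev : e' v ∈ m.source) (hc : ContinuousAt e' v)
    (hee' : ∀ w ∈ l.source, m (e' w) = e (l w)) (he : IsImmersionAtOfComplement F I J ∞ e (l v)) :
    IsImmersionAtOfComplement F I J ∞ e' v := by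
  refine .mk_of_continuousAt hc he.equiv (l.trans he.domChart) (m.trans he.codChart)
    ⟨hv, he.mem_domChart_source⟩ ⟨hev, ?_⟩
    (IsManifold.trans_mem_maximalAtlas hl hl' he.domChart_mem_maximalAtlas)
    (IsManifold.trans_mem_maximalAtlas hm hm' he.codChart_mem_maximalAtlas) ?_
  · change m (e' v) ∈ he.codChart.source
    rw [hee' v hv]
    exact he.mem_codChart_source
  · intro z hz
    rw [OpenPartialHomeomorph.extend_target, mem_inter_iff, mem_preimage] at hz
    obtain ⟨⟨hz1, hz2⟩, hz3⟩ := hz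
    have h1 := he.writtenInCharts (show z ∈ (he.domChart.extend I).target by
      rw [OpenPartialHomeomorph.extend_target]
      exact ⟨hz1, hz3⟩)
    rw [← h1]
    simp only [OpenPartialHomeomorph.extend_coe, OpenPartialHomeomorph.extend_coe_symm,
      Function.comp_apply, OpenPartialHomeomorph.coe_trans, OpenPartialHomeomorph.coe_trans_symm]
    rw [hee' _ (l.map_target hz2), l.right_inv hz2]

/-- In the charts of the definition `e` is the inclusion of a factor followed by a linear
isomorphism, and the chart of the source has injective differential. -/
theorem Manifold.IsImmersionAtOfComplement.mfderiv_injective {F : Type*} [NormedAddCommGroup F]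
    [NormedSpace ℝ F] {N : Type*} [TopologicalSpace N] [ChartedSpace E N] [IsManifold 𝓘(ℝ, E) ∞ N]
    [IsManifold J ∞ M] {e : N → M} {v : N} (he : IsImmersionAtOfComplement F 𝓘(ℝ, E) J ∞ e v) :
    Function.Injective (mfderiv 𝓘(ℝ, E) J e v) := by
  have hφ := (IsManifold.mem_maximalAtlas_iff_contMDiffOn _).1 he.domChart_mem_maximalAtlas
  have hφ' : he.domChart.MDifferentiable 𝓘(ℝ, E) 𝓘(ℝ, E) :=
    ⟨hφ.1.mdifferentiableOn (by simp), hφ.2.mdifferentiableOn (by simp)⟩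
  have h1 : MDifferentiableAt 𝓘(ℝ, E) J e v := he.contMDiffAt.mdifferentiableAt (by simp)
  have h2 : MDifferentiableAt J 𝓘(ℝ, E') (he.codChart.extend J) (e v) :=
    (OpenPartialHomeomorph.contMDiffAt_extend he.codChart_mem_maximalAtlas
      he.mem_codChart_source).mdifferentiableAt (by simp)
  let L : E →L[ℝ] E' :=
    (he.equiv : E × F →L[ℝ] E').comp (ContinuousLinearMap.inl ℝ E F)
  have hL : Function.Injective L := he.equiv.injective.comp fun a b h => congrArg Prod.fst h
  have h3 := L.hasMFDerivAt (x := he.domChart v) |>.comp v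
    (hφ'.mdifferentiableAt he.mem_domChart_source).hasMFDerivAt
  have h4 := h2.hasMFDerivAt.comp v h1.hasMFDerivAt
  have h5 : (he.codChart.extend J) ∘ e =ᶠ[𝓝 v] L ∘ he.domChart := by
    filter_upwards [he.domChart.open_source.mem_nhds he.mem_domChart_source] with w hw
    have h6 := he.writtenInCharts (show he.domChart w ∈ _ by
      rw [OpenPartialHomeomorph.extend_target]
      exact ⟨he.domChart.map_source hw, mem_range_self _⟩)
    simp only [OpenPartialHomeomorph.extend_coe, OpenPartialHomeomorph.extend_coe_symm,
      Function.comp_apply, modelWithCornersSelf_coe_symm, id_eq,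
      he.domChart.left_inv hw] at h6
    exact h6
  have h6 := hasMFDerivAt_unique (h3.congr_of_eventuallyEq h5) h4
  have h7 : Function.Injective (L ∘ mfderiv 𝓘(ℝ, E) 𝓘(ℝ, E) he.domChart v) :=
    hL.comp (hφ'.mfderiv_injective he.mem_domChart_source)
  intro a b hab
  refine h7 ?_
  have h8 := fun a => congrArg (fun D : E →L[ℝ] E' => D a) h6
  refine (h8 a).trans (Eq.trans ?_ (h8 b).symm)
  exact congrArg (mfderiv J 𝓘(ℝ, E') (he.codChart.extend J) (e v)) hab

end Immersions

/-! ### Compactness and orientation of the model surface -/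

section SurfaceGeometry

namespace GenusSurface

variable {h : ℕ}

/-- Outside the large disc the first factor is negative. The centres of the holes have distance at
most `h - 1` from the origin, so the point is at distance at least `2` from each of them and the
other factors are positive. -/
theorem holedDisc_neg_of_lt {x y : ℝ} (hxy : ((h : ℝ) + 1) ^ 2 < x ^ 2 + y ^ 2) :
    holedDisc h x y < 0 := by
  refine mul_neg_of_neg_of_pos (by linarith) (Finset.prod_pos fun i hi => ?_)
  have hi' : (i : ℝ) + 1 ≤ h := by exact_mod_cast Finset.mem_range.1 hi
  have hi0 : (0 : ℝ) ≤ i := i.cast_nonneg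
  set a : ℝ := 2 * i + 1 - h with ha
  have h1 : |a| ≤ h - 1 := abs_le.2 ⟨by linarith, by linarith⟩
  set r := √(x ^ 2 + y ^ 2) with hr
  have hr2 : r ^ 2 = x ^ 2 + y ^ 2 := Real.sq_sqrt (by positivity)
  have hr1 : (h : ℝ) + 1 < r := Real.lt_sqrt_of_sq_lt hxy
  have hx : |x| ≤ r := Real.abs_le_sqrt (by linarith [sq_nonneg y])
  have h3 : a * x ≤ |a| * r := by
    refine (le_abs_self _).trans ?_
    rw [abs_mul]
    exact mul_le_mul_of_nonneg_left hx (abs_nonneg _)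
  have h4 : (x - a) ^ 2 + y ^ 2 = r ^ 2 - 2 * (a * x) + |a| ^ 2 := by rw [hr2, sq_abs]; ring
  have h5 : (2 : ℝ) ^ 2 ≤ (r - |a|) ^ 2 := pow_le_pow_left₀ (by norm_num) (by linarith) 2
  linarith [sub_sq r |a|]

/-- On the surface `holedDisc` is a square, so the first two coordinates lie in the large disc,
where `holedDisc`, and with it the third coordinate, is bounded. -/
instance : CompactSpace (GenusSurface h) := by
  have hiff := isCompact_iff_compactSpace (X := EuclideanSpace ℝ (Fin 3))
    (s := {v | surfaceEq h v = 0})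
  refine hiff.1 ?_
  have hc : Continuous fun p : ℝ × ℝ => |holedDisc h p.1 p.2| := by
    unfold holedDisc
    fun_prop
  obtain ⟨m, hm⟩ := ((isCompact_Icc (a := -((h : ℝ) + 1)) (b := h + 1)).prod
    (isCompact_Icc (a := -((h : ℝ) + 1)) (b := h + 1))).bddAbove_image hc.continuousOn
  refine Metric.isCompact_of_isClosed_isBounded
    (isClosed_singleton.preimage (contDiff_surfaceEq h).continuous)
    ((Metric.isBounded_closedBall (x := (0 : EuclideanSpace ℝ (Fin 3)))
      (r := √(((h : ℝ) + 1) ^ 2 + m))).subset fun v hv => ?_)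
  have h1 : v 2 ^ 2 = holedDisc h (v 0) (v 1) := sub_eq_zero.1 hv
  have h2 : v 0 ^ 2 + v 1 ^ 2 ≤ ((h : ℝ) + 1) ^ 2 := by
    by_contra! h3
    linarith [holedDisc_neg_of_lt h3, sq_nonneg (v 2)]
  have hh : (0 : ℝ) ≤ h + 1 := by positivity
  have h3 := hm ⟨(v 0, v 1),
    ⟨abs_le.1 (abs_le_of_sq_le_sq (by linarith [sq_nonneg (v 1)]) hh),
      abs_le.1 (abs_le_of_sq_le_sq (by linarith [sq_nonneg (v 0)]) hh)⟩, rfl⟩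
  rw [mem_closedBall_zero_iff, EuclideanSpace.norm_eq]
  refine Real.sqrt_le_sqrt ?_
  simp only [Fin.sum_univ_three, Real.norm_eq_abs, sq_abs]
  linarith [le_abs_self (holedDisc h (v 0) (v 1)), h3]

theorem contMDiff_coe : ContMDiff (𝓡 2) 𝓘(ℝ, EuclideanSpace ℝ (Fin 3)) ∞
    (Subtype.val : GenusSurface h → EuclideanSpace ℝ (Fin 3)) := by
  intro v
  rw [contMDiffAt_iff_source, contMDiffWithinAt_iff_contDiffWithinAt]
  exact ((contDiffOn_coe_chart_symm v).contDiffAt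
    ((chart v).open_target.mem_nhds ((chart v).map_source (mem_ambientChart_source v)))).contDiffWithinAt

/-- The charts of the surface are restrictions of linear maps of `ℝ³`. -/
theorem contMDiffAt_of_coe {E H N : Type*} [NormedAddCommGroup E] [NormedSpace ℝ E]
    [TopologicalSpace H] {I : ModelWithCorners ℝ E H} [TopologicalSpace N] [ChartedSpace H N]
    {φ : N → GenusSurface h} {x : N} (hc : ContinuousAt φ x)
    (hφ : ContMDiffAt I 𝓘(ℝ, EuclideanSpace ℝ (Fin 3)) ∞ (fun y => (φ y).1) x) :
    ContMDiffAt I (𝓡 2) ∞ φ x := by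
  rw [contMDiffAt_iff_target]
  exact ⟨hc, ((contDiff_fst.comp (frame (φ x)).contDiff).contMDiff.contMDiffAt).comp x hφ⟩

theorem contMDiff_antipode :
    ContMDiff (𝓡 2) (𝓡 2) ∞ (antipode : GenusSurface h → GenusSurface h) := fun v =>
  contMDiffAt_of_coe continuous_antipode.continuousAt (contMDiff_coe.neg v)

/-- The differential of the inclusion of the surface into `ℝ³`. -/
noncomputable def tangentMap (v : GenusSurface h) :
    EuclideanSpace ℝ (Fin 2) →L[ℝ] EuclideanSpace ℝ (Fin 3) :=
  mfderiv (𝓡 2) 𝓘(ℝ, EuclideanSpace ℝ (Fin 3)) Subtype.val v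

theorem hasMFDerivAt_coe (v : GenusSurface h) :
    HasMFDerivAt (𝓡 2) 𝓘(ℝ, EuclideanSpace ℝ (Fin 3)) Subtype.val v (tangentMap v) :=
  ((contMDiff_coe v).mdifferentiableAt (by simp)).hasMFDerivAt

/-- The chart about `v` factors through the inclusion into `ℝ³`, and its differential is injective.
-/
theorem tangentMap_injective (v : GenusSurface h) : Function.Injective (tangentMap v) := by
  have h1 := ((mdifferentiable_chart (I := 𝓡 2) v).mfderiv_injective
    (mem_chart_source (EuclideanSpace ℝ (Fin 2)) v))
  have h2 : HasMFDerivAt (𝓡 2) (𝓡 2) (chart v) v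
      (((ContinuousLinearMap.fst ℝ (EuclideanSpace ℝ (Fin 2)) ℝ).comp
        (frame v : EuclideanSpace ℝ (Fin 3) →L[ℝ] EuclideanSpace ℝ (Fin 2) × ℝ)).comp
        (tangentMap v)) :=
    (ContinuousLinearMap.hasMFDerivAt ((ContinuousLinearMap.fst ℝ (EuclideanSpace ℝ (Fin 2)) ℝ).comp
        (frame v : EuclideanSpace ℝ (Fin 3) →L[ℝ] EuclideanSpace ℝ (Fin 2) × ℝ))).comp v
      (hasMFDerivAt_coe v)
  intro a b hab
  refine h1 ?_
  have h3 : mfderiv (𝓡 2) (𝓡 2) (chart v) v = _ := h2.mfderiv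
  change mfderiv (𝓡 2) (𝓡 2) (chart v) v a = mfderiv (𝓡 2) (𝓡 2) (chart v) v b
  rw [h3]
  exact congrArg (fun w => (frame v w).1) hab

theorem fderiv_surfaceEq_tangentMap (v : GenusSurface h) (w : EuclideanSpace ℝ (Fin 2)) :
    fderiv ℝ (surfaceEq h) v.1 (tangentMap v w) = 0 := by
  have h1 := (((contDiff_surfaceEq h).differentiable (by simp) v.1).hasFDerivAt.hasMFDerivAt).comp v
    (hasMFDerivAt_coe v)
  have h2 : surfaceEq h ∘ (Subtype.val : GenusSurface h → EuclideanSpace ℝ (Fin 3)) =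
      fun _ => 0 := funext fun v => v.2
  rw [h2] at h1
  have h3 := hasMFDerivAt_unique h1 (hasMFDerivAt_const 0 v)
  exact congrArg (fun D : EuclideanSpace ℝ (Fin 2) →L[ℝ] ℝ => D w) h3

/-- The gradient of the defining equation. -/
noncomputable def normal (v : EuclideanSpace ℝ (Fin 3)) (h : ℕ) : EuclideanSpace ℝ (Fin 3) :=
  (InnerProductSpace.toDual ℝ _).symm (fderiv ℝ (surfaceEq h) v)

theorem continuous_normal : Continuous fun v => normal v h :=
  (InnerProductSpace.toDual ℝ _).symm.continuous.comp
    ((contDiff_surfaceEq h).continuous_fderiv (by simp))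

/-- The gradient of an even function is odd. -/
theorem normal_neg (v : EuclideanSpace ℝ (Fin 3)) : normal (-v) h = -normal v h := by
  have h1 : HasFDerivAt (surfaceEq h) (-fderiv ℝ (surfaceEq h) (-v)) v := by
    have h2 := ((contDiff_surfaceEq h).differentiable (by simp) (-v)).hasFDerivAt.comp v
      (hasFDerivAt_id v).neg
    refine (h2.congr_of_eventuallyEq (.of_forall fun w => (surfaceEq_neg h w).symm)).congr_fderiv ?_
    ext w
    simp
  rw [normal, normal, h1.fderiv, map_neg, neg_neg]

theorem normal_ne_zero (v : GenusSurface h) : normal v.1 h ≠ 0 := by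
  rw [normal, Ne, LinearIsometryEquiv.map_eq_zero_iff]
  exact fderiv_surfaceEq_ne_zero v.2

/-- The oriented area form on the surface, determined by the gradient of its equation. -/
noncomputable def areaForm (v : GenusSurface h) : EuclideanSpace ℝ (Fin 2) [⋀^Fin 2]→ₗ[ℝ] ℝ :=
  ((EuclideanSpace.basisFun (Fin 3) ℝ).toBasis.det.curryLeft (normal v.1 h)).compLinearMap
    (tangentMap v).toLinearMap

theorem areaForm_apply (v : GenusSurface h) (w : Fin 2 → EuclideanSpace ℝ (Fin 2)) :
    areaForm v w = (EuclideanSpace.basisFun (Fin 3) ℝ).toBasis.det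
      (Matrix.vecCons (normal v.1 h) (tangentMap v ∘ w)) := rfl

/-- The differential of the equation vanishes on tangent vectors but not on the gradient, where it
is the square of the norm. So the gradient and a basis of the tangent plane form a basis of `ℝ³`. -/
theorem areaForm_ne_zero (v : GenusSurface h) : areaForm v ≠ 0 := by
  let b := (EuclideanSpace.basisFun (Fin 2) ℝ).toBasis
  intro h0
  have h1 : areaForm v b = 0 := by rw [h0]; rfl
  rw [areaForm_apply] at h1
  have h2 : LinearIndependent ℝ (Matrix.vecCons (normal v.1 h) (tangentMap v ∘ b)) := by
    refine linearIndependent_finCons.2 ⟨?_, ?_⟩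
    · exact b.linearIndependent.map' (tangentMap v).toLinearMap
        (LinearMap.ker_eq_bot.2 (tangentMap_injective v))
    · intro hmem
      have h3 : Submodule.span ℝ (range (tangentMap v ∘ b)) ≤
          LinearMap.ker (fderiv ℝ (surfaceEq h) v.1).toLinearMap := by
        rw [Submodule.span_le]
        rintro _ ⟨i, rfl⟩
        exact fderiv_surfaceEq_tangentMap v (b i)
      have h4 : fderiv ℝ (surfaceEq h) v.1 (normal v.1 h) = 0 := h3 hmem
      rw [← InnerProductSpace.toDual_symm_apply (𝕜 := ℝ)] at h4
      exact normal_ne_zero v (inner_self_eq_zero.1 h4)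
  have h3 := (EuclideanSpace.basisFun (Fin 3) ℝ).toBasis.is_basis_iff_det.1
    ⟨h2, h2.span_eq_top_of_card_eq_finrank (by simp)⟩
  exact h3.ne_zero h1

theorem tangentMap_antipode (v : GenusSurface h) (w : EuclideanSpace ℝ (Fin 2)) :
    tangentMap (antipode v) (mfderiv (𝓡 2) (𝓡 2) antipode v w) = -tangentMap v w := by
  have h1 := (hasMFDerivAt_coe (antipode v)).comp v
    ((contMDiff_antipode v).mdifferentiableAt (by simp)).hasMFDerivAt
  have h2 := (hasMFDerivAt_coe v).neg
  exact congrArg (fun D : EuclideanSpace ℝ (Fin 2) →L[ℝ] EuclideanSpace ℝ (Fin 3) => D w)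
    (hasMFDerivAt_unique h1 h2)

/-- The antipodal map reverses the orientation of the surface. -/
theorem areaForm_antipode (v : GenusSurface h) (w : Fin 2 → EuclideanSpace ℝ (Fin 2)) :
    areaForm (antipode v) (fun i => mfderiv (𝓡 2) (𝓡 2) antipode v (w i)) = -areaForm v w := by
  refine (areaForm_apply _ _).trans ?_
  rw [areaForm_apply]
  -- The antipodal map negates the normal as well as both tangent vectors; three signs leave `-1`.
  have h1 : Matrix.vecCons (normal (antipode v).1 h)
      (tangentMap (antipode v) ∘ fun i => mfderiv (𝓡 2) (𝓡 2) antipode v (w i)) =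
      fun i => (-1 : ℝ) • Matrix.vecCons (normal v.1 h) (tangentMap v ∘ w) i := by
    ext1 i
    refine Fin.cases ?_ (fun i => ?_) i
    · rw [_root_.neg_one_smul ℝ]
      exact normal_neg v.1
    · rw [_root_.neg_one_smul ℝ]
      exact tangentMap_antipode v (w i)
  rw [h1, AlternatingMap.map_smul_univ]
  simp only [Finset.prod_const, Finset.card_univ, Fintype.card_fin, smul_eq_mul]
  ring

end GenusSurface

theorem ContMDiff.continuousAt_mfderiv_section {E H E' H' M N : Type*} [NormedAddCommGroup E]
    [NormedSpace ℝ E] [TopologicalSpace H] {I : ModelWithCorners ℝ E H} [TopologicalSpace N]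
    [ChartedSpace H N] [IsManifold I 1 N] [NormedAddCommGroup E'] [NormedSpace ℝ E']
    [TopologicalSpace H'] {J : ModelWithCorners ℝ E' H'} [TopologicalSpace M] [ChartedSpace H' M]
    [IsManifold J 1 M] {φ : N → M} (hφ : ContMDiff I J ∞ φ) {w : (x : N) → TangentSpace I x} {x : N}
    (hw : ContinuousAt (fun y => (⟨y, w y⟩ : TangentBundle I N)) x) :
    ContinuousAt (fun y => (⟨φ y, mfderiv I J φ y (w y)⟩ : TangentBundle J M)) x :=
  (hφ.continuous_tangentMap (by simp)).continuousAt.comp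
    (f := fun y => (⟨y, w y⟩ : TangentBundle I N)) hw

theorem FiberBundle.continuousAt_extend {E H M : Type*} [NormedAddCommGroup E]
    [NormedSpace ℝ E] [TopologicalSpace H] {I : ModelWithCorners ℝ E H} [TopologicalSpace M]
    [ChartedSpace H M] [IsManifold I 1 M] {x : M} (v : TangentSpace I x) :
    ContinuousAt (fun y => (⟨y, FiberBundle.extend E v y⟩ : TangentBundle I M)) x := by
  let t := trivializationAt E (TangentSpace I : M → Type _) x
  have hx : x ∈ t.baseSet := FiberBundle.mem_baseSet_trivializationAt' x
  have h1 : ContinuousAt (fun y => t.toOpenPartialHomeomorph.symm (y, (t ⟨x, v⟩).2)) x := by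
    refine ContinuousAt.comp (f := fun y => (y, (t ⟨x, v⟩).2))
      (t.toOpenPartialHomeomorph.continuousAt_symm ?_) (by fun_prop)
    exact t.mem_target.2 hx
  refine h1.congr ?_
  filter_upwards [t.open_baseSet.mem_nhds hx] with y hy
  exact (t.mk_symm hy _).symm

end SurfaceGeometry

/-! ### The double covering of the non-orientable model surface -/

section CrosscapCovering

namespace CrosscapSurface

variable {g : ℕ}

theorem isLocalHomeomorph_proj : IsLocalHomeomorph (proj : GenusSurface (g - 1) → CrosscapSurface g) :=
  (isQuotientCoveringMap_quotientMk_of_properlyDiscontinuousSMul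
    (G := ℤˣ) (E := GenusSurface (g - 1))).isCoveringMap.isLocalHomeomorph

theorem proj_surjective : Function.Surjective (proj : GenusSurface (g - 1) → CrosscapSurface g) :=
  Quotient.mk_surjective

theorem eq_or_eq_antipode {v w : GenusSurface (g - 1)} (h : proj (g := g) v = proj w) :
    v = w ∨ v = GenusSurface.antipode w := by
  obtain ⟨a, ha⟩ : ∃ a : ℤˣ, a • w = v := Quotient.exact h
  rcases Int.units_eq_one_or a with rfl | rfl
  · exact Or.inl (by rw [← ha, one_smul])
  · exact Or.inr (by rw [← ha, GenusSurface.neg_one_smul])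

theorem proj_antipode (v : GenusSurface (g - 1)) :
    proj (g := g) (GenusSurface.antipode v) = proj v :=
  Quotient.sound (s := MulAction.orbitRel ℤˣ (GenusSurface (g - 1)))
    ⟨-1, GenusSurface.neg_one_smul v⟩

/-- The atlas of `N_g` uses one selected local inverse of the covering at each point. Any other
differs from it locally by the action of `±1`, which is smooth, so it is just as good. -/
theorem trans_chart_mem_maximalAtlas
    {l : OpenPartialHomeomorph (CrosscapSurface g) (GenusSurface (g - 1))}
    (hl : (l.symm : _ → _) = proj) (p : GenusSurface (g - 1)) :
    l.trans (GenusSurface.chart p) ∈ IsManifold.maximalAtlas (𝓡 2) ∞ (CrosscapSurface g) := by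
  rw [IsManifold.mem_maximalAtlas_iff, mem_maximalAtlas_iff]
  rintro _ ⟨q, rfl⟩
  have h1 := fun (l l' : OpenPartialHomeomorph (CrosscapSurface g) (GenusSurface (g - 1)))
    (hl : (l.symm : _ → _) = proj) (hl' : (l'.symm : _ → _) = proj) p q =>
    (contDiff_transition l l' hl hl' p q)
  have h2 := fun (e e' : OpenPartialHomeomorph (CrosscapSurface g) (EuclideanSpace ℝ (Fin 2)))
      (h : ContDiffOn ℝ ∞ (e.symm.trans e') (e.symm.trans e').source)
      (h' : ContDiffOn ℝ ∞ (e'.symm.trans e) (e'.symm.trans e).source) =>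
    show e.symm.trans e' ∈ contDiffGroupoid ∞ (𝓡 2) by
      rw [contDiffGroupoid, mem_groupoid_of_pregroupoid]
      refine ⟨?_, ?_⟩
      · exact h.mono (by simp [mfld_simps])
      · exact h'.mono (by simp [mfld_simps])
  have h3 := IsLocalHomeomorph.localInverseAt_symm (isLocalHomeomorph_proj (g := g))
  exact ⟨h2 _ _ (h1 _ _ hl (h3 _) _ _) (h1 _ _ (h3 _) hl _ _),
    h2 _ _ (h1 _ _ (h3 _) hl _ _) (h1 _ _ hl (h3 _) _ _)⟩

theorem contMDiffOn_localInverse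
    {l : OpenPartialHomeomorph (CrosscapSurface g) (GenusSurface (g - 1))}
    (hl : (l.symm : _ → _) = proj) :
    ContMDiffOn (𝓡 2) (𝓡 2) ∞ l l.source ∧ ContMDiffOn (𝓡 2) (𝓡 2) ∞ l.symm l.target := by
  constructor
  · intro x hx
    have h1 := IsManifold.mem_maximalAtlas_iff_contMDiffOn _ |>.1
      (trans_chart_mem_maximalAtlas hl (l x))
    have hx' : l x ∈ (GenusSurface.chart (l x)).source := GenusSurface.mem_ambientChart_source _
    have h2 : ContMDiffAt (𝓡 2) (𝓡 2) ∞ (l.trans (GenusSurface.chart (l x))) x :=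
      h1.1.contMDiffAt ((OpenPartialHomeomorph.open_source _).mem_nhds ⟨hx, hx'⟩)
    have h3 : ContMDiffAt (𝓡 2) (𝓡 2) ∞ (GenusSurface.chart (l x)).symm
        (l.trans (GenusSurface.chart (l x)) x) :=
      (contMDiffOn_chart_symm (I := 𝓡 2) (H := EuclideanSpace ℝ (Fin 2)) (n := ∞)
        (x := l x)).contMDiffAt
        ((GenusSurface.chart (l x)).open_target.mem_nhds ((GenusSurface.chart (l x)).map_source hx'))
    refine ((h3.comp x h2).congr_of_eventuallyEq ?_).contMDiffWithinAt
    filter_upwards [l.open_source.mem_nhds hx, (l.continuousAt hx).preimage_mem_nhds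
      ((GenusSurface.chart (l x)).open_source.mem_nhds hx')] with y hy hy'
    exact ((GenusSurface.chart (l x)).left_inv hy').symm
  · intro v hv
    have h1 := IsManifold.mem_maximalAtlas_iff_contMDiffOn _ |>.1
      (trans_chart_mem_maximalAtlas hl v)
    have hv' : v ∈ (GenusSurface.chart v).source := GenusSurface.mem_ambientChart_source _
    have h2 : ContMDiffAt (𝓡 2) (𝓡 2) ∞ (l.trans (GenusSurface.chart v)).symm
        (GenusSurface.chart v v) :=
      h1.2.contMDiffAt ((OpenPartialHomeomorph.open_target _).mem_nhds
        ⟨(GenusSurface.chart v).map_source hv', by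
          rw [mem_preimage, (GenusSurface.chart v).left_inv hv']
          exact hv⟩)
    have h3 : ContMDiffAt (𝓡 2) (𝓡 2) ∞ (GenusSurface.chart v) v :=
      (contMDiffOn_chart (I := 𝓡 2) (H := EuclideanSpace ℝ (Fin 2)) (n := ∞)
        (x := v)).contMDiffAt ((GenusSurface.chart v).open_source.mem_nhds hv')
    refine ((h2.comp v h3).congr_of_eventuallyEq ?_).contMDiffWithinAt
    filter_upwards [(GenusSurface.chart v).open_source.mem_nhds hv'] with y hy
    exact (congrArg l.symm ((GenusSurface.chart v).left_inv hy)).symm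

/-- Near every point, the covering `J̃` is a diffeomorphism. -/
theorem exists_localDiffeomorph (v : GenusSurface (g - 1)) :
    ∃ l : OpenPartialHomeomorph (GenusSurface (g - 1)) (CrosscapSurface g), v ∈ l.source ∧
      (l : _ → _) = proj ∧ ContMDiffOn (𝓡 2) (𝓡 2) ∞ l l.source ∧
      ContMDiffOn (𝓡 2) (𝓡 2) ∞ l.symm l.target := by
  have h1 := isLocalHomeomorph_proj (g := g)
  have h2 := contMDiffOn_localInverse (h1.localInverseAt_symm v)
  exact ⟨(h1.localInverseAt v).symm, h1.self_mem_localInverseAt_target,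
    h1.localInverseAt_symm v, h2.2, h2.1⟩

theorem contMDiff_proj : ContMDiff (𝓡 2) (𝓡 2) ∞ (proj : GenusSurface (g - 1) → CrosscapSurface g) :=
  fun v => by
    obtain ⟨l, hv, hl, hs, -⟩ := exists_localDiffeomorph (g := g) v
    rw [← hl]
    exact hs.contMDiffAt (l.open_source.mem_nhds hv)

end CrosscapSurface
end CrosscapCovering

/-! ### Identifying the fibres of the cover with the orientable model -/

section FiberCovering

open OrientationCover

theorem Module.Basis.continuousAt_det {T V : Type*} [TopologicalSpace T] [NormedAddCommGroup V]
    [NormedSpace ℝ V] {n : ℕ} (b : Module.Basis (Fin n) ℝ V) {v : T → Fin n → V} {t : T}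
    (hv : ∀ j, ContinuousAt (fun s => v s j) t) : ContinuousAt (fun s => b.det (v s)) t := by
  have : FiniteDimensional ℝ V := b.finiteDimensional_of_finite
  have h1 : ∀ i j, ContinuousAt (fun s => b.toMatrix (v s) i j) t := fun i j => by
    simp only [Module.Basis.toMatrix_apply]
    exact (LinearMap.continuous_of_finiteDimensional (b.coord i)).continuousAt.comp (hv j)
  simp only [Module.Basis.det_apply]
  exact (Continuous.matrix_det continuous_id).continuousAt.comp
    (continuousAt_pi.2 fun i => continuousAt_pi.2 fun j => h1 i j)

theorem GenusSurface.continuousAt_areaForm {h : ℕ} {v : GenusSurface h}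
    {w : GenusSurface h → Fin 2 → EuclideanSpace ℝ (Fin 2)}
    (hw : ∀ i, ContinuousAt (fun y => (⟨y, w y i⟩ : TangentBundle (𝓡 2) (GenusSurface h))) v) :
    ContinuousAt (fun y => GenusSurface.areaForm y (w y)) v := by
  have h1 : ∀ i, ContinuousAt (fun y => GenusSurface.tangentMap y (w y i)) v := fun i =>
    (contMDiff_snd_tangentBundle_modelSpace (n := 0) (EuclideanSpace ℝ (Fin 3))
      𝓘(ℝ, EuclideanSpace ℝ (Fin 3))).continuous.continuousAt.comp
      (GenusSurface.contMDiff_coe.continuousAt_mfderiv_section (hw i))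
  simp only [GenusSurface.areaForm_apply]
  refine Module.Basis.continuousAt_det _ fun j => ?_
  refine Fin.cases ?_ (fun j => h1 j) j
  exact (GenusSurface.continuous_normal.comp continuous_subtype_val).continuousAt

variable {X S : Type*} [TopologicalSpace X] [ChartedSpace (EuclideanHalfSpace 4) X]
  [IsManifold (𝓡∂ 4) ∞ X] [TopologicalSpace S] [ChartedSpace (EuclideanHalfSpace 2) S]
  [IsManifold (𝓡∂ 2) ∞ S]

theorem OrientationCover.mk_congr {x x' : X} (hx : x = x')
    (o : Orientation ℝ (EuclideanSpace ℝ (Fin 4)) (Fin 4)) :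
    (OrientationCover.mk x o : OrientationCover (𝓡∂ 4) X) = OrientationCover.mk x' o := by
  rw [hx]

/-- The projection of the orientation cover is a local diffeomorphism. -/
theorem OrientationCover.exists_localDiffeomorph (p : OrientationCover (𝓡∂ 4) X) :
    ∃ m : OpenPartialHomeomorph (OrientationCover (𝓡∂ 4) X) X, p ∈ m.source ∧
      (m : _ → _) = OrientationCover.proj ∧ ContMDiffOn (𝓡∂ 4) (𝓡∂ 4) ∞ m m.source ∧
      ContMDiffOn (𝓡∂ 4) (𝓡∂ 4) ∞ m.symm m.target := by
  have hπ : IsLocalHomeomorph (OrientationCover.proj : OrientationCover (𝓡∂ 4) X → X) :=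
    isLocalHomeomorph_proj
  obtain ⟨m, hp, hm⟩ := hπ p
  refine ⟨m, hp, hm.symm, ?_, contMDiffOn_comp_symm m.continuousOn_symm fun x hx => ?_⟩
  · rw [← hm]
    exact contMDiff_proj.contMDiffOn
  · rw [hm]
    exact m.right_inv hx

/-- An identification of a regular fiber with the non-orientable surface is covered by an
identification of the fiber of the orientation cover with the orientable surface. -/
theorem IsFiberParametrization.exists_cover [T2Space X] {f : X → S}
    (hf : ContMDiff (𝓡∂ 4) (𝓡∂ 2) ∞ f) {g : ℕ} {y : S} (hy : y ∉ f '' criticalSet f)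
    {e : CrosscapSurface g → X} (he : IsFiberParametrization f y e) :
    ∃ e' : GenusSurface (g - 1) → OrientationCover (𝓡∂ 4) X,
      IsFiberParametrization (f ∘ OrientationCover.proj) y e' ∧
      ∀ v, (e' v).proj = e (CrosscapSurface.proj v) := by
  obtain ⟨⟨F, _, _, hF⟩, hemb⟩ := he.isSmoothEmbedding
  let u : GenusSurface (g - 1) → X := e ∘ CrosscapSurface.proj
  have hui : ∀ v, IsImmersionAtOfComplement F (𝓡 2) (𝓡∂ 4) ∞ u v := fun v => by
    obtain ⟨l, hv, hl, hl1, hl2⟩ := CrosscapSurface.exists_localDiffeomorph (g := g) v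
    refine Manifold.IsImmersionAtOfComplement.lift hl1 hl2 (m := OpenPartialHomeomorph.refl X)
      contMDiffOn_id contMDiffOn_id hv (mem_univ _) ?_ (fun w _ => ?_) (hF (l v))
    · exact hemb.continuous.continuousAt.comp CrosscapSurface.contMDiff_proj.continuous.continuousAt
    · rw [hl]
      rfl
  have hu : ContMDiff (𝓡 2) (𝓡∂ 4) ∞ u := fun v => (hui v).contMDiffAt
  let i : GenusSurface (g - 1) → EuclideanSpace ℝ (Fin 2) →L[ℝ] EuclideanSpace ℝ (Fin 4) :=
    fun v => mfderiv (𝓡 2) (𝓡∂ 4) u v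
  let d : X → EuclideanSpace ℝ (Fin 4) →L[ℝ] EuclideanSpace ℝ (Fin 2) :=
    fun x => mfderiv (𝓡∂ 4) (𝓡∂ 2) f x
  have hi : ∀ v, HasMFDerivAt (𝓡 2) (𝓡∂ 4) u v (i v) := fun v =>
    ((hu v).mdifferentiableAt (by simp)).hasMFDerivAt
  have hd : ∀ x, HasMFDerivAt (𝓡∂ 4) (𝓡∂ 2) f x (d x) := fun x =>
    ((hf x).mdifferentiableAt (by simp)).hasMFDerivAt
  have hfu : ∀ v, f (u v) = y := fun v => he.range_eq.le (mem_range_self _)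
  have hdi : ∀ v w, d (u v) (i v w) = 0 := fun v w => by
    have h1 := (hd (u v)).comp v (hi v)
    rw [show f ∘ u = fun _ => y from funext hfu] at h1
    exact congrArg (fun D : EuclideanSpace ℝ (Fin 2) →L[ℝ] EuclideanSpace ℝ (Fin 2) => D w)
      (hasMFDerivAt_unique h1 (hasMFDerivAt_const y v))
  have hds : ∀ v, Function.Surjective (d (u v)) := fun v => by
    by_contra h
    exact hy ⟨u v, h, hfu v⟩
  let b₀ := (EuclideanSpace.basisFun (Fin 2) ℝ).toBasis
  let ρ := b₀.det
  have hρ : ρ ≠ 0 := b₀.det_ne_zero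
  -- At a regular point the tangent space of `X` is an extension of that of the base by that of the
  -- surface. The area form and one fixed orientation of the tangent space at `y` orient it.
  have hex := fun v => exists_orientation_append (i := (i v).toLinearMap) (π := (d (u v)).toLinearMap)
    (hui v).mfderiv_injective (hds v) (hdi v) (by simp) (by simp) (by simp)
    (GenusSurface.areaForm_ne_zero v) hρ
  choose o ho using fun v => (hex v).1
  let e' : GenusSurface (g - 1) → OrientationCover (𝓡∂ 4) X := fun v => OrientationCover.mk (u v) (o v)
  have hproj : ∀ v, (e' v).proj = u v := fun v => rfl
  have hcont : Continuous e' := by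
    refine continuous_iff_continuousAt.2 fun v => ?_
    -- A positive pair of frames at `v` is extended to continuous fields. Positivity persists
    -- nearby, so these fields compute the chosen orientations and `continuousAt_of_frame` applies.
    obtain ⟨w₀, R₀, hpos⟩ := (hex v).2
    let w : GenusSurface (g - 1) → Fin 2 → EuclideanSpace ℝ (Fin 2) := fun t j =>
      FiberBundle.extend (EuclideanSpace ℝ (Fin 2)) (E := TangentSpace (𝓡 2)) (x := v) (w₀ j) t
    let R : X → Fin 2 → EuclideanSpace ℝ (Fin 4) := fun x j =>
      FiberBundle.extend (EuclideanSpace ℝ (Fin 4)) (E := TangentSpace (𝓡∂ 4)) (x := u v) (R₀ j) x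
    have hw : ∀ j, ContinuousAt (fun t => (⟨t, w t j⟩ : TangentBundle (𝓡 2) (GenusSurface (g - 1)))) v :=
      fun j => FiberBundle.continuousAt_extend (I := 𝓡 2) (x := v) (w₀ j)
    have hR : ∀ j, ContinuousAt (fun x => (⟨x, R x j⟩ : TangentBundle (𝓡∂ 4) X)) (u v) :=
      fun j => FiberBundle.continuousAt_extend (I := 𝓡∂ 4) (x := u v) (R₀ j)
    have hdR : ∀ j, ContinuousAt (fun t => d (u t) (R (u t) j)) v := fun j => by
      have h1 : ContinuousAt (fun t => (⟨f (u t), d (u t) (R (u t) j)⟩ : TangentBundle (𝓡∂ 2) S)) v :=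
        (hf.continuousAt_mfderiv_section (hR j)).comp (f := u) hu.continuous.continuousAt
      have h2 : ∀ t, (⟨f (u t), d (u t) (R (u t) j)⟩ : TangentBundle (𝓡∂ 2) S) =
          (⟨y, d (u t) (R (u t) j)⟩ : TangentBundle (𝓡∂ 2) S) := fun t => by
        have h3 : ∀ {a b : S} (h : a = b) (ξ : EuclideanSpace ℝ (Fin 2)),
          (⟨a, ξ⟩ : TangentBundle (𝓡∂ 2) S) = ⟨b, ξ⟩ := by rintro a _ rfl ξ; rfl
        exact h3 (hfu t) _
      simp only [h2] at h1
      exact (FiberBundle.totalSpaceMk_isInducing (EuclideanSpace ℝ (Fin 2))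
        (TangentSpace (𝓡∂ 2) : S → Type _) y).continuousAt_iff.2 h1
    have hev : ∀ᶠ t in 𝓝 v, 0 < GenusSurface.areaForm t (w t) * ρ (d (u t) ∘ R (u t)) := by
      refine ((GenusSurface.continuousAt_areaForm hw).mul (b₀.continuousAt_det hdR)).eventually (lt_mem_nhds ?_)
      have h1 : w v = w₀ := funext fun j =>
        FiberBundle.extend_apply_self (EuclideanSpace ℝ (Fin 2)) (E := TangentSpace (𝓡 2)) (x := v) (w₀ j)
      have h2 : R (u v) = R₀ := funext fun j =>
        FiberBundle.extend_apply_self (EuclideanSpace ℝ (Fin 4)) (E := TangentSpace (𝓡∂ 4)) (x := u v)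
          (R₀ j)
      change 0 < GenusSurface.areaForm v (w v) * ρ (d (u v) ∘ R (u v))
      rw [h1, h2]
      exact hpos
    refine continuousAt_of_frame
      (fun t => Fin.append (m := 2) (n := 2) (i t ∘ w t) (R (u t))) (fun j => ?_) ?_
      hu.continuous.continuousAt
    · refine Fin.addCases (m := 2) (n := 2) (fun j => ?_) (fun j => ?_) j
      · simp only [Fin.append_left]
        exact hu.continuousAt_mfderiv_section (hw j)
      · simp only [Fin.append_right]
        exact (hR j).comp (f := u) hu.continuous.continuousAt
    · filter_upwards [hev] with t ht
      exact ho t (w t) (R (u t)) ht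
  have hua : ∀ v, u (GenusSurface.antipode v) = u v := fun v =>
    congrArg e (CrosscapSurface.proj_antipode v)
  have hia : ∀ v w, i (GenusSurface.antipode v) (mfderiv (𝓡 2) (𝓡 2) GenusSurface.antipode v w) =
      i v w := fun v w => by
    have h1 := (hi (GenusSurface.antipode v)).comp v
      ((GenusSurface.contMDiff_antipode v).mdifferentiableAt (by simp)).hasMFDerivAt
    rw [show u ∘ GenusSurface.antipode = u from funext hua] at h1
    exact congrArg (fun D : EuclideanSpace ℝ (Fin 2) →L[ℝ] EuclideanSpace ℝ (Fin 4) => D w)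
      (hasMFDerivAt_unique h1 (hi v))
  -- At `v` and its antipode the two tangent planes have the same image in the tangent space of `X`,
  -- but the area forms give it opposite orientations.
  have hanti : ∀ v, e' (GenusSurface.antipode v) ≠ e' v := by
    intro v heq
    obtain ⟨w, R, hpos⟩ := (hex v).2
    obtain ⟨B, hB, hoB⟩ := ho v w R hpos
    let J : EuclideanSpace ℝ (Fin 2) →L[ℝ] EuclideanSpace ℝ (Fin 2) :=
      mfderiv (𝓡 2) (𝓡 2) GenusSurface.antipode v
    -- The differential of the antipodal map changes the sign of the area form; negating the first
    -- vector restores it. The resulting bases of the tangent space of `X` differ in the sign of one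
    -- vector.
    let w' : Fin 2 → EuclideanSpace ℝ (Fin 2) := Function.update (J ∘ w) 0 (-J (w 0))
    have hw' : GenusSurface.areaForm (GenusSurface.antipode v) w' = GenusSurface.areaForm v w := by
      have h1 := (GenusSurface.areaForm (GenusSurface.antipode v)).map_update_neg (J ∘ w) 0 (J (w 0))
      have h2 : Function.update (J ∘ w) 0 (J (w 0)) = J ∘ w := Function.update_eq_self 0 (J ∘ w)
      rw [h2] at h1
      exact h1.trans ((congrArg Neg.neg (GenusSurface.areaForm_antipode v w)).trans (neg_neg _))
    obtain ⟨B', hB', hoB'⟩ := ho (GenusSurface.antipode v) w' R (by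
      rw [hw', hua]
      exact hpos)
    have h1 : ⇑B' = Function.update B 0 (-B 0) := by
      have h2 : ∀ j, i (GenusSurface.antipode v) (J (w j)) = i v (w j) := fun j => hia v (w j)
      rw [hB', hB]
      ext1 j
      fin_cases j
      · change i (GenusSurface.antipode v) (-J (w 0)) = -i v (w 0)
        rw [map_neg, h2]
      · exact h2 1
      · rfl
      · rfl
    refine orientation_ne_of_neg h1 ?_
    rw [← hoB, ← hoB']
    refine (mk_injective (I := 𝓡∂ 4) (u v) ?_).symm
    exact (OrientationCover.mk_congr (hua v) _).symm.trans heq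
  have hflip : ∀ v, e' (GenusSurface.antipode v) = (e' v).flip := fun v =>
    (eq_or_eq_flip (p := e' (GenusSurface.antipode v)) (q := e' v) (hua v)).resolve_left
      (hanti v)
  have hinj : Function.Injective e' := by
    intro v w hvw
    have h1 : u v = u w := congrArg OrientationCover.proj hvw
    rcases CrosscapSurface.eq_or_eq_antipode (hemb.injective h1) with h2 | h2
    · exact h2
    · rw [h2] at hvw
      exact (hanti w hvw).elim
  have : T2Space (OrientationCover (𝓡∂ 4) X) := t2Space
  have himm : IsImmersionOfComplement F (𝓡 2) (𝓡∂ 4) ∞ e' := fun v => by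
    obtain ⟨l, hv, hl, hl1, hl2⟩ := CrosscapSurface.exists_localDiffeomorph (g := g) v
    obtain ⟨m, hm, hmp, hm1, hm2⟩ := OrientationCover.exists_localDiffeomorph (e' v)
    refine Manifold.IsImmersionAtOfComplement.lift hl1 hl2 hm1 hm2 hv hm hcont.continuousAt
      (fun w _ => ?_) (hF (l v))
    rw [hmp, hl, hproj]
    rfl
  -- A continuous injection of a compact space into a Hausdorff space is a closed embedding.
  refine ⟨e', ⟨⟨himm.isImmersion, (hcont.isClosedEmbedding hinj).isEmbedding⟩, ?_⟩, hproj⟩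
  ext p
  constructor
  · rintro ⟨v, rfl⟩
    exact hfu v
  · intro hp
    obtain ⟨z, hz⟩ := he.range_eq.ge hp
    obtain ⟨v, rfl⟩ := CrosscapSurface.proj_surjective z
    rcases eq_or_eq_flip ((hproj v).trans hz) with h1 | h1
    · exact ⟨v, h1⟩
    · refine ⟨GenusSurface.antipode v, ?_⟩
      rw [hflip, h1, OrientationCover.flip_flip]

end FiberCovering

theorem proposition3p1 {X S : Type*}
    [TopologicalSpace X] [ChartedSpace (EuclideanHalfSpace 4) X] [IsManifold (𝓡∂ 4) ∞ X]
    [TopologicalSpace S] [ChartedSpace (EuclideanHalfSpace 2) S] [IsManifold (𝓡∂ 2) ∞ S]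
    (g : ℕ) (f : X → S) (hf : IsNonorientableLefschetzFibration g f) :
    -- `f ∘ π` is a Lefschetz fibration of genus `g - 1`, achiral if there are critical points;
    -- each identification of a regular fibre of `f` with `N_g` is covered by an identification
    -- of the fibre of `f ∘ π` with `Σ_{g-1}`
    IsLefschetzFibration (f ∘ (OrientationCover.proj : OrientationCover (𝓡∂ 4) X → X)) ∧
    IsOrientable (𝓡∂ 4) (OrientationCover (𝓡∂ 4) X) ∧
    ((criticalSet f).Nonempty →
      IsAchiral (f ∘ (OrientationCover.proj : OrientationCover (𝓡∂ 4) X → X))) ∧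
    (∀ y ∉ f '' criticalSet f, ∀ e : CrosscapSurface g → X, IsFiberParametrization f y e →
      ∃ e' : GenusSurface (g - 1) → OrientationCover (𝓡∂ 4) X,
        IsFiberParametrization (f ∘ OrientationCover.proj) y e' ∧
        ∀ v, (e' v).proj = e (CrosscapSurface.proj v)) ∧
    -- the inverse image of a vanishing cycle of `f` is an antipodal pair of vanishing cycles
    (∀ (p : OrientationCover (𝓡∂ 4) X) (ℓ : ℝ → S) (c : Set X),
      IsVanishingCycle f p.proj ℓ c → ∃ c₁ c₂, IsAntipodalPair g f p ℓ c c₁ c₂) ∧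
    -- every vanishing cycle of `f ∘ π` is, up to isotopy in the fibre, a member of such a pair
    (∀ (p : OrientationCover (𝓡∂ 4) X) (ℓ : ℝ → S) (c' : Set (OrientationCover (𝓡∂ 4) X)),
      IsVanishingCycle (f ∘ OrientationCover.proj) p ℓ c' →
      ∃ c c₁ c₂, IsVanishingCycle f p.proj ℓ c ∧ IsAntipodalPair g f p ℓ c c₁ c₂ ∧
        IsIsotopicIn ((f ∘ OrientationCover.proj) ⁻¹' {ℓ 1}) c' c₁) ∧
    -- vanishing cycles of `f` are two-sided
    (∀ (x₀ : X) (ℓ : ℝ → S) (c : Set X),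
      IsVanishingCycle f x₀ ℓ c → IsTwoSidedIn (f ⁻¹' {ℓ 1}) c) := by
  have hL := hf.isLefschetzFibration
  have := hL.compactSpace_total
  have := hL.t2Space_total
  have := hL.t2Space_base
  exact ⟨hf.comp_proj, OrientationCover.isOrientable, hf.isAchiral,
    fun y hy e he => he.exists_cover hL.contMDiff hy,
    fun p ℓ c hc => exists_isAntipodalPair hL.contMDiff hc,
    fun p ℓ c' hc => hc.exists_isIsotopicIn g hL.contMDiff hL.boundary_eq,
    fun x₀ ℓ c hc => hc.isTwoSidedIn hL.contMDiff.continuous⟩
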